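/- Let $(\xi_k)_{k\ge 1}$ be i.i.d. symmetric $\mathbb Z$-valued random variables, $S_n=\xi_1+\dots+\xi_n$ ($S_0=0$), whose characteristic function satisfies $\phi_{\xi_1}(s)=1-\nu s^{\beta}+o(s^{\beta})$ as $s\to0^+$, with $\beta\in(0,2]$ and $\nu>0$. Let $(\zeta_k)_{k\in\mathbb Z}$ be i.i.d. (almost surely) positive random variables, independent of $(\xi_k)$, and let $\omega_0=0$, $\omega_k-\omega_{k-1}=\zeta_k$ for $k\in\mathbb Z$. Let $\gamma\in(0,1)\cup(1,2]$, $\hat\gamma=\min\{1,\gamma\}$, and suppose that, as $\theta\to0^+$, $$\phi_{\zeta_1}(\theta)=\begin{cases}1-c\,e^{-i\pi\gamma/2}\theta^{\gamma}+o(\theta^{\gamma}), \ c>0,&\text{if }\gamma\in(0,1),\\ 1+i\mu\theta+o(\theta),\ \mu>0,&\text{if }\gamma\in(1,2].\end{cases}$$ (For $\gamma\in(1,2]$ this holds with $\mu=\mathbb E[\zeta_1]$ whenever $\zeta_1$ lies in the domain of attraction of a $\gamma$-stable law.) Put $Y_n=\omega_{S_n}$, $\mathcal T=\min\{n>0:S_n>0\}$,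 and $$\Phi(1,0)=\exp\Big(-\frac1{2\pi}\int_0^{\pi}\ln[1-\phi_{\xi_1}(t)]\,dt\Big).$$ Then $\mathcal T<\infty$ almost surely and, as $x\to\infty$, $$\mathbb P(Y_{\mathcal T}>x)\sim K\,x^{-\hat\gamma\beta/2},\qquad K=\begin{cases}\dfrac{\sqrt{\nu}\,\mu^{\beta/2}\,\Phi(1,0)}{\Gamma(1-\beta/2)}&\text{if }\gamma\in(1,2],\\[2ex]\dfrac{\sqrt{\nu}\,c^{\beta/2}\,\Phi(1,0)}{\Gamma(1-\gamma\beta/2)}&\text{if }\gamma\in(0,1),\end{cases}$$ where, in the case $\gamma\in(1,2]$, $\beta=2$, in which $1/\Gamma(0)=0$ gives $K=0$, the relation means $\mathbb P(Y_{\mathcal T}>x)=o(x^{-1})$. -/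

import Mathlib

open MeasureTheory ProbabilityTheory Filter Topology Asymptotics

noncomputable section

/-- The partial sums `S_n = ξ_1 + ⋯ + ξ_n`, `S_0 = 0`; the entry `ξ k` of the sequence is the
`(k+1)`-st increment. -/
def walk (ξ : ℕ → ℤ) (n : ℕ) : ℤ := ∑ k ∈ Finset.range n, ξ k

/-- The random medium with inter-distances `ζ`: the points `ω_k`, `k ∈ ℤ`, with
`ω_0 = 0` and `ω_k - ω_{k-1} = ζ_k` for all `k ∈ ℤ`. -/
def medium (ζ : ℤ → ℝ) (k : ℤ) : ℝ :=
  ∑ j ∈ Finset.Ioc 0 k, ζ j - ∑ j ∈ Finset.Ioc k 0, ζ j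

theorem medium_zero (ζ : ℤ → ℝ) : medium ζ 0 = 0 := by
  simp [medium]

theorem medium_sub_pred (ζ : ℤ → ℝ) (k : ℤ) : medium ζ k - medium ζ (k - 1) = ζ k := by
  unfold medium
  rcases le_or_gt k 0 with hk | hk
  · have h1 : Finset.Ioc (k - 1) 0 = insert k (Finset.Ioc k 0) := by
      ext j; simp only [Finset.mem_Ioc, Finset.mem_insert]; omega
    rw [h1, Finset.sum_insert (by simp), Finset.Ioc_eq_empty (a := 0) (b := k) (by omega),
      Finset.Ioc_eq_empty (a := 0) (b := k - 1) (by omega)]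
    simp
  · have h1 : Finset.Ioc 0 k = insert k (Finset.Ioc 0 (k - 1)) := by
      ext j; simp only [Finset.mem_Ioc, Finset.mem_insert]; omega
    rw [h1, Finset.sum_insert (by simp), Finset.Ioc_eq_empty (a := k) (b := 0) (by omega),
      Finset.Ioc_eq_empty (a := k - 1) (b := 0) (by omega)]
    simp

/-- The random walk on the random medium, `Y_n = ω_{S_n}`. -/
def mediumWalk (ξ : ℕ → ℤ) (ζ : ℤ → ℝ) (n : ℕ) : ℝ := medium ζ (walk ξ n)

/-- The first-ladder time `𝒯 = min {n > 0 : S_n > 0}` of the walk `S` with increments `ξ`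
(it is `0` if `S` never enters `(0, ∞)`). -/
def firstLadderTime (ξ : ℕ → ℤ) : ℕ := sInf {n : ℕ | 0 < n ∧ 0 < walk ξ n}

/-- The first-ladder height (leapover) `Y_𝒯`. -/
def firstLadderHeight (ξ : ℕ → ℤ) (ζ : ℤ → ℝ) : ℝ := mediumWalk ξ ζ (firstLadderTime ξ)

/-- `Φ(z, 0) = exp (-(1 / 2π) ∫_0^π log (1 - z φ(t)) dt)`, where `φ` is the characteristic
function of the increment law `m`. It is used for symmetric `m`, where `φ` is real. -/
def ladderPhi (m : Measure ℝ) (z : ℝ) : ℝ :=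
  Real.exp (-(1 / (2 * Real.pi)) *
    ∫ t in (0 : ℝ)..Real.pi, Real.log (1 - z * (charFun m t).re))

end

/-! The walk and the medium are independent, so conditioning on the walk gives `E exp(-s Y_𝒯) =
E[L(s)^(S_𝒯)]`, where `L` is the Laplace transform of `ζ` (`integral_exp_neg_firstLadderHeight`).
The tail of `Y_𝒯` is then read off from two expansions, `1 - E r^(S_𝒯)` as `r → 1-` and `1 - L(s)`
as `s → 0+`, followed by a Tauberian theorem.

The first expansion is Wiener–Hopf theory. For `z < 1`, `1 - E[z^𝒯 exp(i t S_𝒯)]` has only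
nonnegative frequencies and equals `1 - z φ(t)` times a function with only nonpositive ones
(`ladder_factorization`). Splitting `log (1 - z φ)` by the sign of `S_n` also gives a factorization,
and `wienerHopf_unique` identifies the two. By symmetry `φ` is real, and the analytic factor at
radius `r` becomes the exponential of a Poisson integral of `log (1 - z φ)`. The limit `z → 1` is
dominated, because an atom of `ξ` at some `k ≠ 0` bounds `1 - φ` below by a multiple of `sin² (k t /
2)`. This yields `ladderGen_one_eq`: `1 - E r^(S_𝒯)` is `Φ(1,0)` times the exponential of half the
Poisson average of `log (1 - φ)`.

The Poisson average of `log (2 - 2 cos t) = log |1 - exp(i t)|²` is exactly `2 log (1 - r)`, and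
`log (1 - φ) - (β/2) log (2 - 2 cos t)` tends to `log ν` at `0+`. Since the kernel concentrates at
`0`, `1 - E r^(S_𝒯) ~ √ν Φ(1,0) (1 - r)^(β/2)` (`tendsto_one_sub_ladderGen_div`). In particular the
left side, with `r^(S_𝒯)` restricted to `𝒯 < ∞`, vanishes at `r = 1`, which forces `𝒯 < ∞` almost
surely.

For the second expansion the hypothesis on the characteristic function is transferred to the Laplace
transform by integrating `1 - Re φ_ζ(s u)` against a kernel in `u` (`tendsto_laplace_of_lt_one`,
`tendsto_laplace_of_mean`). Composing the two expansions gives `1 - E exp(-s Y_𝒯) ~ C s^α` with `α =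
γ̂ β / 2`. If `α < 1`, Karamata's theorem (`tendsto_rpow_mul_tail`), proved by polynomial
approximation and monotonicity, produces the tail and the factor `1 / Γ(1 - α)`. If `α = 1`, the
mean is finite by Fatou and the tail is `o(1/x)` (`isLittleO_tail_of_tendsto`). -/

noncomputable section

open scoped BoundedContinuousFunction

/-! ### Characters, the mean over a period and the Cauchy integral. -/

/-- The character `t ↦ exp (i k t)` as a bounded continuous function. -/
def expChar (k : ℤ) : ℝ →ᵇ ℂ :=
  BoundedContinuousFunction.ofNormedAddCommGroup
    (fun t : ℝ => Complex.exp ((k * t : ℝ) * Complex.I)) (by fun_prop) 1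
    (fun t => (Complex.norm_exp_ofReal_mul_I _).le)

theorem expChar_apply (k : ℤ) (t : ℝ) :
    expChar k t = Complex.exp ((k * t : ℝ) * Complex.I) := rfl

theorem norm_expChar_apply (k : ℤ) (t : ℝ) : ‖expChar k t‖ = 1 :=
  Complex.norm_exp_ofReal_mul_I _

theorem norm_expChar_le (k : ℤ) : ‖expChar k‖ ≤ 1 :=
  (BoundedContinuousFunction.norm_le zero_le_one).2 fun t => (norm_expChar_apply k t).le

theorem expChar_zero : expChar 0 = 1 := by
  ext t; simp [expChar_apply]

theorem expChar_mul (j k : ℤ) : expChar j * expChar k = expChar (j + k) := by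
  ext t
  simp only [BoundedContinuousFunction.mul_apply, expChar_apply, ← Complex.exp_add]
  congr 1; push_cast; ring

theorem expChar_pow (k : ℤ) (n : ℕ) : expChar k ^ n = expChar (n * k) := by
  induction n with
  | zero => simp [expChar_zero]
  | succ n ih => rw [pow_succ, ih, expChar_mul]; congr 1; push_cast; ring

/-- The mean over a period. -/
def periodMean : (ℝ →ᵇ ℂ) →L[ℂ] ℂ :=
  LinearMap.mkContinuous
    { toFun := fun f => (2 * Real.pi : ℂ)⁻¹ * ∫ t in (-Real.pi)..Real.pi, f t
      map_add' := fun f g => by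
        simp only [BoundedContinuousFunction.add_apply]
        rw [intervalIntegral.integral_add (f.continuous.intervalIntegrable _ _)
          (g.continuous.intervalIntegrable _ _), mul_add]
      map_smul' := fun c f => by
        simp only [BoundedContinuousFunction.smul_apply, smul_eq_mul, RingHom.id_apply]
        rw [intervalIntegral.integral_const_mul]
        ring } 1 (fun f => by
      have hpi := Real.pi_pos
      have h := intervalIntegral.norm_integral_le_of_norm_le_const (f := fun t => f t)
        (a := -Real.pi) (b := Real.pi) (C := ‖f‖) (fun t _ => f.norm_coe_le_norm t)
      simp only [LinearMap.coe_mk, AddHom.coe_mk, norm_mul, norm_inv, Complex.norm_real,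
        Complex.norm_ofNat, Real.norm_eq_abs, abs_of_pos hpi, one_mul]
      rw [show Real.pi - -Real.pi = 2 * Real.pi by ring, abs_of_pos (by positivity)] at h
      rw [inv_mul_le_iff₀ (by positivity)]
      linarith)

theorem periodMean_apply (f : ℝ →ᵇ ℂ) :
    periodMean f = (2 * Real.pi : ℂ)⁻¹ * ∫ t in (-Real.pi)..Real.pi, f t := rfl

theorem periodMean_expChar (k : ℤ) : periodMean (expChar k) = if k = 0 then 1 else 0 := by
  have hpi : (Real.pi : ℂ) ≠ 0 := by exact_mod_cast Real.pi_ne_zero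
  rw [periodMean_apply]
  split_ifs with hk
  · subst hk
    simp only [expChar_zero, BoundedContinuousFunction.coe_one, Pi.one_apply,
      intervalIntegral.integral_const]
    rw [show Real.pi - -Real.pi = 2 * Real.pi by ring]
    simp
    field_simp
  · have hk' : (k : ℂ) * Complex.I ≠ 0 :=
      mul_ne_zero (by exact_mod_cast hk) Complex.I_ne_zero
    have h1 : ∀ t : ℝ, expChar k t = Complex.exp (k * Complex.I * t) := fun t => by
      rw [expChar_apply]; congr 1; push_cast; ring
    simp only [h1]
    rw [integral_exp_mul_complex hk']
    have : Complex.exp (k * Complex.I * Real.pi) =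
        Complex.exp (k * Complex.I * (-Real.pi : ℝ)) := by
      rw [Complex.exp_eq_exp_iff_exists_int]
      exact ⟨k, by push_cast; ring⟩
    rw [this]; simp

theorem summable_cauchyKernel {r : ℝ} (h0 : 0 ≤ r) (h1 : r < 1) :
    Summable fun n : ℕ => ((r : ℂ) ^ n) • expChar (-n) := by
  refine Summable.of_norm_bounded (g := fun n => r ^ n)
    (summable_geometric_of_lt_one h0 h1) fun n => ?_
  rw [norm_smul, norm_pow, Complex.norm_real, Real.norm_of_nonneg h0]
  exact mul_le_of_le_one_right (by positivity) (norm_expChar_le _)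

/-- The Cauchy kernel `1 / (1 - r exp (-i t))`. -/
def cauchyKernel (r : ℝ) : ℝ →ᵇ ℂ := ∑' n : ℕ, ((r : ℂ) ^ n) • expChar (-n)

theorem cauchyKernel_apply {r : ℝ} (h0 : 0 ≤ r) (h1 : r < 1) (t : ℝ) :
    cauchyKernel r t = (1 - r * Complex.exp (-(t * Complex.I)))⁻¹ := by
  have h := (BoundedContinuousFunction.evalCLM ℂ (β := ℂ) t).hasSum
    (summable_cauchyKernel h0 h1).hasSum
  refine h.unique ?_
  have h2 : ∀ n : ℕ, (BoundedContinuousFunction.evalCLM ℂ (β := ℂ) t)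
      (((r : ℂ) ^ n) • expChar (-n)) = (r * Complex.exp (-(t * Complex.I))) ^ n := by
    intro n
    simp only [BoundedContinuousFunction.evalCLM_apply, BoundedContinuousFunction.smul_apply,
      expChar_apply, smul_eq_mul, mul_pow, ← Complex.exp_nat_mul]
    congr 2; push_cast; ring
  simp only [h2]
  refine hasSum_geometric_of_norm_lt_one ?_
  rw [norm_mul, Complex.norm_real, Real.norm_of_nonneg h0]
  have : ‖Complex.exp (-(t * Complex.I))‖ = 1 := by
    have := Complex.norm_exp_ofReal_mul_I (-t)
    simpa using this
  rw [this]; linarith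

/-- Integration against the Cauchy kernel. -/
def cauchyCLM (r : ℝ) : (ℝ →ᵇ ℂ) →L[ℂ] ℂ :=
  periodMean.comp (ContinuousLinearMap.mul ℂ (ℝ →ᵇ ℂ) (cauchyKernel r))

theorem cauchyCLM_apply (r : ℝ) (f : ℝ →ᵇ ℂ) :
    cauchyCLM r f = periodMean (cauchyKernel r * f) := rfl

/-- By orthogonality only the term of the geometric series with frequency `k` survives. So the
functional evaluates the part with nonnegative frequencies at the point `r` of the disc and kills
the negative frequencies. -/
theorem cauchyCLM_expChar {r : ℝ} (h0 : 0 ≤ r) (h1 : r < 1) (k : ℤ) :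
    cauchyCLM r (expChar k) = if 0 ≤ k then (r : ℂ) ^ k.toNat else 0 := by
  have h := (periodMean.comp ((ContinuousLinearMap.mul ℂ (ℝ →ᵇ ℂ)).flip (expChar k))).hasSum
    (summable_cauchyKernel h0 h1).hasSum
  have h2 : ∀ n : ℕ, (periodMean.comp ((ContinuousLinearMap.mul ℂ (ℝ →ᵇ ℂ)).flip (expChar k)))
      (((r : ℂ) ^ n) • expChar (-n)) = if (n : ℤ) = k then (r : ℂ) ^ n else 0 := by
    intro n
    simp only [ContinuousLinearMap.comp_apply, ContinuousLinearMap.flip_apply,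
      ContinuousLinearMap.mul_apply', expChar_mul, map_smul, periodMean_expChar,
      smul_eq_mul]
    by_cases hk : (n : ℤ) = k
    · simp [hk]
    · rw [if_neg hk, if_neg (by omega), mul_zero]
  refine h.unique ?_
  simp only [h2]
  split_ifs with hk
  · have : ∀ n : ℕ, ((n : ℤ) = k) = (n = k.toNat) := fun n => by
      apply propext; omega
    simp only [this]
    exact (hasSum_ite_eq k.toNat ((r : ℂ) ^ k.toNat)).congr_fun (by
      intro n; split_ifs with h <;> simp_all)
  · have : ∀ n : ℕ, ¬ ((n : ℤ) = k) := fun n => by omega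
    simp only [this, if_false]
    exact hasSum_zero

/-! ### Algebras of one-sided frequencies and uniqueness of the Wiener–Hopf factors. -/

/-- The closed algebra generated by `exp (i k t)`. -/
def charAlgebra (k : ℤ) : Subalgebra ℂ (ℝ →ᵇ ℂ) :=
  (Algebra.adjoin ℂ {expChar k}).topologicalClosure

theorem isClosed_charAlgebra (k : ℤ) : IsClosed (charAlgebra k : Set (ℝ →ᵇ ℂ)) :=
  Subalgebra.isClosed_topologicalClosure _

theorem expChar_natMul_mem (k : ℤ) (n : ℕ) : expChar (n * k) ∈ charAlgebra k := by
  rw [← expChar_pow]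
  exact Subalgebra.le_topologicalClosure _ (pow_mem (Algebra.self_mem_adjoin_singleton ℂ _) n)

theorem exp_mem_charAlgebra (k : ℤ) {f : ℝ →ᵇ ℂ} (hf : f ∈ charAlgebra k) :
    NormedSpace.exp f ∈ charAlgebra k :=
  (isClosed_charAlgebra k).mem_of_tendsto (NormedSpace.exp_series_hasSum_exp' (𝕂 := ℂ) f)
    (Eventually.of_forall fun _ => Subalgebra.sum_mem _ fun n _ =>
      Subalgebra.smul_mem _ (pow_mem hf n) _)

/-- The generated algebra consists of polynomials in one character, so a closed additive property
need only be checked on monomials. -/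
theorem charAlgebra_induction {k : ℤ} {p : (ℝ →ᵇ ℂ) → Prop}
    (hc : IsClosed {f | p f}) (hadd : ∀ f g, p f → p g → p (f + g))
    (hsmul : ∀ (c : ℂ) (n : ℕ), p (c • expChar (n * k)))
    {f : ℝ →ᵇ ℂ} (hf : f ∈ charAlgebra k) : p f := by
  have h : closure ((Algebra.adjoin ℂ {expChar k} : Subalgebra ℂ (ℝ →ᵇ ℂ)) : Set (ℝ →ᵇ ℂ))
      ⊆ {f | p f} := by
    refine closure_minimal ?_ hc
    intro g hg
    rw [SetLike.mem_coe, Algebra.adjoin_singleton_eq_range_aeval] at hg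
    obtain ⟨q, rfl⟩ := hg
    change p (Polynomial.aeval (expChar k) q)
    induction q using Polynomial.induction_on' with
    | add q1 q2 h1 h2 =>
      rw [map_add]; exact hadd _ _ h1 h2
    | monomial n a =>
      rw [Polynomial.aeval_monomial, expChar_pow, Algebra.algebraMap_eq_smul_one,
        smul_mul_assoc, one_mul]
      exact hsmul a n
  exact h hf

/-- On functions with nonnegative frequencies the Cauchy integral is point evaluation of the
analytic extension. On monomials this is `r ^ (n + m) = r ^ n * r ^ m`; it would fail for
frequencies of mixed sign. -/
theorem cauchyCLM_mul_of_mem {r : ℝ} (h0 : 0 ≤ r) (h1 : r < 1) {f g : ℝ →ᵇ ℂ}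
    (hf : f ∈ charAlgebra 1) (hg : g ∈ charAlgebra 1) :
    cauchyCLM r (f * g) = cauchyCLM r f * cauchyCLM r g := by
  refine charAlgebra_induction (p := fun f => cauchyCLM r (f * g) = cauchyCLM r f * cauchyCLM r g)
    (isClosed_eq (by fun_prop) (by fun_prop)) ?_ ?_ hf
  · intro f1 f2 h1 h2
    rw [add_mul, map_add, map_add, h1, h2, add_mul]
  · intro c n
    refine charAlgebra_induction (p := fun g => cauchyCLM r (c • expChar (n * 1) * g) =
      cauchyCLM r (c • expChar (n * 1)) * cauchyCLM r g)
      (isClosed_eq (by fun_prop) (by fun_prop)) ?_ ?_ hg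
    · intro f1 f2 h1 h2
      rw [mul_add, map_add, map_add, h1, h2, mul_add]
    · intro d m
      rw [smul_mul_smul_comm, expChar_mul, map_smul, map_smul, map_smul, cauchyCLM_expChar h0 h1,
        cauchyCLM_expChar h0 h1, cauchyCLM_expChar h0 h1, if_pos (by positivity),
        if_pos (by positivity), if_pos (by positivity)]
      have e1 : ((n : ℤ) * 1 + m * 1).toNat = n + m := by omega
      have e2 : ((n : ℤ) * 1).toNat = n := by omega
      have e3 : ((m : ℤ) * 1).toNat = m := by omega
      rw [e1, e2, e3, pow_add]; simp only [smul_eq_mul]; ring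

theorem cauchyCLM_one {r : ℝ} (h0 : 0 ≤ r) (h1 : r < 1) : cauchyCLM r 1 = 1 := by
  rw [← expChar_zero, cauchyCLM_expChar h0 h1]; simp

theorem cauchyCLM_exp_of_mem {r : ℝ} (h0 : 0 ≤ r) (h1 : r < 1) {f : ℝ →ᵇ ℂ}
    (hf : f ∈ charAlgebra 1) :
    cauchyCLM r (NormedSpace.exp f) = Complex.exp (cauchyCLM r f) := by
  have h := (cauchyCLM r).hasSum (NormedSpace.exp_series_hasSum_exp' (𝕂 := ℂ) f)
  refine h.unique ?_
  have hp : ∀ n : ℕ, cauchyCLM r (f ^ n) = (cauchyCLM r f) ^ n := by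
    intro n
    induction n with
    | zero => simpa using cauchyCLM_one h0 h1
    | succ n ih => rw [pow_succ, cauchyCLM_mul_of_mem h0 h1 (pow_mem hf n) hf, ih, pow_succ]
  simp only [map_smul, hp]
  rw [Complex.exp_eq_exp_ℂ]
  exact NormedSpace.exp_series_hasSum_exp' (𝕂 := ℂ) (cauchyCLM r f)

/-- Among nonpositive frequencies only the constant term is seen by the Cauchy integral, and its
contribution does not depend on `r`. -/
theorem cauchyCLM_eq_zero_of_mem {r : ℝ} (h0 : 0 ≤ r) (h1 : r < 1) {f : ℝ →ᵇ ℂ}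
    (hf : f ∈ charAlgebra (-1)) : cauchyCLM r f = cauchyCLM 0 f := by
  refine charAlgebra_induction (p := fun f => cauchyCLM r f = cauchyCLM 0 f)
    (isClosed_eq (by fun_prop) (by fun_prop)) ?_ ?_ hf
  · intro f1 f2 h1 h2
    rw [map_add, map_add, h1, h2]
  · intro c n
    rw [map_smul, map_smul, cauchyCLM_expChar h0 h1, cauchyCLM_expChar le_rfl zero_lt_one]
    rcases Nat.eq_zero_or_pos n with rfl | hn
    · simp
    · rw [if_neg (by omega), if_neg (by omega)]

/-- An additive Wiener–Hopf decomposition determines the analytic factor of a multiplicative one. -/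
theorem wienerHopf_unique {r : ℝ} (h0 : 0 ≤ r) (h1 : r < 1) {f g a b : ℝ →ᵇ ℂ}
    (hf : f ∈ charAlgebra 1) (hg : g ∈ charAlgebra (-1)) (ha : a ∈ charAlgebra 1)
    (hb : b ∈ charAlgebra (-1)) (hfg : f = g * NormedSpace.exp (a + b))
    (hf0 : cauchyCLM 0 f = 1) (ha0 : cauchyCLM 0 a = 0) :
    cauchyCLM r f = Complex.exp (cauchyCLM r (a + b) - cauchyCLM 0 (a + b)) := by
  -- The Liouville step: the left side has nonnegative frequencies and the right side nonpositive
  -- ones, so the common value is a constant, to be compared at `r` and at `0`.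
  have hA : f * NormedSpace.exp (-a) = g * NormedSpace.exp b := by
    rw [hfg, mul_assoc, ← NormedSpace.exp_add]; congr 2; ring
  have hna : -a ∈ charAlgebra 1 := neg_mem ha
  have hm : f * NormedSpace.exp (-a) ∈ charAlgebra (-1) := by
    rw [hA]; exact mul_mem hg (exp_mem_charAlgebra _ hb)
  have h2 := cauchyCLM_eq_zero_of_mem h0 h1 hm
  rw [cauchyCLM_mul_of_mem h0 h1 hf (exp_mem_charAlgebra _ hna),
    cauchyCLM_mul_of_mem le_rfl zero_lt_one hf (exp_mem_charAlgebra _ hna),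
    cauchyCLM_exp_of_mem h0 h1 hna, cauchyCLM_exp_of_mem le_rfl zero_lt_one hna, hf0, map_neg,
    map_neg, ha0, neg_zero, Complex.exp_zero, mul_one, Complex.exp_neg] at h2
  rw [map_add, map_add, cauchyCLM_eq_zero_of_mem h0 h1 hb, ha0, zero_add, add_sub_cancel_right]
  exact (mul_inv_eq_one₀ (Complex.exp_ne_zero _)).1 h2

end

/-! ### The ladder epoch of the walk and its factorization identity. -/

noncomputable section

open scoped BoundedContinuousFunction

section CharE

variable {Ω : Type*} [MeasurableSpace Ω] {P : Measure Ω} [IsProbabilityMeasure P]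

/-- The function `t ↦ E[exp (i t X); A]`. -/
def partialCharFun (P : Measure Ω) (X : Ω → ℤ) (A : Set Ω) : ℝ →ᵇ ℂ :=
  ∫ a in A, expChar (X a) ∂P

/-- The target space is not separable, but the integrand factors through the countable discrete `ℤ`,
so it is strongly measurable. Integrating in the Banach space itself makes membership in closed
subalgebras pass to expectations. -/
theorem integrable_expChar {X : Ω → ℤ} (hX : Measurable X) :
    Integrable (fun a => expChar (X a)) P :=
  Integrable.of_bound
    ((StronglyMeasurable.of_discrete (f := expChar)).comp_measurable hX).aestronglyMeasurable 1
    (Eventually.of_forall fun _ => norm_expChar_le _)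

theorem partialCharFun_apply {X : Ω → ℤ} (hX : Measurable X) (A : Set Ω) (t : ℝ) :
    partialCharFun P X A t = ∫ a in A, expChar (X a) t ∂P :=
  ((BoundedContinuousFunction.evalCLM ℂ (β := ℂ) t).integral_comp_comm
    (integrable_expChar hX).integrableOn).symm

theorem cauchyCLM_partialCharFun {X : Ω → ℤ} (hX : Measurable X) (A : Set Ω) {r : ℝ}
    (h0 : 0 ≤ r) (h1 : r < 1) :
    cauchyCLM r (partialCharFun P X A) =
      ∫ a in A, (if 0 ≤ X a then (r : ℂ) ^ (X a).toNat else 0) ∂P := by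
  rw [partialCharFun, ← ContinuousLinearMap.integral_comp_comm _
    (integrable_expChar hX).integrableOn]
  simp only [cauchyCLM_expChar h0 h1]

theorem norm_partialCharFun_le (X : Ω → ℤ) (A : Set Ω) : ‖partialCharFun P X A‖ ≤ 1 := by
  refine (norm_integral_le_of_norm_le_const (C := 1)
    (Eventually.of_forall fun a => norm_expChar_le (X a))).trans ?_
  rw [one_mul, measureReal_restrict_apply_univ]
  exact measureReal_le_one

theorem partialCharFun_mem {X : Ω → ℤ} (hX : Measurable X) {A : Set Ω} (hA : MeasurableSet A)
    {k : ℤ} (h : ∀ a ∈ A, ∃ n : ℕ, X a = n * k) : partialCharFun P X A ∈ charAlgebra k := by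
  -- An indicator is used instead of the restricted measure because the convexity argument needs a
  -- probability measure; the value `0` off `A` lies in the algebra anyway.
  rw [partialCharFun, ← integral_indicator hA]
  refine Convex.integral_mem (s := (charAlgebra k : Set (ℝ →ᵇ ℂ))) ?_ (isClosed_charAlgebra k)
    (Eventually.of_forall fun a => ?_) ((integrable_indicator_iff hA).2
      (integrable_expChar hX).integrableOn)
  · intro x hx y hy a b _ _ _
    have hs : ∀ (c : ℝ) (f : ℝ →ᵇ ℂ), c • f = (c : ℂ) • f := fun c f => by
      ext t; simp
    rw [hs, hs]
    exact add_mem (Subalgebra.smul_mem _ hx _) (Subalgebra.smul_mem _ hy _)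
  · by_cases ha : a ∈ A
    · obtain ⟨n, hn⟩ := h a ha
      rw [Set.indicator_of_mem ha, hn]
      exact expChar_natMul_mem k n
    · rw [Set.indicator_of_notMem ha]
      exact zero_mem _

theorem partialCharFun_union {X : Ω → ℤ} (hX : Measurable X) {A B : Set Ω}
    (hB : MeasurableSet B) (hAB : Disjoint A B) :
    partialCharFun P X (A ∪ B) = partialCharFun P X A + partialCharFun P X B :=
  setIntegral_union hAB hB (integrable_expChar hX).integrableOn
    (integrable_expChar hX).integrableOn

end CharE

theorem measurable_walk (n : ℕ) : Measurable fun x : ℕ → ℤ => walk x n := by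
  unfold walk
  exact Finset.measurable_sum _ fun k _ => measurable_pi_apply k

theorem walk_congr {x y : ℕ → ℤ} {n : ℕ} (h : ∀ k < n, x k = y k) : walk x n = walk y n :=
  Finset.sum_congr rfl fun k hk => h k (Finset.mem_range.1 hk)

/-- The paths that have not entered `(0, ∞)` up to time `n`. -/
def noLadder (n : ℕ) : Set (ℕ → ℤ) := {x | ∀ m, 0 < m → m ≤ n → walk x m ≤ 0}

/-- The paths that enter `(0, ∞)` for the first time at time `n + 1`. -/
def ladderAt (n : ℕ) : Set (ℕ → ℤ) := noLadder n ∩ {x | 0 < walk x (n + 1)}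

theorem measurableSet_noLadder (n : ℕ) : MeasurableSet (noLadder n) := by
  have : noLadder n = ⋂ m, ⋂ (_ : 0 < m), ⋂ (_ : m ≤ n), {x | walk x m ≤ 0} := by
    ext x; simp [noLadder]
  rw [this]
  exact MeasurableSet.iInter fun m => MeasurableSet.iInter fun _ => MeasurableSet.iInter fun _ =>
    measurable_walk m (MeasurableSet.of_discrete (s := Set.Iic 0))

theorem measurableSet_ladderAt (n : ℕ) : MeasurableSet (ladderAt n) :=
  (measurableSet_noLadder n).inter
    (measurable_walk (n + 1) (MeasurableSet.of_discrete (s := Set.Ioi 0)))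

theorem noLadder_congr {x y : ℕ → ℤ} {n : ℕ} (h : ∀ k < n, x k = y k) :
    x ∈ noLadder n ↔ y ∈ noLadder n := by
  refine forall_congr' fun m => imp_congr_right fun _ => forall_congr' fun hm => ?_
  rw [walk_congr fun k hk => h k (hk.trans_le hm)]

theorem noLadder_zero : noLadder 0 = Set.univ := by
  ext x; simp only [noLadder, Set.mem_ofPred_eq, Set.mem_univ, iff_true]; intro m; omega

theorem walk_nonpos_of_mem_noLadder {x : ℕ → ℤ} {n : ℕ} (h : x ∈ noLadder n) : walk x n ≤ 0 := by
  rcases Nat.eq_zero_or_pos n with rfl | hn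
  · simp [walk]
  · exact h n hn le_rfl

theorem noLadder_eq_union (n : ℕ) : noLadder n = noLadder (n + 1) ∪ ladderAt n := by
  ext x
  simp only [Set.mem_union, ladderAt, Set.mem_inter_iff, Set.mem_ofPred_eq]
  constructor
  · intro h
    rcases le_or_gt (walk x (n + 1)) 0 with h1 | h1
    · left
      intro m hm hmn
      rcases Nat.lt_or_ge m (n + 1) with h2 | h2
      · exact h m hm (by omega)
      · have : m = n + 1 := by omega
        rw [this]; exact h1
    · exact Or.inr ⟨h, h1⟩
  · rintro (h | h)
    · exact fun m hm hmn => h m hm (by omega)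
    · exact h.1

theorem disjoint_noLadder_ladderAt {m n : ℕ} (h : n < m) : Disjoint (noLadder m) (ladderAt n) :=
  Set.disjoint_left.2 fun _ h1 h2 => absurd (h1 (n + 1) (by omega) (by omega)) (not_le.2 h2.2)

theorem pairwise_disjoint_ladderAt : Pairwise (Function.onFun Disjoint ladderAt) := by
  have key : ∀ m n, m < n → Disjoint (ladderAt m) (ladderAt n) := fun m n h =>
    ((disjoint_noLadder_ladderAt h).mono_left Set.inter_subset_left).symm
  intro m n h
  rcases lt_or_gt_of_ne h with h | h
  · exact key m n h
  · exact (key n m h).symm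

section Walk

variable {Ω : Type*} [MeasurableSpace Ω] {P : Measure Ω} {ξ : ℕ → Ω → ℤ}

theorem measurable_walk_comp (hξ_meas : ∀ k, Measurable (ξ k)) (n : ℕ) :
    Measurable fun a => walk (fun k => ξ k a) n :=
  (measurable_walk n).comp (measurable_pi_lambda _ fun k => hξ_meas k)

theorem integral_mul_next (hξ_meas : ∀ k, Measurable (ξ k)) (hξ_indep : iIndepFun ξ P)
    (hξ_ident : ∀ k, IdentDistrib (ξ k) (ξ 0) P P) {n : ℕ} {g : (ℕ → ℤ) → ℂ}
    (hg : ∀ x y : ℕ → ℤ, (∀ k < n, x k = y k) → g x = g y) (f : ℤ → ℂ) :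
    ∫ a, g (fun k => ξ k a) * f (ξ n a) ∂P =
      (∫ a, g (fun k => ξ k a) ∂P) * ∫ a, f (ξ 0 a) ∂P := by
  -- Padding by zeros writes `g` as a function of the first `n` steps alone, which are independent
  -- of the step with index `n`.
  let ext : ((Finset.range n) → ℤ) → ℕ → ℤ := fun v k =>
    if h : k ∈ Finset.range n then v ⟨k, h⟩ else 0
  have hg' : ∀ a, g (fun k => ξ k a) = g (ext fun i => ξ i a) := fun a =>
    hg _ _ fun k hk => by simp [ext, hk]
  have hi := hξ_indep.indepFun_finset (Finset.range n) {n} (by simp) hξ_meas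
  have hi2 : IndepFun (fun a => g (ext fun i : Finset.range n => ξ i a)) (fun a => f (ξ n a)) P :=
    hi.comp (φ := fun v => g (ext v)) (ψ := fun v : ({n} : Finset ℕ) → ℤ => f (v ⟨n, by simp⟩))
      (measurable_of_countable _) (measurable_of_countable _)
  have hm : Measurable fun a => g (ext fun i : Finset.range n => ξ i a) :=
    (measurable_of_countable (fun v => g (ext v))).comp
      (measurable_pi_lambda _ fun i => hξ_meas i)
  simp only [hg']
  rw [hi2.integral_fun_mul_eq_mul_integral hm.aestronglyMeasurable
    ((measurable_of_countable f).comp (hξ_meas n)).aestronglyMeasurable]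
  congr 1
  exact ((hξ_ident n).comp (measurable_of_countable f)).integral_eq

variable [IsProbabilityMeasure P]

/-- An event decided by the first `n` steps is independent of the next one, so taking that step
multiplies by the characteristic function of a single increment. -/
theorem partialCharFun_mul_next (hξ_meas : ∀ k, Measurable (ξ k)) (hξ_indep : iIndepFun ξ P)
    (hξ_ident : ∀ k, IdentDistrib (ξ k) (ξ 0) P P) {n : ℕ} {A : Set (ℕ → ℤ)}
    (hA : MeasurableSet A)
    (hA' : ∀ x y : ℕ → ℤ, (∀ k < n, x k = y k) → (x ∈ A ↔ y ∈ A)) :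
    partialCharFun P (fun a => walk (fun k => ξ k a) n) ((fun a k => ξ k a) ⁻¹' A) *
      partialCharFun P (ξ 0) Set.univ =
    partialCharFun P (fun a => walk (fun k => ξ k a) (n + 1)) ((fun a k => ξ k a) ⁻¹' A) := by
  classical
  have hseq : Measurable fun a k => ξ k a := measurable_pi_lambda _ fun k => hξ_meas k
  ext t
  rw [BoundedContinuousFunction.mul_apply, partialCharFun_apply (measurable_walk_comp hξ_meas n),
    partialCharFun_apply (measurable_walk_comp hξ_meas (n + 1)), partialCharFun_apply (hξ_meas 0),
    setIntegral_univ, ← integral_indicator (hseq hA), ← integral_indicator (hseq hA)]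
  have h := integral_mul_next hξ_meas hξ_indep hξ_ident (n := n)
    (g := fun x => A.indicator (fun x => expChar (walk x n) t) x) (by
      intro x y hxy
      by_cases hx : x ∈ A
      · rw [Set.indicator_of_mem hx, Set.indicator_of_mem ((hA' x y hxy).1 hx), walk_congr hxy]
      · rw [Set.indicator_of_notMem hx,
          Set.indicator_of_notMem (fun hy => hx ((hA' x y hxy).2 hy))])
    (fun k => expChar k t)
  refine Eq.trans h.symm ?_
  congr 1; ext a
  by_cases ha : (fun k => ξ k a) ∈ A
  · rw [Set.indicator_of_mem ha, Set.indicator_of_mem (show a ∈ _ from ha), walk, walk,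
      Finset.sum_range_succ, ← expChar_mul]
    rfl
  · rw [Set.indicator_of_notMem ha, Set.indicator_of_notMem (show a ∉ _ from ha), zero_mul]

theorem partialCharFun_walk (hξ_meas : ∀ k, Measurable (ξ k)) (hξ_indep : iIndepFun ξ P)
    (hξ_ident : ∀ k, IdentDistrib (ξ k) (ξ 0) P P) (n : ℕ) :
    partialCharFun P (fun a => walk (fun k => ξ k a) n) Set.univ =
      partialCharFun P (ξ 0) Set.univ ^ n := by
  induction n with
  | zero =>
    simp [partialCharFun, walk, expChar_zero]
  | succ n ih =>
    have := partialCharFun_mul_next hξ_meas hξ_indep hξ_ident (n := n) (A := Set.univ)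
      MeasurableSet.univ (fun _ _ _ => Iff.rfl)
    rw [Set.preimage_univ] at this
    rw [← this, ih, pow_succ]

/-- The generating function `∑ z ^ n E[r ^ S_n; 𝒯 = n]` of the first ladder epoch and height. -/
def ladderGen (P : Measure Ω) (ξ : ℕ → Ω → ℤ) (z r : ℝ) : ℝ :=
  ∑' n : ℕ, z ^ (n + 1) *
    ∫ a in (fun a k => ξ k a) ⁻¹' ladderAt n, r ^ (walk (fun k => ξ k a) (n + 1)).toNat ∂P

theorem summable_smul_partialCharFun {z : ℝ} (hz0 : 0 ≤ z) (hz1 : z < 1) (c : ℕ → ℂ)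
    (hc : ∀ n, ‖c n‖ ≤ 1) (X : ℕ → Ω → ℤ) (A : ℕ → Set Ω) :
    Summable fun n => (c n * (z : ℂ) ^ n) • partialCharFun P (X n) (A n) := by
  refine Summable.of_norm_bounded (summable_geometric_of_lt_one hz0 hz1) fun n => ?_
  rw [norm_smul, norm_mul, norm_pow, Complex.norm_real, Real.norm_of_nonneg hz0]
  calc ‖c n‖ * z ^ n * ‖partialCharFun P (X n) (A n)‖ ≤ 1 * z ^ n * 1 := by
        gcongr
        · exact hc n
        · exact norm_partialCharFun_le _ _
    _ = z ^ n := by ring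

/-- A path without ladder epoch up to `n` either still has none at `n + 1` or has its first one
there. With `a n`, `b n` the corresponding transforms this reads `a n * φ = a (n + 1) + b n`;
weighting by `z ^ (n + 1)` and summing from `a 0 = 1` gives the identity. -/
theorem ladder_factorization (hξ_meas : ∀ k, Measurable (ξ k)) (hξ_indep : iIndepFun ξ P)
    (hξ_ident : ∀ k, IdentDistrib (ξ k) (ξ 0) P P) {z : ℝ} (hz0 : 0 ≤ z) (hz1 : z < 1) :
    1 - ∑' n : ℕ, ((z : ℂ) ^ (n + 1)) • partialCharFun P (fun a => walk (fun k => ξ k a) (n + 1))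
        ((fun a k => ξ k a) ⁻¹' ladderAt n) =
      (∑' n : ℕ, ((z : ℂ) ^ n) • partialCharFun P (fun a => walk (fun k => ξ k a) n)
        ((fun a k => ξ k a) ⁻¹' noLadder n)) * (1 - (z : ℂ) • partialCharFun P (ξ 0) Set.univ) := by
  have hseq : Measurable fun a k => ξ k a := measurable_pi_lambda _ fun k => hξ_meas k
  set φ := partialCharFun P (ξ 0) Set.univ
  set a : ℕ → ℝ →ᵇ ℂ := fun n => partialCharFun P (fun a => walk (fun k => ξ k a) n)
        ((fun a k => ξ k a) ⁻¹' noLadder n) with ha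
  set b : ℕ → ℝ →ᵇ ℂ := fun n => partialCharFun P (fun a => walk (fun k => ξ k a) (n + 1))
        ((fun a k => ξ k a) ⁻¹' ladderAt n) with hb
  have hsa : Summable fun n => ((z : ℂ) ^ n) • a n := by
    simpa using summable_smul_partialCharFun (P := P) hz0 hz1 (fun _ => 1) (by simp)
      (fun n a => walk (fun k => ξ k a) n) (fun n => (fun a k => ξ k a) ⁻¹' noLadder n)
  have hsb : Summable fun n => ((z : ℂ) ^ (n + 1)) • b n := by
    have := summable_smul_partialCharFun (P := P) hz0 hz1 (fun _ => z)
      (by simpa [abs_of_nonneg hz0] using hz1.le)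
      (fun n a => walk (fun k => ξ k a) (n + 1)) (fun n => (fun a k => ξ k a) ⁻¹' ladderAt n)
    refine this.congr fun n => ?_
    rw [pow_succ, mul_comm]
  have hab : ∀ n, a n * φ = a (n + 1) + b n := by
    intro n
    rw [ha]
    simp only
    rw [partialCharFun_mul_next hξ_meas hξ_indep hξ_ident (measurableSet_noLadder n)
      (fun x y hxy => noLadder_congr hxy), noLadder_eq_union n, Set.preimage_union,
      partialCharFun_union (measurable_walk_comp hξ_meas _) (hseq (measurableSet_ladderAt n))
      ((disjoint_noLadder_ladderAt (Nat.lt_succ_self n)).preimage _)]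
  have ha0 : a 0 = 1 := by
    simp [ha, noLadder_zero, partialCharFun, walk, expChar_zero]
  have hs1 : (∑' n, ((z : ℂ) ^ n) • a n) = 1 + ∑' n, ((z : ℂ) ^ (n + 1)) • a (n + 1) := by
    rw [hsa.tsum_eq_zero_add]; simp [ha0]
  have hs2 : (∑' n, ((z : ℂ) ^ n) • a n) * ((z : ℂ) • φ) =
      ∑' n, ((z : ℂ) ^ (n + 1)) • a (n + 1) + ∑' n, ((z : ℂ) ^ (n + 1)) • b n := by
    rw [← Summable.tsum_add ((summable_nat_add_iff 1).2 hsa) hsb, ← hsa.tsum_mul_right]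
    refine tsum_congr fun n => ?_
    rw [smul_mul_smul_comm, hab, smul_add, pow_succ]
  rw [mul_sub, mul_one, hs2, hs1]
  ring

/-- The second factorization is the Spitzer–Baxter one: in `log (1 - z φ) = -∑ z ^ n φ ^ n / n` the
power `φ ^ n` is the transform of `S_n`, which splits according to `S_n > 0` or `S_n ≤ 0`. The
condition `z < 1` makes every series converge in norm. -/
theorem ladderGen_eq_exp_cauchy (hξ_meas : ∀ k, Measurable (ξ k)) (hξ_indep : iIndepFun ξ P)
    (hξ_ident : ∀ k, IdentDistrib (ξ k) (ξ 0) P P) {z : ℝ} (hz0 : 0 ≤ z) (hz1 : z < 1) :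
    ∃ l : ℝ →ᵇ ℂ, (∀ t, l t = Complex.log (1 - z * partialCharFun P (ξ 0) Set.univ t)) ∧
      ∀ r : ℝ, 0 ≤ r → r < 1 →
        (1 - ladderGen P ξ z r : ℂ) = Complex.exp (cauchyCLM r l - cauchyCLM 0 l) := by
  have hseq : Measurable fun a k => ξ k a := measurable_pi_lambda _ fun k => hξ_meas k
  set φ := partialCharFun P (ξ 0) Set.univ with hφ
  have hsum := summable_smul_partialCharFun (P := P) hz0 hz1
  have hcoef : ∀ n : ℕ, ‖(-((z : ℂ) / (n + 1)))‖ ≤ 1 := fun n => by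
    rw [norm_neg, norm_div, Complex.norm_real, Real.norm_of_nonneg hz0]
    have : ‖((n : ℂ) + 1)‖ = n + 1 := by exact_mod_cast Complex.norm_natCast (n + 1)
    rw [this, div_le_one (by positivity)]
    linarith [(Nat.cast_nonneg n : (0 : ℝ) ≤ n)]
  let W : ℕ → Ω → ℤ := fun n a => walk (fun k => ξ k a) (n + 1)
  have hW : ∀ n, Measurable (W n) := fun n => measurable_walk_comp hξ_meas (n + 1)
  have hposm : ∀ n, MeasurableSet {a | 0 < W n a} := fun n =>
    hW n (MeasurableSet.of_discrete (s := Set.Ioi 0))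
  have hnegm : ∀ n, MeasurableSet {a | W n a ≤ 0} := fun n =>
    hW n (MeasurableSet.of_discrete (s := Set.Iic 0))
  -- The index is shifted by one: the coefficient is `-z ^ (n + 1) / (n + 1)`, attached to
  -- `S_(n+1)`.
  let up : ℝ →ᵇ ℂ := ∑' n : ℕ, (-((z : ℂ) / (n + 1)) * z ^ n) •
    partialCharFun P (W n) {a | 0 < W n a}
  let dn : ℝ →ᵇ ℂ := ∑' n : ℕ, (-((z : ℂ) / (n + 1)) * z ^ n) •
    partialCharFun P (W n) {a | W n a ≤ 0}
  have hup : HasSum _ up := (hsum _ hcoef W (fun n => {a | 0 < W n a})).hasSum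
  have hdn : HasSum _ dn := (hsum _ hcoef W (fun n => {a | W n a ≤ 0})).hasSum
  have hφ1 : ∀ t, ‖(z : ℂ) * φ t‖ < 1 := fun t => by
    rw [norm_mul, Complex.norm_real, Real.norm_of_nonneg hz0]
    have := (φ.norm_coe_le_norm t).trans (norm_partialCharFun_le _ _)
    nlinarith [norm_nonneg (φ t)]
  have hl : ∀ t, (up + dn) t = Complex.log (1 - z * φ t) := by
    intro t
    have h1 := (BoundedContinuousFunction.evalCLM ℂ (β := ℂ) t).hasSum (hup.add hdn)
    have h2 := Complex.hasSum_taylorSeries_neg_log (hφ1 t)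
    rw [← hasSum_nat_add_iff' 1] at h2
    simp only [Finset.range_one, Finset.sum_singleton, pow_zero, Nat.cast_zero, div_zero,
      sub_zero] at h2
    have h3 := h2.neg
    rw [neg_neg] at h3
    refine h1.unique (h3.congr_fun fun n => ?_)
    have hu : ({a | 0 < W n a} ∪ {a | W n a ≤ 0}) = Set.univ := by
      ext a; simp [lt_or_ge]
    have hd : Disjoint {a | 0 < W n a} {a | W n a ≤ 0} :=
      Set.disjoint_left.2 fun a h1 h2 => not_le.2 (show 0 < W n a from h1) h2
    rw [← smul_add, ← partialCharFun_union (hW n) (hnegm n) hd, hu,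
      partialCharFun_walk hξ_meas hξ_indep hξ_ident]
    simp only [BoundedContinuousFunction.evalCLM_apply, BoundedContinuousFunction.smul_apply,
      BoundedContinuousFunction.pow_apply, smul_eq_mul, mul_pow, Nat.cast_add, Nat.cast_one]
    rw [← hφ]
    ring
  -- The exponential in the Banach algebra is computed pointwise, since evaluation at `t` is
  -- continuous and multiplicative.
  have hexp : NormedSpace.exp (up + dn) = 1 - (z : ℂ) • φ := by
    ext t
    have h1 := (BoundedContinuousFunction.evalCLM ℂ (β := ℂ) t).hasSum
      (NormedSpace.exp_series_hasSum_exp' (𝕂 := ℂ) (up + dn))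
    have h2 := NormedSpace.exp_series_hasSum_exp' (𝕂 := ℂ) ((up + dn) t)
    have h3 : NormedSpace.exp (up + dn) t = NormedSpace.exp ((up + dn) t) := by
      refine h1.unique (h2.congr_fun fun n => ?_)
      simp
    rw [h3, hl, ← Complex.exp_eq_exp_ℂ, Complex.exp_log]
    · simp
    · intro h0
      have := hφ1 t
      rw [← sub_eq_zero.1 h0] at this
      simp at this
  have hmem1 : ∀ (s : ℕ → ℂ) (f : ℕ → ℝ →ᵇ ℂ) (k : ℤ), (∀ n, f n ∈ charAlgebra k) →
      (∑' n, s n • f n) ∈ charAlgebra k := by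
    intro s f k hf
    by_cases hs : Summable fun n => s n • f n
    · exact (isClosed_charAlgebra k).mem_of_tendsto hs.hasSum
        (Eventually.of_forall fun _ => Subalgebra.sum_mem _ fun n _ =>
          Subalgebra.smul_mem _ (hf n) _)
    · rw [tsum_eq_zero_of_not_summable hs]; exact zero_mem _
  have hposW : ∀ m : ℤ, 0 < m → ∃ n : ℕ, m = n * 1 := fun m hm => ⟨m.toNat, by omega⟩
  have hnegW : ∀ m : ℤ, m ≤ 0 → ∃ n : ℕ, m = n * -1 := fun m hm => ⟨(-m).toNat, by omega⟩
  have hupm : up ∈ charAlgebra 1 := hmem1 _ _ _ fun n =>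
    partialCharFun_mem (hW n) (hposm n) fun a ha => hposW _ ha
  have hdnm : dn ∈ charAlgebra (-1) := hmem1 _ _ _ fun n =>
    partialCharFun_mem (hW n) (hnegm n) fun a ha => hnegW _ ha
  have hGm : (∑' n : ℕ, ((z : ℂ) ^ n) • partialCharFun P (fun a => walk (fun k => ξ k a) n)
        ((fun a k => ξ k a) ⁻¹' noLadder n)) ∈ charAlgebra (-1) := hmem1 _ _ _ fun n =>
    partialCharFun_mem (measurable_walk_comp hξ_meas n) (hseq (measurableSet_noLadder n))
      fun a ha => hnegW _ (walk_nonpos_of_mem_noLadder ha)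
  have hFm : (∑' n : ℕ, ((z : ℂ) ^ (n + 1)) • partialCharFun P (W n)
        ((fun a k => ξ k a) ⁻¹' ladderAt n)) ∈ charAlgebra 1 := hmem1 _ _ _ fun n =>
    partialCharFun_mem (hW n) (hseq (measurableSet_ladderAt n)) fun a ha => hposW _ ha.2
  have hFs : Summable (fun n : ℕ => ((z : ℂ) ^ (n + 1)) • partialCharFun P (W n)
        ((fun a k => ξ k a) ⁻¹' ladderAt n)) := by
    have := hsum (fun _ => z) (by simpa [abs_of_nonneg hz0] using hz1.le) W
      (fun n => (fun a k => ξ k a) ⁻¹' ladderAt n)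
    refine this.congr fun n => ?_
    rw [pow_succ, mul_comm]
  have hFc : ∀ r : ℝ, 0 ≤ r → r < 1 → cauchyCLM r (∑' n : ℕ, ((z : ℂ) ^ (n + 1)) •
      partialCharFun P (W n) ((fun a k => ξ k a) ⁻¹' ladderAt n)) = ladderGen P ξ z r := by
    intro r h0 h1
    rw [(cauchyCLM r).map_tsum hFs, ladderGen, Complex.ofReal_tsum]
    refine tsum_congr fun n => ?_
    rw [map_smul, cauchyCLM_partialCharFun (hW n) _ h0 h1, Complex.ofReal_mul, smul_eq_mul,
      Complex.ofReal_pow, ← integral_complex_ofReal]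
    congr 1
    refine setIntegral_congr_fun (hseq (measurableSet_ladderAt n)) fun a ha => ?_
    rw [if_pos (le_of_lt (show 0 < W n a from ha.2)), Complex.ofReal_pow]
  -- Ladder heights are strictly positive, so the value `0 ^ 0 = 1` never occurs. This is the
  -- normalization that uniqueness of the factors requires.
  have hF0 : ladderGen P ξ z 0 = 0 := by
    rw [ladderGen]
    have : ∀ n : ℕ, ∫ a in (fun a k => ξ k a) ⁻¹' ladderAt n,
        (0 : ℝ) ^ (walk (fun k => ξ k a) (n + 1)).toNat ∂P = 0 := fun n => by
      rw [setIntegral_congr_fun (g := fun _ => 0) (hseq (measurableSet_ladderAt n)), integral_zero]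
      intro a ha
      have : 0 < walk (fun k => ξ k a) (n + 1) := ha.2
      exact zero_pow (by omega)
    simp [this]
  have hup0 : cauchyCLM 0 up = 0 := by
    refine ((cauchyCLM 0).hasSum hup).unique ?_
    refine (hasSum_zero).congr_fun fun n => ?_
    rw [map_smul, cauchyCLM_partialCharFun (hW n) _ le_rfl zero_lt_one,
      setIntegral_congr_fun (g := fun _ => 0) (hposm n), integral_zero, smul_zero]
    intro a ha
    have : 0 < W n a := ha
    simp only [this.le, if_true, Complex.ofReal_zero]
    exact zero_pow (by omega)
  refine ⟨up + dn, hl, fun r h0 h1 => ?_⟩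
  have key := wienerHopf_unique h0 h1 (f := 1 - ∑' n : ℕ, ((z : ℂ) ^ (n + 1)) •
      partialCharFun P (W n) ((fun a k => ξ k a) ⁻¹' ladderAt n))
    (sub_mem (one_mem _) hFm) hGm hupm hdnm
    (by rw [hexp]; exact ladder_factorization hξ_meas hξ_indep hξ_ident hz0 hz1)
    (by rw [map_sub, cauchyCLM_one le_rfl zero_lt_one, hFc 0 le_rfl zero_lt_one, hF0]; simp) hup0
  rw [← key, map_sub, cauchyCLM_one h0 h1, hFc r h0 h1]

end Walk

end

/-! ### The ladder generating function as a Poisson integral. -/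

noncomputable section

open scoped BoundedContinuousFunction

/-- The Poisson kernel of the unit disc. -/
def poissonWeight (r t : ℝ) : ℝ := (1 - r ^ 2) / (1 - 2 * r * Real.cos t + r ^ 2)

theorem poissonWeight_denom_pos {r : ℝ} (h0 : 0 ≤ r) (h1 : r < 1) (t : ℝ) :
    0 < 1 - 2 * r * Real.cos t + r ^ 2 := by
  nlinarith [Real.cos_le_one t, mul_nonneg h0 (sub_nonneg.2 (Real.cos_le_one t)),
    pow_pos (sub_pos.2 h1) 2]

theorem poissonWeight_nonneg {r : ℝ} (h0 : 0 ≤ r) (h1 : r < 1) (t : ℝ) :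
    0 ≤ poissonWeight r t :=
  div_nonneg (by nlinarith) (poissonWeight_denom_pos h0 h1 t).le

theorem continuous_poissonWeight {r : ℝ} (h0 : 0 ≤ r) (h1 : r < 1) :
    Continuous (poissonWeight r) := by
  unfold poissonWeight
  exact continuous_const.div (by fun_prop) fun t => (poissonWeight_denom_pos h0 h1 t).ne'

theorem poissonWeight_neg (r t : ℝ) : poissonWeight r (-t) = poissonWeight r t := by
  simp [poissonWeight]

theorem exp_neg_mul_I (t : ℝ) :
    Complex.exp (-(t * Complex.I)) = (Real.cos t : ℂ) - Real.sin t * Complex.I := by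
  rw [← neg_mul, Complex.exp_mul_I, Complex.cos_neg, Complex.sin_neg]
  push_cast; ring

/-- For a symmetric law the logarithm integrated against the kernel is real, so only this real part
of the Cauchy kernel matters. -/
theorem cauchyKernel_re {r : ℝ} (h0 : 0 ≤ r) (h1 : r < 1) (t : ℝ) :
    (cauchyKernel r t).re = (1 + poissonWeight r t) / 2 := by
  have hd := poissonWeight_denom_pos h0 h1 t
  have hn : Complex.normSq (1 - r * Complex.exp (-(t * Complex.I))) =
      1 - 2 * r * Real.cos t + r ^ 2 := by
    rw [exp_neg_mul_I, Complex.normSq_apply]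
    simp only [Complex.sub_re, Complex.one_re, Complex.mul_re, Complex.ofReal_re,
      Complex.ofReal_im, Complex.sub_im, Complex.one_im, Complex.mul_im, Complex.I_re,
      Complex.I_im]
    nlinarith [Real.sin_sq_add_cos_sq t]
  rw [cauchyKernel_apply h0 h1, Complex.inv_re, hn, poissonWeight]
  have : (1 - r * Complex.exp (-(t * Complex.I))).re = 1 - r * Real.cos t := by
    rw [exp_neg_mul_I]
    simp only [Complex.sub_re, Complex.one_re, Complex.mul_re, Complex.ofReal_re,
      Complex.ofReal_im, Complex.sub_im, Complex.mul_im, Complex.I_re,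
      Complex.I_im]
    ring
  rw [this, show 1 - r * Real.cos t =
    ((1 - 2 * r * Real.cos t + r ^ 2) + (1 - r ^ 2)) / 2 by ring, div_right_comm, add_div,
    div_self hd.ne']

theorem integral_symm_of_even {f : ℝ → ℝ} (hf : Continuous f) (he : ∀ t, f (-t) = f t) (a : ℝ) :
    ∫ t in (-a)..a, f t = 2 * ∫ t in (0 : ℝ)..a, f t := by
  rw [← intervalIntegral.integral_add_adjacent_intervals (b := 0) (hf.intervalIntegrable _ _)
    (hf.intervalIntegrable _ _)]
  have : ∫ t in (-a)..0, f t = ∫ t in (0 : ℝ)..a, f t := by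
    have h := intervalIntegral.integral_comp_neg (a := 0) (b := a) f
    rw [neg_zero] at h
    rw [← h]
    simp only [he]
  rw [this]; ring

section Gen

variable {Ω : Type*} [MeasurableSpace Ω] {P : Measure Ω} {ξ : ℕ → Ω → ℤ}

theorem charFun_im_eq_zero {X : Ω → ℤ} (hX : Measurable X)
    (hs : IdentDistrib (fun a => -X a) X P P) (t : ℝ) :
    (charFun (P.map (fun a => (X a : ℝ))) t).im = 0 := by
  have hm : Measurable fun a => (X a : ℝ) := (measurable_of_countable _).comp hX
  have h1 : ∀ t, charFun (P.map (fun a => (X a : ℝ))) t = ∫ a, expChar (X a) t ∂P := fun t => by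
    rw [charFun_apply_real, integral_map hm.aemeasurable (by fun_prop)]
    congr 1; ext a; rw [expChar_apply]; congr 1; push_cast; ring
  have h2 : charFun (P.map (fun a => (X a : ℝ))) (-t) = charFun (P.map (fun a => (X a : ℝ))) t := by
    rw [h1, h1]
    have := (hs.comp (measurable_of_countable fun k : ℤ => expChar k t)).integral_eq
    refine Eq.trans ?_ this
    congr 1; ext a
    simp only [Function.comp, expChar_apply]
    congr 1; push_cast; ring
  rw [charFun_neg] at h2
  exact Complex.conj_eq_iff_im.1 h2

theorem ladderTerm_nonneg {r : ℝ} (h0 : 0 ≤ r) (A : Set Ω) (n : ℕ) :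
    0 ≤ ∫ a in A, r ^ (walk (fun k => ξ k a) n).toNat ∂P :=
  integral_nonneg fun _ => pow_nonneg h0 _

variable [IsProbabilityMeasure P]

theorem partialCharFun_univ_apply {X : Ω → ℤ} (hX : Measurable X)
    (hs : IdentDistrib (fun a => -X a) X P P) (t : ℝ) :
    partialCharFun P X Set.univ t = ((charFun (P.map (fun a => (X a : ℝ))) t).re : ℂ) := by
  have hm : Measurable fun a => (X a : ℝ) := (measurable_of_countable _).comp hX
  have h1 : charFun (P.map (fun a => (X a : ℝ))) t = partialCharFun P X Set.univ t := by
    rw [partialCharFun_apply hX, setIntegral_univ,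
      charFun_apply_real, integral_map hm.aemeasurable (by fun_prop)]
    congr 1; ext a; rw [expChar_apply]; congr 1; push_cast; ring
  rw [← h1]
  apply Complex.ext
  · simp
  · simp [charFun_im_eq_zero hX hs t]

theorem summable_measureReal_ladderAt (hξ_meas : ∀ k, Measurable (ξ k)) :
    Summable (fun n : ℕ => P.real ((fun a k => ξ k a) ⁻¹' ladderAt n)) ∧
      ∑' n : ℕ, P.real ((fun a k => ξ k a) ⁻¹' ladderAt n) ≤ 1 := by
  have hseq : Measurable fun a k => ξ k a := measurable_pi_lambda _ fun k => hξ_meas k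
  have hd : Pairwise (Function.onFun Disjoint fun n : ℕ => (fun a k => ξ k a) ⁻¹' ladderAt n) :=
    fun m n h => (pairwise_disjoint_ladderAt h).preimage _
  have h := hasSum_integral_iUnion (μ := P) (f := fun _ => (1 : ℝ))
    (fun n => hseq (measurableSet_ladderAt n)) hd (integrable_const _).integrableOn
  simp only [integral_const, measureReal_restrict_apply_univ, smul_eq_mul, mul_one] at h
  exact ⟨h.summable, by rw [h.tsum_eq]; exact measureReal_le_one⟩

theorem ladderTerm_le {r : ℝ} (h0 : 0 ≤ r) (h1 : r ≤ 1) (A : Set Ω) (n : ℕ) :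
    ∫ a in A, r ^ (walk (fun k => ξ k a) n).toNat ∂P ≤ P.real A := by
  have h := norm_integral_le_of_norm_le_const (μ := P.restrict A) (C := 1)
    (f := fun a => r ^ (walk (fun k => ξ k a) n).toNat) (Eventually.of_forall fun a => by
      rw [norm_pow, Real.norm_of_nonneg h0]; exact pow_le_one₀ h0 h1)
  rw [one_mul, measureReal_restrict_apply_univ] at h
  exact (le_abs_self _).trans h

theorem ladderGen_le (hξ_meas : ∀ k, Measurable (ξ k)) {z r : ℝ} (hz0 : 0 ≤ z) (hz1 : z ≤ 1)
    (h0 : 0 ≤ r) (h1 : r ≤ 1) :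
    ladderGen P ξ z r ≤ ∑' n : ℕ, P.real ((fun a k => ξ k a) ⁻¹' ladderAt n) := by
  have hle : ∀ n : ℕ, z ^ (n + 1) *
      ∫ a in (fun a k => ξ k a) ⁻¹' ladderAt n, r ^ (walk (fun k => ξ k a) (n + 1)).toNat ∂P ≤
      P.real ((fun a k => ξ k a) ⁻¹' ladderAt n) := fun n =>
    (mul_le_of_le_one_left (ladderTerm_nonneg h0 _ _) (pow_le_one₀ hz0 hz1)).trans
      (ladderTerm_le h0 h1 _ _)
  exact Summable.tsum_le_tsum hle (Summable.of_nonneg_of_le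
    (fun n => mul_nonneg (pow_nonneg hz0 _) (ladderTerm_nonneg h0 _ _)) hle
    (summable_measureReal_ladderAt hξ_meas).1) (summable_measureReal_ladderAt hξ_meas).1

/-- Abel summation: for `z` in `(0, 1)` the terms are dominated by the probabilities of the disjoint
events that the first ladder epoch is `n + 1`. -/
theorem continuousWithinAt_ladderGen (hξ_meas : ∀ k, Measurable (ξ k)) {r : ℝ}
    (h0 : 0 ≤ r) (h1 : r ≤ 1) :
    Tendsto (fun z => ladderGen P ξ z r) (𝓝[<] 1) (𝓝 (ladderGen P ξ 1 r)) := by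
  refine tendsto_tsum_of_dominated_convergence (summable_measureReal_ladderAt (P := P) hξ_meas).1
    (fun n => ?_) ?_
  · exact ((Continuous.tendsto (by fun_prop) 1).mono_left nhdsWithin_le_nhds)
  · filter_upwards [Ioo_mem_nhdsLT (zero_lt_one (α := ℝ))] with z hz n
    rw [Real.norm_of_nonneg (mul_nonneg (pow_nonneg hz.1.le _) (ladderTerm_nonneg h0 _ _))]
    exact (mul_le_of_le_one_left (ladderTerm_nonneg h0 _ _) (pow_le_one₀ hz.1.le hz.2.le)).trans
      (ladderTerm_le h0 h1 _ _)

theorem continuous_charFun_re (m : Measure ℝ) [IsProbabilityMeasure m] :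
    Continuous fun t => (charFun m t).re :=
  Complex.continuous_re.comp continuous_charFun

theorem charFun_re_neg (m : Measure ℝ) (t : ℝ) : (charFun m (-t)).re = (charFun m t).re := by
  rw [charFun_neg, Complex.conj_re]

theorem abs_charFun_re_le (m : Measure ℝ) [IsProbabilityMeasure m] (t : ℝ) :
    |(charFun m t).re| ≤ 1 :=
  (Complex.abs_re_le_norm _).trans (norm_charFun_le_one _)

theorem ladderGen_eq_exp_of_lt_one (hξ_meas : ∀ k, Measurable (ξ k)) (hξ_indep : iIndepFun ξ P)
    (hξ_ident : ∀ k, IdentDistrib (ξ k) (ξ 0) P P)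
    (hξ_symm : IdentDistrib (fun a => -ξ 0 a) (ξ 0) P P) {z : ℝ} (hz0 : 0 ≤ z) (hz1 : z < 1)
    {r : ℝ} (h0 : 0 ≤ r) (h1 : r < 1) :
    1 - ladderGen P ξ z r = Real.exp ((2 * Real.pi)⁻¹ * ∫ t in (0 : ℝ)..Real.pi,
      (poissonWeight r t - 1) *
        Real.log (1 - z * (charFun (P.map (fun a => (ξ 0 a : ℝ))) t).re)) := by
  have hm : Measurable fun a => (ξ 0 a : ℝ) := (measurable_of_countable _).comp (hξ_meas 0)
  have : IsProbabilityMeasure (P.map (fun a => (ξ 0 a : ℝ))) :=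
    Measure.isProbabilityMeasure_map hm.aemeasurable
  set m := P.map (fun a => (ξ 0 a : ℝ)) with hm_def
  obtain ⟨l, hl, h⟩ := ladderGen_eq_exp_cauchy hξ_meas hξ_indep hξ_ident hz0 hz1
  have hpos : ∀ t, 0 < 1 - z * (charFun m t).re := fun t => by
    have := abs_le.1 (abs_charFun_re_le m t)
    nlinarith
  have hl' : ∀ t, l t = (Real.log (1 - z * (charFun m t).re) : ℂ) := fun t => by
    rw [hl, partialCharFun_univ_apply (hξ_meas 0) hξ_symm, Complex.ofReal_log (hpos t).le]
    push_cast; rfl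
  have hcont : Continuous fun t => (poissonWeight r t - 1) *
      Real.log (1 - z * (charFun m t).re) :=
    ((continuous_poissonWeight h0 h1).sub continuous_const).mul
      (Continuous.log (by have := continuous_charFun_re m; fun_prop) fun t => (hpos t).ne')
  -- The Poisson kernel at radius `0` is `1`, so the difference of the two kernels has real part
  -- `(poissonWeight r t - 1) / 2`; evenness turns the full period into twice `[0, π]`.
  have hre : (cauchyCLM r l - cauchyCLM 0 l).re = (2 * Real.pi)⁻¹ * ∫ t in (0 : ℝ)..Real.pi,
      (poissonWeight r t - 1) * Real.log (1 - z * (charFun m t).re) := by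
    rw [cauchyCLM_apply, cauchyCLM_apply, ← map_sub, ← sub_mul, periodMean_apply,
      show ((2 * Real.pi : ℂ)⁻¹) = (((2 * Real.pi)⁻¹ : ℝ) : ℂ) by push_cast; rfl,
      Complex.re_ofReal_mul]
    congr 1
    have h3 := Complex.reCLM.intervalIntegral_comp_comm (μ := volume) (a := -Real.pi)
      (b := Real.pi) (((cauchyKernel r - cauchyKernel 0) * l).continuous.intervalIntegrable _ _)
    rw [Complex.reCLM_apply] at h3
    rw [← h3]
    have h4 : ∀ t, Complex.reCLM (((cauchyKernel r - cauchyKernel 0) * l) t) =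
        (1 / 2) * ((poissonWeight r t - 1) * Real.log (1 - z * (charFun m t).re)) := fun t => by
      rw [BoundedContinuousFunction.mul_apply, hl', Complex.reCLM_apply, Complex.re_mul_ofReal,
        BoundedContinuousFunction.sub_apply, Complex.sub_re, cauchyKernel_re h0 h1,
        cauchyKernel_re le_rfl zero_lt_one]
      simp only [poissonWeight]
      norm_num
      ring
    simp only [h4]
    rw [intervalIntegral.integral_const_mul, integral_symm_of_even hcont fun t => by
      rw [poissonWeight_neg, charFun_re_neg]]
    ring
  -- Taking norms leaves only the real part of the exponent; the left side is recovered from its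
  -- norm because it is nonnegative.
  rw [← hre, ← Complex.norm_exp, ← h r h0 h1, ← Complex.ofReal_one, ← Complex.ofReal_sub,
    Complex.norm_real, Real.norm_of_nonneg]
  have := ladderGen_le (P := P) hξ_meas hz0 hz1.le h0 h1.le
  linarith [(summable_measureReal_ladderAt (P := P) hξ_meas).2]

end Gen

/-! ### Integrability of `log (1 - φ)` and the limit `z → 1`. -/

theorem charFun_re_eq (m : Measure ℝ) [IsProbabilityMeasure m] (t : ℝ) :
    (charFun m t).re = ∫ x, Real.cos (t * x) ∂m := by
  rw [charFun_apply_real]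
  have hi : Integrable (fun x : ℝ => Complex.exp (t * x * Complex.I)) m :=
    Integrable.of_bound (by fun_prop) 1 (Eventually.of_forall fun x => by
      rw [← Complex.ofReal_mul, Complex.norm_exp_ofReal_mul_I])
  have h := Complex.reCLM.integral_comp_comm hi
  rw [Complex.reCLM_apply] at h
  rw [← h]
  congr 1; ext x
  rw [Complex.reCLM_apply, ← Complex.ofReal_mul, Complex.exp_ofReal_mul_I_re]

theorem charFun_im_eq (m : Measure ℝ) [IsProbabilityMeasure m] (t : ℝ) :
    (charFun m t).im = ∫ x, Real.sin (t * x) ∂m := by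
  rw [charFun_apply_real]
  have hi : Integrable (fun x : ℝ => Complex.exp (t * x * Complex.I)) m :=
    Integrable.of_bound (by fun_prop) 1 (Eventually.of_forall fun x => by
      rw [← Complex.ofReal_mul, Complex.norm_exp_ofReal_mul_I])
  have h := Complex.imCLM.integral_comp_comm hi
  rw [Complex.imCLM_apply] at h
  rw [← h]
  congr 1; ext x
  rw [Complex.imCLM_apply, ← Complex.ofReal_mul, Complex.exp_ofReal_mul_I_im]

theorem integrable_cos_mul (m : Measure ℝ) [IsProbabilityMeasure m] (t : ℝ) :
    Integrable (fun x => Real.cos (t * x)) m :=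
  Integrable.of_bound (by fun_prop) 1 (Eventually.of_forall fun _ => Real.abs_cos_le_one _)

theorem integrable_sin_mul (m : Measure ℝ) [IsProbabilityMeasure m] (t : ℝ) :
    Integrable (fun x => Real.sin (t * x)) m :=
  Integrable.of_bound (by fun_prop) 1 (Eventually.of_forall fun _ => Real.abs_sin_le_one _)

theorem one_sub_charFun_re_eq (m : Measure ℝ) [IsProbabilityMeasure m] (t : ℝ) :
    1 - (charFun m t).re = ∫ x, (1 - Real.cos (t * x)) ∂m := by
  rw [charFun_re_eq, integral_sub (integrable_const _) (integrable_cos_mul m t)]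
  simp

/-- Otherwise the increment vanishes almost surely and `φ` is identically `1`, which `ν > 0`
excludes: the error term would have to equal `ν s ^ β`. -/
theorem exists_mass_of_charFun {m : Measure ℝ} [IsProbabilityMeasure m] {β ν : ℝ} (hν : 0 < ν)
    (hm : ∀ᵐ x ∂m, ∃ k : ℤ, (k : ℝ) = x)
    (h : (fun s : ℝ => charFun m s - (1 - ν * (s ^ β : ℝ))) =o[𝓝[>] 0] fun s : ℝ => s ^ β) :
    ∃ k : ℤ, k ≠ 0 ∧ 0 < m.real {(k : ℝ)} := by
  by_contra! hc
  have h0 : ∀ᵐ x ∂m, x = 0 := by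
    have : ∀ k : ℤ, k ≠ 0 → ∀ᵐ x ∂m, x ≠ (k : ℝ) := fun k hk => by
      have h1 : m.real {(k : ℝ)} = 0 := le_antisymm (hc k hk) measureReal_nonneg
      rw [measureReal_eq_zero_iff] at h1
      rw [ae_iff]
      convert h1 using 2
      ext x; simp
    have h2 : ∀ᵐ x ∂m, ∀ k : ℤ, k ≠ 0 → x ≠ (k : ℝ) :=
      ae_all_iff.2 fun k => by
        by_cases hk : k = 0
        · simp [hk]
        · filter_upwards [this k hk] with x h4 _ using h4
    filter_upwards [hm, h2] with x ⟨k, hk⟩ h3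
    by_contra hx
    have : k ≠ 0 := fun h4 => hx (by rw [← hk, h4]; simp)
    exact h3 k this hk.symm
  have h1 : ∀ t, charFun m t = 1 := fun t => by
    rw [charFun_apply_real]
    have : (fun x : ℝ => Complex.exp (t * x * Complex.I)) =ᵐ[m] fun _ => 1 := by
      filter_upwards [h0] with x hx
      simp [hx]
    rw [integral_congr_ae this]; simp
  have h2 := h.def (half_pos hν)
  obtain ⟨s, hs, hs0⟩ := (h2.and self_mem_nhdsWithin).exists
  have hs0' : (0 : ℝ) < s := hs0
  have hp := Real.rpow_pos_of_pos hs0' β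
  rw [h1, sub_sub_cancel, norm_mul, Complex.norm_real, Complex.norm_real, Real.norm_of_nonneg hν.le,
    Real.norm_of_nonneg hp.le] at hs
  nlinarith

/-- The integrand `1 - cos (t x)` is nonnegative, so the contribution of one atom is a lower bound.
-/
theorem mass_mul_le_one_sub_charFun (m : Measure ℝ) [IsProbabilityMeasure m] (k t : ℝ) :
    m.real {k} * (1 - Real.cos (t * k)) ≤ 1 - (charFun m t).re := by
  rw [one_sub_charFun_re_eq]
  have hi : Integrable (fun x => 1 - Real.cos (t * x)) m :=
    (integrable_const _).sub (integrable_cos_mul m t)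
  calc m.real {k} * (1 - Real.cos (t * k)) = ∫ x in {k}, (1 - Real.cos (t * x)) ∂m := by
        rw [integral_singleton, smul_eq_mul]
    _ ≤ _ := setIntegral_le_integral hi
        (Eventually.of_forall fun x => sub_nonneg.2 (Real.cos_le_one _))

theorem one_sub_cos_eq (x : ℝ) : 1 - Real.cos x = 2 * Real.sin (x / 2) ^ 2 := by
  rw [Real.sin_sq_eq_half_sub, mul_div_cancel₀ _ two_ne_zero]; ring

theorem ae_sin_ne_zero {k : ℝ} (hk : k ≠ 0) : ∀ᵐ t : ℝ, Real.sin (k * t) ≠ 0 := by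
  have h : {t : ℝ | Real.sin (k * t) = 0} ⊆ Set.range fun n : ℤ => n * Real.pi / k := by
    intro t ht
    obtain ⟨n, hn⟩ := Real.sin_eq_zero_iff.1 ht
    exact ⟨n, by simp only; rw [hn]; field_simp⟩
  have h2 := ((Set.countable_range _).mono h).measure_zero (volume : Measure ℝ)
  rw [ae_iff]
  simpa using h2

theorem intervalIntegrable_log_sin_mul {k : ℝ} (a b : ℝ) :
    IntervalIntegrable (fun t => Real.log (Real.sin (k * t))) volume a b := by
  have h : AnalyticOnNhd ℝ (fun t => Real.sin (k * t)) (Set.uIcc a b) := fun t _ => by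
    fun_prop
  exact h.meromorphicOn.intervalIntegrable_log

theorem ae_charFun_re_lt_one {m : Measure ℝ} [IsProbabilityMeasure m]
    (hk : ∃ k : ℤ, k ≠ 0 ∧ 0 < m.real {(k : ℝ)}) : ∀ᵐ t : ℝ, (charFun m t).re < 1 := by
  obtain ⟨k, hk0, hp⟩ := hk
  have hk2 : (k : ℝ) / 2 ≠ 0 := by
    have : (k : ℝ) ≠ 0 := by exact_mod_cast hk0
    positivity
  filter_upwards [ae_sin_ne_zero hk2] with t ht
  have h := mass_mul_le_one_sub_charFun m k t
  rw [one_sub_cos_eq, show t * k / 2 = k / 2 * t by ring] at h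
  have : 0 < m.real {(k : ℝ)} * (2 * Real.sin (k / 2 * t) ^ 2) := by positivity
  linarith

/-- An atom of mass `p` at `k ≠ 0` gives `2 p sin² (k t / 2) ≤ 1 - φ ≤ 2`, and the logarithm of a
sine is locally integrable. -/
theorem intervalIntegrable_log_one_sub_charFun {m : Measure ℝ} [IsProbabilityMeasure m]
    (hk : ∃ k : ℤ, k ≠ 0 ∧ 0 < m.real {(k : ℝ)}) (a b : ℝ) :
    IntervalIntegrable (fun t => Real.log (1 - (charFun m t).re)) volume a b := by
  obtain ⟨k, hk0, hp⟩ := hk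
  have hk2 : (k : ℝ) / 2 ≠ 0 := by
    have : (k : ℝ) ≠ 0 := by exact_mod_cast hk0
    positivity
  have hB : IntervalIntegrable (fun t => (|Real.log (m.real {(k : ℝ)} * 2)| + Real.log 2) +
      2 * |Real.log (Real.sin (k / 2 * t))|) volume a b :=
    intervalIntegrable_const.add ((intervalIntegrable_log_sin_mul a b).abs.const_mul 2)
  refine hB.mono_fun ?_ ?_
  · have := continuous_charFun_re m
    exact (Measurable.log (by fun_prop)).aestronglyMeasurable
  · refine ae_restrict_of_ae ?_
    filter_upwards [ae_sin_ne_zero hk2] with t ht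
    have h := mass_mul_le_one_sub_charFun m k t
    rw [one_sub_cos_eq, show t * k / 2 = k / 2 * t by ring] at h
    have hs : 0 < m.real {(k : ℝ)} * (2 * Real.sin (k / 2 * t) ^ 2) := by positivity
    have h1 := Real.log_le_log hs h
    rw [← mul_assoc, Real.log_mul (by positivity) (by positivity), Real.log_pow] at h1
    have h2 : Real.log (1 - (charFun m t).re) ≤ Real.log 2 :=
      Real.log_le_log (hs.trans_le h) (by linarith [(abs_le.1 (abs_charFun_re_le m t)).1])
    have h3 := abs_nonneg (Real.log (Real.sin (k / 2 * t)))
    have h4 := abs_nonneg (Real.log (m.real {(k : ℝ)} * 2))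
    have h5 := neg_abs_le (Real.log (Real.sin (k / 2 * t)))
    have h6 := neg_abs_le (Real.log (m.real {(k : ℝ)} * 2))
    have h7 := Real.log_nonneg (one_le_two (α := ℝ))
    push_cast at h1
    rw [Real.norm_eq_abs, Real.norm_of_nonneg (by positivity), abs_le]
    constructor <;> linarith

/-- For either sign of `x`, the number `1 - z x` lies between `1` and `1 - x`. This supplies the
domination in the limit `z → 1`. -/
theorem abs_log_one_sub_mul_le {z x : ℝ} (hz0 : 0 ≤ z) (hz1 : z ≤ 1) (hx1 : x < 1) :
    |Real.log (1 - z * x)| ≤ |Real.log (1 - x)| := by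
  rcases le_total 0 x with h | h
  · have h1 : 1 - x ≤ 1 - z * x := by nlinarith
    have h2 := Real.log_le_log (by linarith) h1
    have h3 : Real.log (1 - z * x) ≤ 0 := Real.log_nonpos (by linarith) (by nlinarith)
    rw [abs_of_nonpos h3, abs_of_nonpos (h2.trans h3)]; linarith
  · have h1 : 1 - z * x ≤ 1 - x := by nlinarith
    have h4 : 1 ≤ 1 - z * x := by nlinarith
    have h2 := Real.log_le_log (by linarith) h1
    have h3 : 0 ≤ Real.log (1 - z * x) := Real.log_nonneg h4
    rw [abs_of_nonneg h3, abs_of_nonneg (h3.trans h2)]; exact h2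

theorem tendsto_integral_log_one_sub_mul {m : Measure ℝ} [IsProbabilityMeasure m]
    (hk : ∃ k : ℤ, k ≠ 0 ∧ 0 < m.real {(k : ℝ)}) {w : ℝ → ℝ} (hw : Continuous w) (a b : ℝ) :
    Tendsto (fun z => ∫ t in a..b, w t * Real.log (1 - z * (charFun m t).re)) (𝓝[<] 1)
      (𝓝 (∫ t in a..b, w t * Real.log (1 - (charFun m t).re))) := by
  have hint := intervalIntegrable_log_one_sub_charFun hk a b
  refine intervalIntegral.tendsto_integral_filter_of_dominated_convergence
    (fun t => |w t * Real.log (1 - (charFun m t).re)|) ?_ ?_ ?_ ?_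
  · refine Eventually.of_forall fun z => ?_
    have := continuous_charFun_re m
    exact (hw.measurable.mul (Measurable.log (by fun_prop))).aestronglyMeasurable
  · filter_upwards [Ioo_mem_nhdsLT (zero_lt_one (α := ℝ))] with z hz
    filter_upwards [ae_charFun_re_lt_one hk] with t ht _
    rw [Real.norm_eq_abs, abs_mul, abs_mul]
    exact mul_le_mul_of_nonneg_left (abs_log_one_sub_mul_le hz.1.le hz.2.le ht) (abs_nonneg _)
  · exact (hint.continuousOn_mul hw.continuousOn).abs
  · filter_upwards [ae_charFun_re_lt_one hk] with t ht _
    have h1 : Tendsto (fun z => 1 - z * (charFun m t).re) (𝓝[<] 1)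
        (𝓝 (1 - 1 * (charFun m t).re)) :=
      (Continuous.tendsto (by fun_prop) 1).mono_left nhdsWithin_le_nhds
    rw [one_mul] at h1
    exact (h1.log (by linarith)).const_mul _

/-- The limit `z → 1` has weight `poissonWeight r t - 1`; the part with `-1` is exactly the exponent
that defines `ladderPhi`. -/
theorem ladderGen_one_eq {Ω : Type*} [MeasurableSpace Ω] {P : Measure Ω} [IsProbabilityMeasure P]
    {ξ : ℕ → Ω → ℤ} (hξ_meas : ∀ k, Measurable (ξ k)) (hξ_indep : iIndepFun ξ P)
    (hξ_ident : ∀ k, IdentDistrib (ξ k) (ξ 0) P P)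
    (hξ_symm : IdentDistrib (fun a => -ξ 0 a) (ξ 0) P P)
    (hk : ∃ k : ℤ, k ≠ 0 ∧ 0 < (P.map (fun a => (ξ 0 a : ℝ))).real {(k : ℝ)})
    {r : ℝ} (h0 : 0 ≤ r) (h1 : r < 1) :
    1 - ladderGen P ξ 1 r = ladderPhi (P.map (fun a => (ξ 0 a : ℝ))) 1 *
      Real.exp ((2 * Real.pi)⁻¹ * ∫ t in (0 : ℝ)..Real.pi, poissonWeight r t *
        Real.log (1 - (charFun (P.map (fun a => (ξ 0 a : ℝ))) t).re)) := by
  have hm : Measurable fun a => (ξ 0 a : ℝ) := (measurable_of_countable _).comp (hξ_meas 0)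
  have : IsProbabilityMeasure (P.map (fun a => (ξ 0 a : ℝ))) :=
    Measure.isProbabilityMeasure_map hm.aemeasurable
  set m := P.map (fun a => (ξ 0 a : ℝ)) with hm_def
  have hc := continuous_poissonWeight h0 h1
  have hint := intervalIntegrable_log_one_sub_charFun hk 0 Real.pi
  have hl := ((tendsto_integral_log_one_sub_mul hk
    (w := fun t => poissonWeight r t - 1) (hc.sub continuous_const) 0
    Real.pi).const_mul ((2 * Real.pi)⁻¹)).rexp
  have hl2 := (continuousWithinAt_ladderGen (P := P) hξ_meas h0 h1.le).const_sub 1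
  have heq : (fun z => 1 - ladderGen P ξ z r) =ᶠ[𝓝[<] 1] fun z =>
      Real.exp ((2 * Real.pi)⁻¹ * ∫ t in (0 : ℝ)..Real.pi,
      (poissonWeight r t - 1) * Real.log (1 - z * (charFun m t).re)) := by
    filter_upwards [Ioo_mem_nhdsLT (zero_lt_one (α := ℝ))] with z hz
    exact ladderGen_eq_exp_of_lt_one hξ_meas hξ_indep hξ_ident hξ_symm hz.1.le hz.2 h0 h1
  rw [tendsto_nhds_unique (hl2.congr' heq) hl, ladderPhi, ← Real.exp_add]
  congr 1
  simp only [sub_mul, one_mul]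
  rw [intervalIntegral.integral_sub (hint.continuousOn_mul hc.continuousOn) hint]
  ring

/-! ### Poisson averages of logarithms and the behaviour at `r → 1`. -/

theorem norm_one_sub_mul_exp_sq (s t : ℝ) :
    ‖(1 : ℂ) - s * Complex.exp (t * Complex.I)‖ ^ 2 = 1 - 2 * s * Real.cos t + s ^ 2 := by
  rw [← Complex.normSq_eq_norm_sq, Complex.exp_mul_I, ← Complex.ofReal_cos, ← Complex.ofReal_sin,
    Complex.normSq_apply]
  simp only [Complex.sub_re, Complex.one_re, Complex.mul_re, Complex.ofReal_re, Complex.add_re,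
      Complex.ofReal_im, Complex.sub_im, Complex.one_im, Complex.mul_im, Complex.I_re,
      Complex.I_im, Complex.add_im]
  nlinarith [Real.sin_sq_add_cos_sq t]

theorem integral_poissonWeight_smul {f : ℂ → ℂ} (hf : DiffContOnCl ℂ f (Metric.ball 0 1)) {r : ℝ}
    (h0 : 0 ≤ r) (h1 : r < 1) :
    (2 * Real.pi)⁻¹ * ∫ t in (-Real.pi)..Real.pi,
      poissonWeight r t * (f (Complex.exp (t * Complex.I))).re = (f r).re := by
  have hw : (r : ℂ) ∈ Metric.ball (0 : ℂ) 1 := by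
    simpa [abs_of_nonneg h0] using h1
  have h := hf.circleAverage_poissonKernel_smul' hw
  set F : ℂ → ℂ := fun z => ((‖z - 0‖ ^ 2 - ‖(r : ℂ) - 0‖ ^ 2) /
    ‖(z - 0) - ((r : ℂ) - 0)‖ ^ 2) • f z with hF
  have hP : ∀ t : ℝ, F (circleMap 0 1 t) =
      (poissonWeight r t : ℂ) * f (Complex.exp (t * Complex.I)) := by
    intro t
    have e1 : circleMap 0 1 t = Complex.exp (t * Complex.I) := by simp [circleMap]
    have e2 : ‖Complex.exp (t * Complex.I) - r‖ ^ 2 = 1 - 2 * r * Real.cos t + r ^ 2 := by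
      rw [← Complex.normSq_eq_norm_sq, Complex.exp_mul_I, ← Complex.ofReal_cos,
        ← Complex.ofReal_sin, Complex.normSq_apply]
      simp only [Complex.sub_re, Complex.mul_re, Complex.ofReal_re, Complex.add_re,
          Complex.ofReal_im, Complex.sub_im, Complex.mul_im, Complex.I_re,
          Complex.I_im, Complex.add_im]
      nlinarith [Real.sin_sq_add_cos_sq t]
    simp only [hF, e1, sub_zero]
    rw [e2, Complex.norm_exp_ofReal_mul_I, Complex.norm_real, Real.norm_of_nonneg h0,
      Complex.real_smul, poissonWeight]
    norm_num
  rw [Real.circleAverage_def] at h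
  have hper : Function.Periodic (fun t : ℝ => F (circleMap 0 1 t)) (2 * Real.pi) :=
    fun t => by simp only [periodic_circleMap 0 1 t]
  have h2 := hper.intervalIntegral_add_eq 0 (-Real.pi)
  rw [zero_add, show -Real.pi + 2 * Real.pi = Real.pi by ring] at h2
  rw [h2] at h
  simp only [hP] at h
  have hcont : Continuous fun t : ℝ => (poissonWeight r t : ℂ) * f (Complex.exp (t * Complex.I)) := by
    refine (Complex.continuous_ofReal.comp (continuous_poissonWeight h0 h1)).mul ?_
    refine hf.continuousOn.comp_continuous (by fun_prop) fun t => ?_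
    rw [closure_ball _ one_ne_zero]
    simp [Complex.norm_exp_ofReal_mul_I]
  have h3 := Complex.reCLM.intervalIntegral_comp_comm (μ := volume) (a := -Real.pi)
      (b := Real.pi) (hcont.intervalIntegrable _ _)
  simp only [Complex.reCLM_apply, Complex.re_ofReal_mul] at h3
  rw [h3, ← h, Complex.smul_re, smul_eq_mul]

theorem integral_poissonWeight {r : ℝ} (h0 : 0 ≤ r) (h1 : r < 1) :
    ∫ t in (0 : ℝ)..Real.pi, poissonWeight r t = Real.pi := by
  have h := integral_poissonWeight_smul (f := fun _ => 1) diffContOnCl_const h0 h1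
  simp only [Complex.one_re, mul_one] at h
  rw [integral_symm_of_even (continuous_poissonWeight h0 h1) (poissonWeight_neg r)] at h
  have hpi := Real.pi_pos
  field_simp at h
  exact h

/-- `log (1 - s u)` is analytic across the closed unit disc when `s < 1`, and its real part on the
circle is half the logarithm in the integrand; the Poisson formula evaluates it at `u = r`. -/
theorem integral_poissonWeight_log_of_lt_one {r s : ℝ} (h0 : 0 ≤ r) (h1 : r < 1) (hs0 : 0 ≤ s)
    (hs1 : s < 1) :
    ∫ t in (0 : ℝ)..Real.pi, poissonWeight r t * Real.log (1 - 2 * s * Real.cos t + s ^ 2) =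
      2 * Real.pi * Real.log (1 - s * r) := by
  have hslit : ∀ u ∈ closure (Metric.ball (0 : ℂ) 1), 1 - (s : ℂ) * u ∈ Complex.slitPlane := by
    intro u hu
    rw [closure_ball _ one_ne_zero, mem_closedBall_zero_iff] at hu
    left
    have h2 : ((s : ℂ) * u).re ≤ s := by
      rw [Complex.re_ofReal_mul]
      exact mul_le_of_le_one_right hs0 ((Complex.re_le_norm u).trans hu)
    simp only [Complex.sub_re, Complex.one_re]
    linarith
  have hf : DiffContOnCl ℂ (fun u => Complex.log (1 - s * u)) (Metric.ball 0 1) := by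
    refine ⟨fun u hu => ?_, fun u hu => ?_⟩
    · have hd : DifferentiableAt ℂ (fun u : ℂ => 1 - (s : ℂ) * u) u := by fun_prop
      exact (hd.clog (hslit u (subset_closure hu))).differentiableWithinAt
    · have hc : ContinuousAt (fun u : ℂ => 1 - (s : ℂ) * u) u := by fun_prop
      exact (hc.clog (hslit u hu)).continuousWithinAt
  have h := integral_poissonWeight_smul hf h0 h1
  have hlog : ∀ t : ℝ, (Complex.log (1 - s * Complex.exp (t * Complex.I))).re =
      (1 / 2) * Real.log (1 - 2 * s * Real.cos t + s ^ 2) := fun t => by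
    rw [Complex.log_re, ← norm_one_sub_mul_exp_sq, Real.log_pow]
    push_cast; ring
  have hsr : (Complex.log (1 - s * r)).re = Real.log (1 - s * r) := by
    rw [Complex.log_re, show (1 - (s : ℂ) * r) = ((1 - s * r : ℝ) : ℂ) by push_cast; rfl,
      Complex.norm_real, Real.norm_of_nonneg (by nlinarith)]
  simp only [hlog] at h
  rw [hsr] at h
  have hcont : Continuous fun t => poissonWeight r t *
      (1 / 2 * Real.log (1 - 2 * s * Real.cos t + s ^ 2)) :=
    (continuous_poissonWeight h0 h1).mul (continuous_const.mul
      (Continuous.log (by fun_prop) fun t => (poissonWeight_denom_pos hs0 hs1 t).ne'))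
  rw [integral_symm_of_even hcont fun t => by rw [poissonWeight_neg, Real.cos_neg]] at h
  have e : ∀ t, poissonWeight r t * (1 / 2 * Real.log (1 - 2 * s * Real.cos t + s ^ 2)) =
      (1 / 2) * (poissonWeight r t * Real.log (1 - 2 * s * Real.cos t + s ^ 2)) := fun t => by ring
  simp only [e] at h
  rw [intervalIntegral.integral_const_mul] at h
  have hpi := Real.pi_pos
  rw [← h]
  field_simp

theorem intervalIntegrable_log_two_sub_two_cos (a b : ℝ) :
    IntervalIntegrable (fun t => Real.log (2 - 2 * Real.cos t)) volume a b := by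
  have h : AnalyticOnNhd ℝ (fun t => 2 - 2 * Real.cos t) (Set.uIcc a b) := fun t _ => by
    fun_prop
  exact h.meromorphicOn.intervalIntegrable_log

theorem integral_poissonWeight_log {r : ℝ} (h0 : 0 ≤ r) (h1 : r < 1) :
    ∫ t in (0 : ℝ)..Real.pi, poissonWeight r t * Real.log (2 - 2 * Real.cos t) =
      2 * Real.pi * Real.log (1 - r) := by
  have hw := continuous_poissonWeight h0 h1
  have hl : Tendsto (fun s => ∫ t in (0 : ℝ)..Real.pi,
      poissonWeight r t * Real.log (1 - 2 * s * Real.cos t + s ^ 2)) (𝓝[<] 1)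
      (𝓝 (∫ t in (0 : ℝ)..Real.pi, poissonWeight r t * Real.log (2 - 2 * Real.cos t))) := by
    refine intervalIntegral.tendsto_integral_filter_of_dominated_convergence
      (fun t => poissonWeight r t * (4 * Real.log 2 + |Real.log (2 - 2 * Real.cos t)|)) ?_ ?_ ?_ ?_
    · refine Eventually.of_forall fun z => ?_
      exact (hw.measurable.mul (Measurable.log (by fun_prop))).aestronglyMeasurable
    · filter_upwards [Ioo_mem_nhdsLT (zero_lt_one (α := ℝ))] with s hs
      filter_upwards [ae_sin_ne_zero (k := 1 / 2) (by norm_num)] with t ht _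
      have hp : 0 < 2 - 2 * Real.cos t := by
        have := one_sub_cos_eq t
        rw [show t / 2 = 1 / 2 * t by ring] at this
        have : 0 < Real.sin (1 / 2 * t) ^ 2 := by positivity
        linarith
      have hc1 := Real.cos_le_one t
      have hc2 := Real.neg_one_le_cos t
      -- A lower bound uniform in `s`. If `cos t ≥ 0`, the right side is at least its minimum `sin²
      -- t` over `s`, and `sin² t ≥ 1 - cos t`; if `cos t ≤ 0`, the left side is at most `1` and the
      -- right side at least `1`.
      have hlow : (2 - 2 * Real.cos t) / 4 ≤ 1 - 2 * s * Real.cos t + s ^ 2 := by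
        rcases le_total 0 (Real.cos t) with h | h
        · nlinarith [sq_nonneg (s - Real.cos t)]
        · nlinarith [sq_nonneg s, mul_nonneg hs.1.le (neg_nonneg.2 h)]
      have hup : 1 - 2 * s * Real.cos t + s ^ 2 ≤ 4 := by nlinarith [hs.1, hs.2]
      have h4 : Real.log 4 = 2 * Real.log 2 := by
        rw [show (4 : ℝ) = 2 ^ 2 by norm_num, Real.log_pow]; norm_num
      have l1 := Real.log_le_log (by positivity) hlow
      have l2 := Real.log_le_log (lt_of_lt_of_le (by positivity) hlow) hup
      rw [Real.log_div hp.ne' (by norm_num), h4] at l1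
      rw [h4] at l2
      have h7 := Real.log_nonneg (one_le_two (α := ℝ))
      have h8 := abs_nonneg (Real.log (2 - 2 * Real.cos t))
      have h9 := neg_abs_le (Real.log (2 - 2 * Real.cos t))
      rw [norm_mul, Real.norm_of_nonneg (poissonWeight_nonneg h0 h1 t)]
      refine mul_le_mul_of_nonneg_left ?_ (poissonWeight_nonneg h0 h1 t)
      rw [Real.norm_eq_abs, abs_le]
      constructor <;> linarith
    · exact (intervalIntegrable_const.add
        (intervalIntegrable_log_two_sub_two_cos _ _).abs).continuousOn_mul hw.continuousOn
    · filter_upwards [ae_sin_ne_zero (k := 1 / 2) (by norm_num)] with t ht _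
      have hp : 0 < 2 - 2 * Real.cos t := by
        have := one_sub_cos_eq t
        rw [show t / 2 = 1 / 2 * t by ring] at this
        have : 0 < Real.sin (1 / 2 * t) ^ 2 := by positivity
        linarith
      have h1 : Tendsto (fun s : ℝ => 1 - 2 * s * Real.cos t + s ^ 2) (𝓝[<] 1)
          (𝓝 (1 - 2 * 1 * Real.cos t + 1 ^ 2)) :=
        (Continuous.tendsto (by fun_prop) 1).mono_left nhdsWithin_le_nhds
      rw [show 1 - 2 * 1 * Real.cos t + 1 ^ 2 = 2 - 2 * Real.cos t by ring] at h1
      exact (h1.log hp.ne').const_mul _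
  have hl2 : Tendsto (fun s => 2 * Real.pi * Real.log (1 - s * r)) (𝓝[<] 1)
      (𝓝 (2 * Real.pi * Real.log (1 - 1 * r))) := by
    refine Tendsto.const_mul _ (Tendsto.log ?_ (by linarith))
    exact (Continuous.tendsto (by fun_prop) 1).mono_left nhdsWithin_le_nhds
  rw [one_mul] at hl2
  refine tendsto_nhds_unique hl (hl2.congr' ?_)
  filter_upwards [Ioo_mem_nhdsLT (zero_lt_one (α := ℝ))] with s hs
  exact (integral_poissonWeight_log_of_lt_one h0 h1 hs.1.le hs.2).symm

/-- `poissonWeight r / π` is an approximate identity on `(0, π]` with its peak at the excluded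
endpoint `0`, so only the limit from the right enters. -/
theorem tendsto_integral_poissonWeight_mul {g : ℝ → ℝ} {L : ℝ}
    (hg : IntegrableOn g (Set.Ioc 0 Real.pi)) (hL : Tendsto g (𝓝[>] 0) (𝓝 L)) :
    Tendsto (fun r => Real.pi⁻¹ * ∫ t in (0 : ℝ)..Real.pi, poissonWeight r t * g t) (𝓝[<] 1)
      (𝓝 L) := by
  have hpi := Real.pi_pos
  have hI : Set.Ioo (2⁻¹ : ℝ) 1 ∈ 𝓝[<] (1 : ℝ) := Ioo_mem_nhdsLT (by norm_num)
  have key := tendsto_setIntegral_peak_smul_of_integrableOn_of_tendsto (μ := volume)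
    (s := Set.Ioc 0 Real.pi) (t := Set.Ioc 0 Real.pi) (x₀ := 0) (l := 𝓝[<] (1 : ℝ))
    (φ := fun r t => Real.pi⁻¹ * poissonWeight r t) (g := g) (a := L)
    measurableSet_Ioc measurableSet_Ioc subset_rfl self_mem_nhdsWithin (by simp) ?_ ?_ ?_ ?_ hg
    (hL.mono_left (nhdsWithin_mono _ Set.Ioc_subset_Ioi_self))
  · refine key.congr fun r => ?_
    rw [intervalIntegral.integral_of_le hpi.le, ← integral_const_mul]
    simp only [smul_eq_mul, mul_assoc]
  · filter_upwards [hI] with r hr t _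
    exact mul_nonneg (by positivity) (poissonWeight_nonneg (by linarith [hr.1]) hr.2 t)
  · intro u hu h0
    obtain ⟨δ, hδ, hδu⟩ := Metric.isOpen_iff.1 hu 0 h0
    set d := min δ Real.pi with hd
    have hdpos : 0 < d := lt_min hδ hpi
    have hcos : 0 < 1 - Real.cos d := by
      have h := Real.cos_lt_cos_of_nonneg_of_le_pi (le_refl 0) (min_le_right δ Real.pi) hdpos
      rw [Real.cos_zero] at h
      linarith
    have hlim : Tendsto (fun r : ℝ => Real.pi⁻¹ * ((1 - r ^ 2) / (1 - Real.cos d))) (𝓝[<] 1)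
        (𝓝 0) := by
      have : Tendsto (fun r : ℝ => Real.pi⁻¹ * ((1 - r ^ 2) / (1 - Real.cos d))) (𝓝[<] 1)
        (𝓝 (Real.pi⁻¹ * ((1 - 1 ^ 2) / (1 - Real.cos d)))) :=
        (Continuous.tendsto (by fun_prop) 1).mono_left nhdsWithin_le_nhds
      simpa using this
    rw [Metric.tendstoUniformlyOn_iff]
    intro ε hε
    filter_upwards [hI, hlim.eventually (gt_mem_nhds hε)] with r hr hrε t ht
    have hr0 : 0 ≤ r := by linarith [hr.1]
    have hdt : d ≤ t := by
      by_contra! hlt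
      refine ht.2 (hδu ?_)
      rw [Metric.mem_ball, Real.dist_eq, sub_zero, abs_of_pos ht.1.1]
      exact hlt.trans_le (min_le_left _ _)
    have hct : Real.cos t ≤ Real.cos d :=
      Real.cos_le_cos_of_nonneg_of_le_pi hdpos.le ht.1.2 hdt
    rw [Pi.zero_apply, dist_zero_left, Real.norm_of_nonneg
      (mul_nonneg (by positivity) (poissonWeight_nonneg hr0 hr.2 t))]
    refine lt_of_le_of_lt (mul_le_mul_of_nonneg_left ?_ (by positivity)) hrε
    -- The denominator is `(1 - r)² + 2 r (1 - cos t)`, which is at least `1 - cos d` as soon as `r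
    -- ≥ 1/2`.
    refine div_le_div_of_nonneg_left (by nlinarith [hr.2]) hcos ?_
    nlinarith [hr.1, sq_nonneg (1 - r)]
  · refine tendsto_const_nhds.congr' ?_
    filter_upwards [hI] with r hr
    rw [integral_const_mul, ← intervalIntegral.integral_of_le hpi.le,
      integral_poissonWeight (by linarith [hr.1]) hr.2, inv_mul_cancel₀ hpi.ne']
  · filter_upwards [hI] with r hr
    exact (continuous_const.mul
      (continuous_poissonWeight (by linarith [hr.1]) hr.2)).aestronglyMeasurable

theorem tendsto_two_sub_two_cos_div_sq :
    Tendsto (fun t : ℝ => (2 - 2 * Real.cos t) / t ^ 2) (𝓝[>] 0) (𝓝 1) := by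
  have h : HasDerivAt Real.sin 1 0 := by simpa using Real.hasDerivAt_sin 0
  have h2 := h.tendsto_slope_zero_right
  simp only [zero_add, Real.sin_zero, sub_zero, smul_eq_mul] at h2
  have h3 : Tendsto (fun t : ℝ => t / 2) (𝓝[>] 0) (𝓝[>] 0) := by
    refine tendsto_nhdsWithin_iff.2 ⟨?_, ?_⟩
    · have : Tendsto (fun t : ℝ => t / 2) (𝓝[>] 0) (𝓝 (0 / 2)) :=
        (Continuous.tendsto (by fun_prop) 0).mono_left nhdsWithin_le_nhds
      simpa using this
    · filter_upwards [self_mem_nhdsWithin] with t ht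
      exact half_pos (Set.mem_Ioi.1 ht)
  have h4 := (h2.comp h3).pow 2
  rw [one_pow] at h4
  refine h4.congr' ?_
  filter_upwards [self_mem_nhdsWithin] with t ht
  have ht' : t ≠ 0 := ne_of_gt ht
  have := one_sub_cos_eq t
  rw [show 2 - 2 * Real.cos t = 2 * (1 - Real.cos t) by ring, this]
  simp only [Function.comp]
  field_simp

theorem tendsto_one_sub_charFun_re_div {m : Measure ℝ} {β ν : ℝ}
    (h : (fun s : ℝ => charFun m s - (1 - ν * (s ^ β : ℝ))) =o[𝓝[>] 0] fun s : ℝ => s ^ β) :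
    Tendsto (fun s => (1 - (charFun m s).re) / s ^ β) (𝓝[>] 0) (𝓝 ν) := by
  have h1 : (fun s : ℝ => (1 - (charFun m s).re) - ν * s ^ β) =o[𝓝[>] 0] fun s : ℝ => s ^ β := by
    refine IsBigO.trans_isLittleO (IsBigO.of_bound 1 (Eventually.of_forall fun s => ?_)) h
    rw [one_mul, Real.norm_eq_abs, ← abs_neg]
    refine le_trans (le_of_eq ?_) (Complex.abs_re_le_norm _)
    rw [Complex.sub_re, Complex.sub_re, Complex.one_re, Complex.re_ofReal_mul, Complex.ofReal_re]
    congr 1; ring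
  have h2 := h1.tendsto_div_nhds_zero.add_const ν
  rw [zero_add] at h2
  refine h2.congr' ?_
  filter_upwards [self_mem_nhdsWithin] with s hs
  have : s ^ β ≠ 0 := (Real.rpow_pos_of_pos hs β).ne'
  field_simp
  ring

/-- The singularity of `log (1 - φ)` at `0` is that of `β log t`. Subtracting the model `(β/2) log
(2 - 2 cos t)`, whose Poisson average is explicit, leaves an integrable function with limit `log ν`
at `0+`. -/
theorem tendsto_poisson_log_sub {m : Measure ℝ} [IsProbabilityMeasure m] {β ν : ℝ} (hν : 0 < ν)
    (hk : ∃ k : ℤ, k ≠ 0 ∧ 0 < m.real {(k : ℝ)})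
    (h : (fun s : ℝ => charFun m s - (1 - ν * (s ^ β : ℝ))) =o[𝓝[>] 0] fun s : ℝ => s ^ β) :
    Tendsto (fun r => (Real.pi⁻¹ * ∫ t in (0 : ℝ)..Real.pi, poissonWeight r t *
      Real.log (1 - (charFun m t).re)) - β * Real.log (1 - r)) (𝓝[<] 1) (𝓝 (Real.log ν)) := by
  have hpi := Real.pi_pos
  have hi1 := intervalIntegrable_log_one_sub_charFun hk 0 Real.pi
  have hi2 := (intervalIntegrable_log_two_sub_two_cos 0 Real.pi).const_mul (β / 2)
  have hlim : Tendsto (fun t => Real.log (1 - (charFun m t).re) -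
      β / 2 * Real.log (2 - 2 * Real.cos t)) (𝓝[>] 0) (𝓝 (Real.log ν)) := by
    have h1 := (tendsto_one_sub_charFun_re_div h)
    have h2 := tendsto_two_sub_two_cos_div_sq
    have h3 := (h1.log hν.ne').sub ((h2.log one_ne_zero).const_mul (β / 2))
    rw [Real.log_one, mul_zero, sub_zero] at h3
    refine h3.congr' ?_
    filter_upwards [self_mem_nhdsWithin, h1.eventually (lt_mem_nhds hν),
      h2.eventually (lt_mem_nhds one_pos)] with t ht ha hb
    have ht' : (0 : ℝ) < t := ht
    have ha' := (div_pos_iff_of_pos_right (Real.rpow_pos_of_pos ht' β)).1 ha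
    have hb' := (div_pos_iff_of_pos_right (pow_pos ht' 2)).1 hb
    rw [Real.log_div ha'.ne' (Real.rpow_pos_of_pos ht' β).ne', Real.log_div hb'.ne'
      (pow_pos ht' 2).ne', Real.log_rpow ht', Real.log_pow]
    push_cast; ring
  have key := tendsto_integral_poissonWeight_mul
    ((intervalIntegrable_iff_integrableOn_Ioc_of_le hpi.le).1 (hi1.sub hi2)) hlim
  refine key.congr' ?_
  filter_upwards [Ioo_mem_nhdsLT (zero_lt_one (α := ℝ))] with r hr
  have hw := continuous_poissonWeight hr.1.le hr.2
  simp only [mul_sub]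
  rw [intervalIntegral.integral_sub (hi1.continuousOn_mul hw.continuousOn)
    (hi2.continuousOn_mul hw.continuousOn)]
  simp only [mul_left_comm _ (β / 2) _]
  rw [intervalIntegral.integral_const_mul, integral_poissonWeight_log hr.1.le hr.2]
  field_simp

theorem tendsto_one_sub_ladderGen_div {Ω : Type*} [MeasurableSpace Ω] {P : Measure Ω}
    [IsProbabilityMeasure P]
    {ξ : ℕ → Ω → ℤ} (hξ_meas : ∀ k, Measurable (ξ k)) (hξ_indep : iIndepFun ξ P)
    (hξ_ident : ∀ k, IdentDistrib (ξ k) (ξ 0) P P)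
    (hξ_symm : IdentDistrib (fun a => -ξ 0 a) (ξ 0) P P) {β ν : ℝ} (hν : 0 < ν)
    (hξ_char : (fun s : ℝ => charFun (P.map (fun a => (ξ 0 a : ℝ))) s - (1 - ν * (s ^ β : ℝ)))
      =o[𝓝[>] 0] fun s : ℝ => s ^ β) :
    Tendsto (fun r => (1 - ladderGen P ξ 1 r) / (1 - r) ^ (β / 2)) (𝓝[<] 1)
      (𝓝 (√ν * ladderPhi (P.map (fun a => (ξ 0 a : ℝ))) 1)) := by
  have hm : Measurable fun a => (ξ 0 a : ℝ) := (measurable_of_countable _).comp (hξ_meas 0)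
  have : IsProbabilityMeasure (P.map (fun a => (ξ 0 a : ℝ))) :=
    Measure.isProbabilityMeasure_map hm.aemeasurable
  have hint : ∀ᵐ x ∂(P.map (fun a => (ξ 0 a : ℝ))), ∃ k : ℤ, (k : ℝ) = x :=
    (ae_map_iff hm.aemeasurable (Set.countable_range (fun k : ℤ => (k : ℝ))).measurableSet).2
      (Eventually.of_forall fun a => ⟨ξ 0 a, rfl⟩)
  have hk := exists_mass_of_charFun hν hint hξ_char
  have h1 := ((tendsto_poisson_log_sub hν hk hξ_char).const_mul (1 / 2)).rexp.const_mul
    (ladderPhi (P.map (fun a => (ξ 0 a : ℝ))) 1)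
  have e : Real.exp (1 / 2 * Real.log ν) = √ν := by
    rw [Real.sqrt_eq_rpow, Real.rpow_def_of_pos hν, mul_comm]
  rw [e, mul_comm] at h1
  refine h1.congr' ?_
  filter_upwards [Ioo_mem_nhdsLT (zero_lt_one (α := ℝ))] with r hr
  have hr1 : 0 < 1 - r := by linarith [hr.2]
  rw [ladderGen_one_eq hξ_meas hξ_indep hξ_ident hξ_symm hk hr.1.le hr.2,
    Real.rpow_def_of_pos hr1, mul_div_assoc, ← Real.exp_sub]
  congr 2
  ring

/-! ### Tauberian theorems for the tail. -/

theorem exp_neg_mem_Icc {u : ℝ} (hu : u ∈ Set.Ioi (0 : ℝ)) : Real.exp (-u) ∈ Set.Icc (0 : ℝ) 1 :=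
  ⟨(Real.exp_pos _).le, Real.exp_le_one_iff.2 (neg_nonpos.2 (le_of_lt hu))⟩

theorem integrableOn_comp_exp_neg_mul {w : ℝ → ℝ} (hw : IntegrableOn w (Set.Ioi 0)) {q : ℝ → ℝ}
    (hq : Continuous q) : IntegrableOn (fun u => q (Real.exp (-u)) * w u) (Set.Ioi 0) := by
  obtain ⟨K, hK⟩ := isCompact_Icc.exists_bound_of_continuousOn (s := Set.Icc (0 : ℝ) 1)
    hq.continuousOn
  refine Integrable.bdd_mul (c := K) hw (by fun_prop) ?_
  filter_upwards [ae_restrict_mem measurableSet_Ioi] with u hu using hK _ (exp_neg_mem_Icc hu)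

/-- Convergence of the moments of weights on `(0, 1]`, in the coordinate `exp (-u)`, implies weak
convergence. -/
theorem tendsto_integral_comp_exp_of_moments {ι : Type*} {l : Filter ι} {w : ι → ℝ → ℝ}
    {w₀ : ℝ → ℝ} (hw : ∀ᶠ i in l, (∀ u ∈ Set.Ioi (0 : ℝ), 0 ≤ w i u) ∧ IntegrableOn (w i) (Set.Ioi 0))
    (hw₀ : ∀ u ∈ Set.Ioi (0 : ℝ), 0 ≤ w₀ u) (hwi₀ : IntegrableOn w₀ (Set.Ioi 0))
    (h : ∀ n : ℕ, Tendsto (fun i => ∫ u in Set.Ioi 0, Real.exp (-u) ^ n * w i u) l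
      (𝓝 (∫ u in Set.Ioi 0, Real.exp (-u) ^ n * w₀ u))) {q : ℝ → ℝ} (hq : Continuous q) :
    Tendsto (fun i => ∫ u in Set.Ioi 0, q (Real.exp (-u)) * w i u) l
      (𝓝 (∫ u in Set.Ioi 0, q (Real.exp (-u)) * w₀ u)) := by
  have hpoly : ∀ p : Polynomial ℝ,
      Tendsto (fun i => ∫ u in Set.Ioi 0, p.eval (Real.exp (-u)) * w i u) l
      (𝓝 (∫ u in Set.Ioi 0, p.eval (Real.exp (-u)) * w₀ u)) := by
    intro p
    have e : ∀ v : ℝ → ℝ, IntegrableOn v (Set.Ioi 0) →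
        ∑ n ∈ Finset.range (p.natDegree + 1), p.coeff n * ∫ u in Set.Ioi 0, Real.exp (-u) ^ n * v u
          = ∫ u in Set.Ioi 0, p.eval (Real.exp (-u)) * v u := by
      intro v hv
      simp only [← integral_const_mul]
      rw [← integral_finsetSum]
      · congr 1; ext u
        rw [Polynomial.eval_eq_sum_range, Finset.sum_mul]
        exact Finset.sum_congr rfl fun n _ => by ring
      · intro n _
        exact (integrableOn_comp_exp_neg_mul hv (q := fun y => y ^ n) (by fun_prop)).const_mul _
    rw [← e w₀ hwi₀]
    refine (tendsto_finsetSum _ fun n _ => (h n).const_mul (p.coeff n)).congr' ?_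
    filter_upwards [hw] with i hi using e _ hi.2
  have hdiff : ∀ (p : Polynomial ℝ) (ε : ℝ), (∀ y ∈ Set.Icc (0 : ℝ) 1, |p.eval y - q y| < ε) →
      ∀ v : ℝ → ℝ, (∀ u ∈ Set.Ioi (0 : ℝ), 0 ≤ v u) → IntegrableOn v (Set.Ioi 0) →
      |(∫ u in Set.Ioi 0, p.eval (Real.exp (-u)) * v u) -
        ∫ u in Set.Ioi 0, q (Real.exp (-u)) * v u| ≤ ε * ∫ u in Set.Ioi 0, v u := by
    intro p ε hp v hv0 hv
    rw [← integral_sub (integrableOn_comp_exp_neg_mul hv p.continuous)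
      (integrableOn_comp_exp_neg_mul hv hq), ← integral_const_mul]
    rw [← Real.norm_eq_abs]
    refine norm_integral_le_of_norm_le (hv.const_mul ε) ?_
    filter_upwards [ae_restrict_mem measurableSet_Ioi] with u hu
    rw [← sub_mul, norm_mul, Real.norm_of_nonneg (hv0 u hu)]
    exact mul_le_mul_of_nonneg_right (hp _ (exp_neg_mem_Icc hu)).le (hv0 u hu)
  set M := ∫ u in Set.Ioi 0, w₀ u with hM
  have hM0 : 0 ≤ M := setIntegral_nonneg measurableSet_Ioi hw₀
  have hmass : Tendsto (fun i => ∫ u in Set.Ioi 0, w i u) l (𝓝 M) := by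
    simpa using h 0
  rw [Metric.tendsto_nhds]
  intro ε hε
  -- Weierstrass approximation on `[0, 1]`: the total masses are eventually below `M + 1`, so
  -- replacing `q` by the polynomial costs at most `ε / 3` on each side.
  have hδ : 0 < ε / (3 * (M + 1)) := by positivity
  obtain ⟨p, hp⟩ := exists_polynomial_near_of_continuousOn 0 1 q hq.continuousOn _ hδ
  filter_upwards [hw, (Metric.tendsto_nhds.1 (hpoly p)) (ε / 3) (by positivity),
    hmass.eventually (gt_mem_nhds (lt_add_one M))] with i hi h1 h2
  have h3 := hdiff p _ hp _ hi.1 hi.2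
  have h4 := hdiff p _ hp _ hw₀ hwi₀
  have h5 : ε / (3 * (M + 1)) * ∫ u in Set.Ioi 0, w i u ≤ ε / 3 := by
    calc _ ≤ ε / (3 * (M + 1)) * (M + 1) := by gcongr
      _ = ε / 3 := by field_simp
  have h6 : ε / (3 * (M + 1)) * M < ε / 3 := by
    calc _ < ε / (3 * (M + 1)) * (M + 1) := by gcongr; linarith
      _ = ε / 3 := by field_simp
  rw [Real.dist_eq] at h1 ⊢
  rw [← hM] at h4
  rw [abs_lt] at h1 ⊢
  rw [abs_le] at h3 h4
  constructor <;> linarith [h3.1, h3.2, h4.1, h4.2, h1.1, h1.2]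

section Laplace

variable {m : Measure ℝ} [IsProbabilityMeasure m]

theorem integrable_exp_neg_mul (hpos : ∀ᵐ x ∂m, 0 ≤ x) {s : ℝ} (hs : 0 ≤ s) :
    Integrable (fun x => Real.exp (-(s * x))) m :=
  Integrable.of_bound (by fun_prop) 1 (by
    filter_upwards [hpos] with x hx
    rw [Real.norm_of_nonneg (Real.exp_pos _).le, Real.exp_le_one_iff]
    nlinarith)

theorem antitone_measureReal_Ioi : Antitone fun x => m.real (Set.Ioi x) := fun _ _ h =>
  measureReal_mono (Set.Ioi_subset_Ioi h)

theorem integrableOn_exp_neg_mul_tail {s c : ℝ} (hs : 0 < s) :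
    IntegrableOn (fun u => Real.exp (-(s * u)) * m.real (Set.Ioi (u * c))) (Set.Ioi 0) := by
  have hi : IntegrableOn (fun u : ℝ => Real.exp (-(s * u))) (Set.Ioi 0) := by
    have := integrableOn_exp_mul_Ioi (neg_neg_of_pos hs) 0
    simpa only [neg_mul] using this
  have hm : Measurable fun u : ℝ => m.real (Set.Ioi (u * c)) :=
    antitone_measureReal_Ioi.measurable.comp (measurable_id.mul_const c)
  refine Integrable.mul_bdd (c := 1) hi hm.aestronglyMeasurable (Eventually.of_forall fun u => ?_)
  rw [Real.norm_of_nonneg measureReal_nonneg]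
  exact measureReal_le_one

/-- The layer-cake formula for `(1 - exp (-s x)) / s`, the primitive of `exp (-s t)`. -/
theorem integral_exp_neg_mul_tail (hpos : ∀ᵐ x ∂m, 0 ≤ x) {s : ℝ} (hs : 0 < s) :
    ∫ x in Set.Ioi 0, Real.exp (-(s * x)) * m.real (Set.Ioi x) =
      (1 - ∫ x, Real.exp (-(s * x)) ∂m) / s := by
  have h := lintegral_comp_eq_lintegral_meas_lt_mul m (f := fun x => x)
    (g := fun t => Real.exp (-(s * t))) hpos aemeasurable_id
    (fun t _ => (by fun_prop : Continuous fun t => Real.exp (-(s * t))).intervalIntegrable _ _)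
    (Eventually.of_forall fun t => (Real.exp_pos _).le)
  have hint : ∀ x : ℝ, ∫ t in (0 : ℝ)..x, Real.exp (-(s * t)) = (1 - Real.exp (-(s * x))) / s := by
    intro x
    have h2 : ∫ t in (0 : ℝ)..x, Real.exp (-s * t) = (-s)⁻¹ * (∫ t in (-s * 0)..(-s * x), Real.exp t) := by
      rw [intervalIntegral.integral_comp_mul_left (fun t => Real.exp t) (by linarith : -s ≠ 0)]
      rfl
    simp only [neg_mul] at h2
    rw [h2, integral_exp]
    simp
    field_simp
    ring
  simp only [hint] at h
  have h1 : Integrable (fun x => (1 - Real.exp (-(s * x))) / s) m :=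
    ((integrable_const _).sub (integrable_exp_neg_mul hpos hs.le)).div_const s
  have hnn : 0 ≤ᵐ[m] fun x => (1 - Real.exp (-(s * x))) / s := by
    filter_upwards [hpos] with x hx
    refine div_nonneg (sub_nonneg.2 (Real.exp_le_one_iff.2 ?_)) hs.le
    nlinarith
  rw [← ofReal_integral_eq_lintegral_ofReal h1 hnn] at h
  have h2 : ∀ t : ℝ, m {a | t < a} * ENNReal.ofReal (Real.exp (-(s * t))) =
      ENNReal.ofReal (Real.exp (-(s * t)) * m.real (Set.Ioi t)) := fun t => by
    rw [ENNReal.ofReal_mul (Real.exp_pos _).le, mul_comm, ofReal_measureReal]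
    rfl
  simp only [h2] at h
  have h3 := integrableOn_exp_neg_mul_tail (m := m) (c := 1) hs
  simp only [mul_one] at h3
  rw [← ofReal_integral_eq_lintegral_ofReal h3 (Eventually.of_forall fun t =>
    mul_nonneg (Real.exp_pos _).le measureReal_nonneg)] at h
  have h4 := (ENNReal.ofReal_eq_ofReal_iff (integral_nonneg_of_ae hnn)
    (integral_nonneg fun t => mul_nonneg (Real.exp_pos _).le measureReal_nonneg)).1 h
  rw [← h4, integral_div, integral_sub (integrable_const _) (integrable_exp_neg_mul hpos hs.le)]
  simp

end Laplace

/-- A bump supported on `exp (-b) ≤ y ≤ exp (-a)`. -/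
def expBump (a b y : ℝ) : ℝ := max 0 ((y - Real.exp (-b)) * (Real.exp (-a) - y))

theorem continuous_expBump (a b : ℝ) : Continuous (expBump a b) := by
  unfold expBump; fun_prop

theorem expBump_nonneg (a b y : ℝ) : 0 ≤ expBump a b y := le_max_left _ _

theorem expBump_eq_zero {a b u : ℝ} (hab : a < b) (hu : u < a ∨ b < u) :
    expBump a b (Real.exp (-u)) = 0 := by
  refine max_eq_left ?_
  have h0 : Real.exp (-b) < Real.exp (-a) := Real.exp_lt_exp.2 (by linarith)
  rcases hu with hu | hu
  · have : Real.exp (-a) < Real.exp (-u) := Real.exp_lt_exp.2 (by linarith)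
    nlinarith
  · have : Real.exp (-u) < Real.exp (-b) := Real.exp_lt_exp.2 (by linarith)
    nlinarith

theorem expBump_pos {a b u : ℝ} (ha : a < u) (hb : u < b) : 0 < expBump a b (Real.exp (-u)) := by
  refine lt_max_of_lt_right (mul_pos ?_ ?_)
  · exact sub_pos.2 (Real.exp_lt_exp.2 (by linarith))
  · exact sub_pos.2 (Real.exp_lt_exp.2 (by linarith))

theorem integrableOn_exp_neg_Ioi_zero : IntegrableOn (fun u : ℝ => Real.exp (-u)) (Set.Ioi 0) :=
  integrableOn_exp_neg_Ioi 0

theorem integral_expBump_pos {a b : ℝ} (ha : 0 < a) (hab : a < b) :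
    0 < ∫ u in Set.Ioi 0, expBump a b (Real.exp (-u)) * Real.exp (-u) := by
  have hi := integrableOn_comp_exp_neg_mul integrableOn_exp_neg_Ioi_zero (continuous_expBump a b)
  rw [setIntegral_pos_iff_support_of_nonneg_ae (Eventually.of_forall fun u =>
    mul_nonneg (expBump_nonneg _ _ _) (Real.exp_pos _).le) hi]
  have hsub : Set.Ioo a b ⊆ (Function.support fun u =>
      expBump a b (Real.exp (-u)) * Real.exp (-u)) ∩ Set.Ioi 0 := fun u hu =>
    ⟨(mul_pos (expBump_pos hu.1 hu.2) (Real.exp_pos _)).ne', ha.trans hu.1⟩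
  refine lt_of_lt_of_le ?_ (measure_mono hsub)
  rw [Real.volume_Ioo]
  exact ENNReal.ofReal_pos.2 (by linarith)

theorem integral_expBump_mul_le {a b K : ℝ} (hab : a < b) {v : ℝ → ℝ}
    (hv : IntegrableOn (fun u => Real.exp (-u) * v u) (Set.Ioi 0))
    (hK : ∀ u ∈ Set.Icc a b, 0 < u → v u ≤ K) :
    ∫ u in Set.Ioi 0, expBump a b (Real.exp (-u)) * (Real.exp (-u) * v u) ≤
      K * ∫ u in Set.Ioi 0, expBump a b (Real.exp (-u)) * Real.exp (-u) := by
  rw [← integral_const_mul]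
  refine setIntegral_mono_on (integrableOn_comp_exp_neg_mul hv (continuous_expBump a b))
    ((integrableOn_comp_exp_neg_mul integrableOn_exp_neg_Ioi_zero
      (continuous_expBump a b)).const_mul K) measurableSet_Ioi fun u hu => ?_
  by_cases h : u ∈ Set.Icc a b
  · have h1 := hK u h hu
    have h2 := mul_nonneg (expBump_nonneg a b (Real.exp (-u))) (Real.exp_pos (-u)).le
    nlinarith
  · rw [expBump_eq_zero hab]
    · simp
    · rw [Set.mem_Icc, not_and_or, not_le, not_le] at h
      exact h

theorem le_integral_expBump_mul {a b K : ℝ} (hab : a < b) {v : ℝ → ℝ}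
    (hv : IntegrableOn (fun u => Real.exp (-u) * v u) (Set.Ioi 0))
    (hK : ∀ u ∈ Set.Icc a b, 0 < u → K ≤ v u) :
    K * ∫ u in Set.Ioi 0, expBump a b (Real.exp (-u)) * Real.exp (-u) ≤
      ∫ u in Set.Ioi 0, expBump a b (Real.exp (-u)) * (Real.exp (-u) * v u) := by
  have h := integral_expBump_mul_le hab (v := fun u => -v u) (K := -K)
    (by simp only [mul_neg]; exact hv.neg) (fun u hu h0 => neg_le_neg (hK u hu h0))
  simp only [mul_neg, integral_neg, neg_mul] at h
  linarith

/-- Antitone densities whose exponential moments converge to those of `L u ^ (-α)` converge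
at `1`. -/
theorem tendsto_of_antitone_of_moments {ι : Type*} {l : Filter ι} {v : ι → ℝ → ℝ} {α L : ℝ}
    (hα : α < 1) (hα0 : 0 ≤ α) (hL : 0 ≤ L)
    (hv0 : ∀ᶠ i in l, ∀ u, 0 ≤ v i u) (hanti : ∀ᶠ i in l, Antitone (v i))
    (hvi : ∀ᶠ i in l, IntegrableOn (fun u => Real.exp (-u) * v i u) (Set.Ioi 0))
    (h : ∀ n : ℕ, Tendsto (fun i => ∫ u in Set.Ioi 0, Real.exp (-u) ^ n * (Real.exp (-u) * v i u)) l
      (𝓝 (∫ u in Set.Ioi 0, Real.exp (-u) ^ n * (Real.exp (-u) * (L * u ^ (-α)))))) :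
    Tendsto (fun i => v i 1) l (𝓝 L) := by
  have hwi₀ : IntegrableOn (fun u : ℝ => Real.exp (-u) * (L * u ^ (-α))) (Set.Ioi 0) := by
    have := (Real.GammaIntegral_convergent (s := 1 - α) (by linarith)).const_mul L
    refine IntegrableOn.congr_fun this (fun u _ => ?_) measurableSet_Ioi
    rw [show 1 - α - 1 = -α by ring]; ring
  have key : ∀ a b : ℝ, Tendsto (fun i => ∫ u in Set.Ioi 0, expBump a b (Real.exp (-u)) *
      (Real.exp (-u) * v i u)) l
      (𝓝 (∫ u in Set.Ioi 0, expBump a b (Real.exp (-u)) * (Real.exp (-u) * (L * u ^ (-α))))) := by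
    intro a b
    refine tendsto_integral_comp_exp_of_moments ?_ ?_ hwi₀ h (continuous_expBump a b)
    · filter_upwards [hv0, hvi] with i h1 h2
      exact ⟨fun u _ => mul_nonneg (Real.exp_pos _).le (h1 u), h2⟩
    · intro u hu
      exact mul_nonneg (Real.exp_pos _).le (mul_nonneg hL (Real.rpow_nonneg (le_of_lt hu) _))
  have hcont : Tendsto (fun a : ℝ => L * a ^ (-α)) (𝓝 1) (𝓝 L) := by
    have : ContinuousAt (fun a : ℝ => L * a ^ (-α)) 1 :=
      continuousAt_const.mul (Real.continuousAt_rpow_const 1 (-α) (Or.inl one_ne_zero))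
    have h2 := this.tendsto
    simpa using h2
  have hmono : ∀ x y : ℝ, 0 < x → x ≤ y → L * y ^ (-α) ≤ L * x ^ (-α) := fun x y hx hxy =>
    mul_le_mul_of_nonneg_left (Real.rpow_le_rpow_of_nonpos hx hxy (by linarith)) hL
  refine tendsto_order.2 ⟨fun c hc => ?_, fun c hc => ?_⟩
  -- Lower bound from a bump on `[1, b]`: there `v i ≤ v i 1`, while the limit density is at least
  -- `L * b ^ (-α) > c`.
  · obtain ⟨b, hb, hb1⟩ := (((hcont.mono_left nhdsWithin_le_nhds).eventually
      (lt_mem_nhds hc)).and (self_mem_nhdsWithin (s := Set.Ioi (1 : ℝ)))).exists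
    have hb1' : (1 : ℝ) < b := hb1
    have hJ := integral_expBump_pos one_pos hb1'
    have h1 := le_integral_expBump_mul hb1' hwi₀ (K := L * b ^ (-α))
      (fun u hu h0 => hmono u b h0 hu.2)
    filter_upwards [hanti, hvi, (key 1 b).eventually (lt_mem_nhds
      (lt_of_lt_of_le (mul_lt_mul_of_pos_right hb hJ) h1))] with i h2 h3 h4
    have h5 := integral_expBump_mul_le hb1' h3 (K := v i 1) (fun u hu _ => h2 hu.1)
    exact lt_of_mul_lt_mul_right (h4.trans_le h5) hJ.le
  -- Upper bound from a bump on `[a, 1]`, where the inequalities are reversed and `L * a ^ (-α) <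
  -- c`.
  · obtain ⟨a, ha, ha1⟩ := (((hcont.mono_left nhdsWithin_le_nhds).eventually
      (gt_mem_nhds hc)).and (Ioo_mem_nhdsLT (zero_lt_one (α := ℝ)))).exists
    have hJ := integral_expBump_pos ha1.1 ha1.2
    have h1 := integral_expBump_mul_le ha1.2 hwi₀ (K := L * a ^ (-α))
      (fun u hu _ => hmono a u ha1.1 hu.1)
    filter_upwards [hanti, hvi, (key a 1).eventually (gt_mem_nhds
      (lt_of_le_of_lt h1 (mul_lt_mul_of_pos_right ha hJ)))] with i h2 h3 h4
    have h5 := le_integral_expBump_mul ha1.2 h3 (K := v i 1) (fun u hu _ => h2 hu.2)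
    exact lt_of_mul_lt_mul_right (h5.trans_lt h4) hJ.le

/-- Karamata's Tauberian theorem for the tail of a nonnegative random variable. -/
theorem tendsto_rpow_mul_tail {m : Measure ℝ} [IsProbabilityMeasure m]
    (hpos : ∀ᵐ x ∂m, 0 ≤ x) {α C : ℝ} (hα0 : 0 < α) (hα1 : α < 1) (hC : 0 ≤ C)
    (h : Tendsto (fun s => (1 - ∫ x, Real.exp (-(s * x)) ∂m) / s ^ α) (𝓝[>] 0) (𝓝 C)) :
    Tendsto (fun x => x ^ α * m.real (Set.Ioi x)) atTop (𝓝 (C / Real.Gamma (1 - α))) := by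
  have hG : 0 < Real.Gamma (1 - α) := Real.Gamma_pos_of_pos (by linarith)
  have key := tendsto_of_antitone_of_moments (l := atTop) (α := α)
    (L := C / Real.Gamma (1 - α))
    -- The rescaled tail, whose value at `u = 1` is the quantity sought. Its moment of order `n` is
    -- governed by the Laplace transform at `(n + 1) / x`, which tends to `0+`.
    (v := fun x u => x ^ α * m.real (Set.Ioi (u * x))) hα1 hα0.le (by positivity) ?_ ?_ ?_ ?_
  · simpa using key
  · filter_upwards [eventually_gt_atTop 0] with x hx u
    exact mul_nonneg (Real.rpow_nonneg hx.le _) measureReal_nonneg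
  · filter_upwards [eventually_gt_atTop 0] with x hx u w huw
    exact mul_le_mul_of_nonneg_left (antitone_measureReal_Ioi (by gcongr))
      (Real.rpow_nonneg hx.le _)
  · refine Eventually.of_forall fun x => ?_
    have := (integrableOn_exp_neg_mul_tail (m := m) (c := x) one_pos).const_mul (x ^ α)
    refine IntegrableOn.congr_fun this (fun u _ => ?_) measurableSet_Ioi
    rw [one_mul]; ring
  · intro n
    have hn : (0 : ℝ) < n + 1 := by positivity
    have hexp : ∀ u : ℝ, Real.exp (-u) ^ n * Real.exp (-u) = Real.exp (-((n + 1) * u)) := fun u => by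
      rw [← Real.exp_nat_mul, ← Real.exp_add]; congr 1; ring
    have hR : ∫ u in Set.Ioi 0, Real.exp (-u) ^ n * (Real.exp (-u) *
        (C / Real.Gamma (1 - α) * u ^ (-α))) = C * ((n : ℝ) + 1) ^ (α - 1) := by
      have h1 := Real.integral_rpow_mul_exp_neg_mul_Ioi (a := 1 - α) (r := n + 1) (by linarith) hn
      have h2 : ∀ u : ℝ, Real.exp (-u) ^ n * (Real.exp (-u) *
          (C / Real.Gamma (1 - α) * u ^ (-α))) = C / Real.Gamma (1 - α) *
          (u ^ (1 - α - 1) * Real.exp (-((n + 1) * u))) := fun u => by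
        rw [← hexp, show 1 - α - 1 = -α by ring]; ring
      simp only [h2]
      rw [integral_const_mul, h1, one_div, Real.inv_rpow hn.le, ← Real.rpow_neg hn.le,
        show -(1 - α) = α - 1 by ring]
      field_simp
    rw [hR]
    have hs : Tendsto (fun x : ℝ => ((n : ℝ) + 1) * x⁻¹) atTop (𝓝[>] 0) := by
      refine tendsto_nhdsWithin_iff.2 ⟨?_, ?_⟩
      · simpa using tendsto_inv_atTop_zero.const_mul ((n : ℝ) + 1)
      · filter_upwards [eventually_gt_atTop 0] with x hx
        exact Set.mem_Ioi.2 (by positivity)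
    refine ((h.comp hs).mul_const (((n : ℝ) + 1) ^ (α - 1))).congr' ?_
    filter_upwards [eventually_gt_atTop 0] with x hx
    have hsx : 0 < ((n : ℝ) + 1) * x⁻¹ := by positivity
    have h3 := integral_exp_neg_mul_tail hpos hsx
    have h4 := integral_comp_mul_right_Ioi (fun y => Real.exp (-(((n : ℝ) + 1) * x⁻¹ * y)) *
      m.real (Set.Ioi y)) 0 hx
    rw [zero_mul, h3, smul_eq_mul] at h4
    have h5 : ∀ u : ℝ, Real.exp (-u) ^ n * (Real.exp (-u) * (x ^ α * m.real (Set.Ioi (u * x)))) =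
        x ^ α * (Real.exp (-(((n : ℝ) + 1) * x⁻¹ * (u * x))) * m.real (Set.Ioi (u * x))) := fun u => by
      rw [show ((n : ℝ) + 1) * x⁻¹ * (u * x) = (n + 1) * u by field_simp, ← hexp]; ring
    simp only [h5]
    rw [integral_const_mul, h4]
    simp only [Function.comp]
    rw [Real.mul_rpow hn.le (by positivity), Real.inv_rpow hx.le, Real.rpow_sub_one hn.ne']
    have := (Real.rpow_pos_of_pos hn α).ne'
    have := (Real.rpow_pos_of_pos hx α).ne'
    field_simp

/-- Along `s = 1 / (n + 1)` the quotients `(1 - exp (-s x)) / s` tend to `x` with convergent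
integrals, so Fatou makes the mean finite. Then `x P(X > x) ≤ E[X; X > x] → 0`. -/
theorem isLittleO_tail_of_tendsto {m : Measure ℝ} [IsProbabilityMeasure m]
    (hpos : ∀ᵐ x ∂m, 0 ≤ x) {C : ℝ}
    (h : Tendsto (fun s => (1 - ∫ x, Real.exp (-(s * x)) ∂m) / s) (𝓝[>] 0) (𝓝 C)) :
    Tendsto (fun x => x * m.real (Set.Ioi x)) atTop (𝓝 0) := by
  have hseq : Tendsto (fun n : ℕ => (((n : ℝ) + 1)⁻¹)) atTop (𝓝[>] 0) := by
    refine tendsto_nhdsWithin_iff.2 ⟨?_, Eventually.of_forall fun n => ?_⟩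
    · simpa using tendsto_one_div_add_atTop_nhds_zero_nat (𝕜 := ℝ)
    · exact Set.mem_Ioi.2 (by positivity)
  have hnn : ∀ n : ℕ, ∀ᵐ x ∂m,
      0 ≤ (1 - Real.exp (-(((n : ℝ) + 1)⁻¹ * x))) / ((n : ℝ) + 1)⁻¹ := fun n => by
    filter_upwards [hpos] with x hx
    refine div_nonneg (sub_nonneg.2 (Real.exp_le_one_iff.2 ?_)) (by positivity)
    exact neg_nonpos.2 (by positivity)
  have hint : Integrable (fun x : ℝ => x) m := by
    refine integrable_of_tendsto
      (G := fun (n : ℕ) x => (1 - Real.exp (-(((n : ℝ) + 1)⁻¹ * x))) / ((n : ℝ) + 1)⁻¹)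
      (Eventually.of_forall fun x => ?_) (fun n => by fun_prop) ?_
    · have hd : HasDerivAt (fun s : ℝ => 1 - Real.exp (-(s * x))) x 0 := by
        have := (((hasDerivAt_id (0 : ℝ)).mul_const x).neg.exp).const_sub 1
        simpa using this
      have h2 := hd.tendsto_slope_zero_right.comp hseq
      refine h2.congr fun n => ?_
      simp [div_eq_inv_mul]
    · have h3 : ∀ n : ℕ, ∫⁻ x, ‖(1 - Real.exp (-(((n : ℝ) + 1)⁻¹ * x))) / ((n : ℝ) + 1)⁻¹‖ₑ ∂m =
          ENNReal.ofReal ((1 - ∫ x, Real.exp (-(((n : ℝ) + 1)⁻¹ * x)) ∂m) / ((n : ℝ) + 1)⁻¹) := by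
        intro n
        have hi := integrable_exp_neg_mul hpos (s := ((n : ℝ) + 1)⁻¹) (by positivity)
        have h4 : ∫ x, (1 - Real.exp (-(((n : ℝ) + 1)⁻¹ * x))) / ((n : ℝ) + 1)⁻¹ ∂m =
            (1 - ∫ x, Real.exp (-(((n : ℝ) + 1)⁻¹ * x)) ∂m) / ((n : ℝ) + 1)⁻¹ := by
          rw [integral_div, integral_sub (integrable_const _) hi]; simp
        have h5 : Integrable (fun x => (1 - Real.exp (-(((n : ℝ) + 1)⁻¹ * x))) / ((n : ℝ) + 1)⁻¹) m :=
          ((integrable_const _).sub hi).div_const _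
        rw [← h4, ofReal_integral_eq_lintegral_ofReal h5 (hnn n)]
        refine lintegral_congr_ae ?_
        filter_upwards [hnn n] with x hx
        rw [Real.enorm_of_nonneg hx]
      simp only [h3]
      have h6 := (ENNReal.tendsto_ofReal (h.comp hseq)).liminf_eq
      simp only [Function.comp_def] at h6
      rw [h6]
      exact ENNReal.ofReal_ne_top
  have hle : ∀ x : ℝ, 0 ≤ x → x * m.real (Set.Ioi x) ≤ ∫ y, (Set.Ioi x).indicator (fun y => y) y ∂m := by
    intro x hx
    have : x * m.real (Set.Ioi x) = ∫ y, (Set.Ioi x).indicator (fun _ => x) y ∂m := by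
      rw [integral_indicator measurableSet_Ioi, setIntegral_const, smul_eq_mul, mul_comm]
    rw [this]
    refine integral_mono ((integrable_const x).indicator measurableSet_Ioi)
      (hint.indicator measurableSet_Ioi) fun y => ?_
    exact Set.indicator_le_indicator' fun hy => le_of_lt hy
  have hlim : Tendsto (fun x : ℝ => ∫ y, (Set.Ioi x).indicator (fun y => y) y ∂m) atTop (𝓝 0) := by
    have := tendsto_integral_filter_of_dominated_convergence (μ := m) (l := (atTop : Filter ℝ))
      (F := fun x y => (Set.Ioi x).indicator (fun y => y) y) (f := fun _ => (0 : ℝ))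
      (fun y => ‖y‖) (Eventually.of_forall fun x =>
        (measurable_id.indicator measurableSet_Ioi).aestronglyMeasurable)
      (Eventually.of_forall fun x => Eventually.of_forall fun y => norm_indicator_le_norm_self _ _)
      hint.norm (Eventually.of_forall fun y => ?_)
    · simpa using this
    · refine tendsto_const_nhds.congr' ?_
      filter_upwards [eventually_ge_atTop y] with x hx
      rw [Set.indicator_of_notMem]
      exact not_lt.2 hx
  refine squeeze_zero' ?_ ?_ hlim
  · filter_upwards [eventually_ge_atTop 0] with x hx using mul_nonneg hx measureReal_nonneg
  · filter_upwards [eventually_ge_atTop 0] with x hx using hle x hx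

end

/-! ### From the characteristic function to the Laplace transform of the medium. -/

noncomputable section

open scoped FourierTransform

theorem integral_exp_neg_mul_cos (y : ℝ) :
    ∫ t in Set.Ioi (0 : ℝ), Real.exp (-t) * Real.cos (t * y) = 1 / (1 + y ^ 2) := by
  have ha : (-1 + y * Complex.I : ℂ).re < 0 := by simp
  have h := integral_exp_mul_complex_Ioi ha 0
  have hi := integrableOn_exp_mul_complex_Ioi ha 0
  have h2 := Complex.reCLM.integral_comp_comm hi
  rw [h] at h2
  have h3 : ∀ t : ℝ, Complex.reCLM (Complex.exp ((-1 + y * Complex.I) * t)) =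
      Real.exp (-t) * Real.cos (t * y) := fun t => by
    rw [Complex.reCLM_apply, Complex.exp_re]
    simp [mul_comm]
  simp only [h3] at h2
  rw [h2]
  simp [Complex.div_re, Complex.normSq_apply]
  ring

theorem integrableOn_exp_neg_mul_one_sub_cos (y : ℝ) :
    IntegrableOn (fun t : ℝ => Real.exp (-t) * Real.cos (t * y)) (Set.Ioi 0) :=
  Integrable.mul_bdd (c := 1) integrableOn_exp_neg_Ioi_zero (by fun_prop)
    (Eventually.of_forall fun _ => Real.abs_cos_le_one _)

theorem integral_exp_neg_mul_one_sub_cos (y : ℝ) :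
    ∫ t in Set.Ioi (0 : ℝ), Real.exp (-t) * (1 - Real.cos (t * y)) = y ^ 2 / (1 + y ^ 2) := by
  simp only [mul_sub, mul_one]
  rw [integral_sub integrableOn_exp_neg_Ioi_zero (integrableOn_exp_neg_mul_one_sub_cos y),
    integral_exp_neg_mul_cos, integral_exp_neg_Ioi_zero]
  field_simp
  ring

theorem integrable_exp_neg_abs : Integrable fun x : ℝ => Real.exp (-|x|) := by
  rw [← integrableOn_univ, ← Set.Iic_union_Ioi (a := (0 : ℝ)), integrableOn_union]
  constructor
  · refine IntegrableOn.congr_fun (integrableOn_exp_mul_Iic one_pos 0) (fun x hx => ?_)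
      measurableSet_Iic
    rw [abs_of_nonpos hx, neg_neg, one_mul]
  · refine IntegrableOn.congr_fun integrableOn_exp_neg_Ioi_zero (fun x hx => ?_) measurableSet_Ioi
    rw [abs_of_pos hx]

theorem fourier_exp_neg_abs (w : ℝ) :
    𝓕 (fun x : ℝ => (Real.exp (-|x|) : ℂ)) w = ((2 * (1 + (2 * Real.pi * w) ^ 2)⁻¹ : ℝ) : ℂ) := by
  have hi : Integrable fun v : ℝ => Complex.exp ((-2 * Real.pi * v * w : ℝ) * Complex.I) •
      (Real.exp (-|v|) : ℂ) := by
    refine Integrable.bdd_mul (c := 1) integrable_exp_neg_abs.ofReal (by fun_prop)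
      (Eventually.of_forall fun v => ?_)
    rw [Complex.norm_exp_ofReal_mul_I]
  rw [Real.fourier_real_eq_integral_exp_smul,
    ← integral_add_compl (measurableSet_Iic (a := 0)) hi, Set.compl_Iic]
  have h1 : ∫ v : ℝ in Set.Iic 0, Complex.exp ((-2 * Real.pi * v * w : ℝ) * Complex.I) •
      (Real.exp (-|v|) : ℂ) = 1 / (1 - (2 * Real.pi * w : ℝ) * Complex.I) := by
    have h := integral_exp_mul_complex_Iic (a := 1 - (2 * Real.pi * w : ℝ) * Complex.I) (by simp) 0
    rw [Complex.ofReal_zero, mul_zero, Complex.exp_zero] at h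
    rw [← h]
    refine setIntegral_congr_fun measurableSet_Iic fun v hv => ?_
    rw [abs_of_nonpos hv, smul_eq_mul, Complex.ofReal_exp, ← Complex.exp_add]
    congr 1; push_cast; ring
  have h2 : ∫ v : ℝ in Set.Ioi 0, Complex.exp ((-2 * Real.pi * v * w : ℝ) * Complex.I) •
      (Real.exp (-|v|) : ℂ) = 1 / (1 + (2 * Real.pi * w : ℝ) * Complex.I) := by
    have h := integral_exp_mul_complex_Ioi (a := -(1 + (2 * Real.pi * w : ℝ) * Complex.I)) (by simp) 0
    rw [Complex.ofReal_zero, mul_zero, Complex.exp_zero, neg_div_neg_eq] at h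
    rw [← h]
    refine setIntegral_congr_fun measurableSet_Ioi fun v hv => ?_
    rw [abs_of_nonneg (le_of_lt hv), smul_eq_mul, Complex.ofReal_exp, ← Complex.exp_add]
    congr 1; push_cast; ring
  rw [h1, h2]
  set y := 2 * Real.pi * w
  have e1 : (1 : ℂ) - y * Complex.I ≠ 0 := fun h => by
    have := congrArg Complex.re h
    simp at this
  have e2 : (1 : ℂ) + y * Complex.I ≠ 0 := fun h => by
    have := congrArg Complex.re h
    simp at this
  have e3 : (1 : ℂ) + (y : ℂ) ^ 2 = (1 - y * Complex.I) * (1 + y * Complex.I) := by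
    ring_nf; rw [Complex.I_sq]; ring
  push_cast
  rw [e3]
  field_simp
  ring

/-- Fourier inversion for `exp (-|x|)`, whose transform is a rescaled Cauchy density. -/
theorem integral_cos_div_one_add_sq (y : ℝ) :
    ∫ u : ℝ, (1 + u ^ 2)⁻¹ * Real.cos (u * y) = Real.pi * Real.exp (-|y|) := by
  have hpi := Real.pi_pos
  have hF : 𝓕 (fun x : ℝ => (Real.exp (-|x|) : ℂ)) =
      fun w => ((2 * (1 + (2 * Real.pi * w) ^ 2)⁻¹ : ℝ) : ℂ) := funext fourier_exp_neg_abs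
  have hFr : Integrable fun w : ℝ => 2 * (1 + (2 * Real.pi * w) ^ 2)⁻¹ :=
    (integrable_inv_one_add_sq.comp_mul_left' (by positivity : 2 * Real.pi ≠ 0)).const_mul 2
  have hFi : Integrable (𝓕 (fun x : ℝ => (Real.exp (-|x|) : ℂ))) := by
    rw [hF]; exact hFr.ofReal
  have h := congrFun (Continuous.fourierInv_fourier_eq (f := fun x : ℝ => (Real.exp (-|x|) : ℂ))
    (by fun_prop) integrable_exp_neg_abs.ofReal hFi) y
  rw [hF, Real.fourierInv_eq'] at h
  have h2 := congrArg Complex.re h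
  rw [Complex.ofReal_re] at h2
  have hi : Integrable fun v : ℝ => Complex.exp ((2 * Real.pi * inner ℝ v y : ℝ) * Complex.I) •
      ((2 * (1 + (2 * Real.pi * v) ^ 2)⁻¹ : ℝ) : ℂ) := by
    refine Integrable.bdd_mul (c := 1) hFr.ofReal (by fun_prop)
      (Eventually.of_forall fun v => ?_)
    rw [Complex.norm_exp_ofReal_mul_I]
  have h3 := Complex.reCLM.integral_comp_comm hi
  rw [Complex.reCLM_apply] at h3
  rw [← h3] at h2
  have h4 : ∀ v : ℝ, Complex.reCLM (Complex.exp ((2 * Real.pi * inner ℝ v y : ℝ) * Complex.I) •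
      ((2 * (1 + (2 * Real.pi * v) ^ 2)⁻¹ : ℝ) : ℂ)) =
      2 * ((1 + (2 * Real.pi * v) ^ 2)⁻¹ * Real.cos (2 * Real.pi * v * y)) := fun v => by
    rw [Complex.reCLM_apply, smul_eq_mul, Complex.re_mul_ofReal, Complex.exp_ofReal_mul_I_re]
    have : inner ℝ v y = y * v := by simp
    rw [this, show 2 * Real.pi * (y * v) = 2 * Real.pi * v * y by ring]
    ring
  simp only [h4] at h2
  rw [integral_const_mul, Measure.integral_comp_mul_left
    (fun u => (1 + u ^ 2)⁻¹ * Real.cos (u * y)) (2 * Real.pi), abs_of_pos (by positivity),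
    smul_eq_mul] at h2
  rw [← h2]
  generalize ∫ u : ℝ, (1 + u ^ 2)⁻¹ * Real.cos (u * y) = J
  field_simp

/-- Exhibits `1 - exp (-y)` as a mixture of the functions `1 - cos (u y)`, hence `1 - L(s)` as a
mixture of the numbers `1 - Re φ(s u)`. -/
theorem integral_Ioi_one_sub_cos_div_one_add_sq {y : ℝ} (hy : 0 ≤ y) :
    ∫ u in Set.Ioi (0 : ℝ), (1 + u ^ 2)⁻¹ * (1 - Real.cos (u * y)) =
      Real.pi / 2 * (1 - Real.exp (-y)) := by
  have h := integral_comp_abs (f := fun u => (1 + u ^ 2)⁻¹ * (1 - Real.cos (u * y)))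
  have h2 : ∀ u : ℝ, (1 + |u| ^ 2)⁻¹ * (1 - Real.cos (|u| * y)) =
      (1 + u ^ 2)⁻¹ - (1 + u ^ 2)⁻¹ * Real.cos (u * y) := fun u => by
    have : Real.cos (|u| * y) = Real.cos (u * y) := by
      rw [← Real.cos_abs (u * y), abs_mul, abs_of_nonneg hy]
    rw [sq_abs, this]; ring
  simp only [h2] at h
  rw [integral_sub integrable_inv_one_add_sq, integral_univ_inv_one_add_sq,
    integral_cos_div_one_add_sq, abs_of_nonneg hy] at h
  · linarith
  · exact Integrable.mul_bdd (c := 1) integrable_inv_one_add_sq (by fun_prop)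
      (Eventually.of_forall fun _ => Real.abs_cos_le_one _)

theorem integrableOn_rpow_div_one_add_sq {γ : ℝ} (h0 : 0 ≤ γ) (h1 : γ < 1) :
    IntegrableOn (fun u : ℝ => (1 + u ^ 2)⁻¹ * u ^ γ) (Set.Ioi 0) := by
  have h := integrable_rpow_neg_one_add_norm_sq (E := ℝ) (μ := volume) (r := 2 - γ)
    (by simp; linarith)
  refine Integrable.mono' h.integrableOn ?_ ?_
  · exact Measurable.aestronglyMeasurable (by fun_prop)
  · filter_upwards [ae_restrict_mem measurableSet_Ioi] with u hu
    have hu' : (0 : ℝ) < u := hu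
    have hp : (0 : ℝ) < 1 + u ^ 2 := by positivity
    rw [Real.norm_of_nonneg (by positivity), Real.norm_eq_abs, sq_abs,
      show -(2 - γ) / 2 = γ / 2 - 1 by ring, Real.rpow_sub_one hp.ne', div_eq_inv_mul]
    refine mul_le_mul_of_nonneg_left ?_ (by positivity)
    calc u ^ γ = (u ^ 2) ^ (γ / 2) := by
          rw [← Real.rpow_natCast, ← Real.rpow_mul hu'.le]; congr 1; push_cast; ring
      _ ≤ _ := Real.rpow_le_rpow (by positivity) (by linarith) (by linarith)

/-- Write `1 / (1 + u²)` as the integral of `exp (-(1 + u²) t)` over `t > 0` and exchange. The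
integrals in `u` and then `t` produce `Γ((γ + 1) / 2) Γ((1 - γ) / 2)`, and the reflection formula
gives the cosine. -/
theorem integral_rpow_div_one_add_sq {γ : ℝ} (h0 : 0 ≤ γ) (h1 : γ < 1) :
    ∫ u in Set.Ioi (0 : ℝ), (1 + u ^ 2)⁻¹ * u ^ γ = Real.pi / (2 * Real.cos (Real.pi * γ / 2)) := by
  have hexp : ∀ u : ℝ, ∫ t in Set.Ioi (0 : ℝ), u ^ γ * Real.exp (-(1 + u ^ 2) * t) =
      (1 + u ^ 2)⁻¹ * u ^ γ := fun u => by
    have hp : (0 : ℝ) < 1 + u ^ 2 := by positivity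
    rw [integral_const_mul, integral_exp_mul_Ioi (by linarith), mul_zero, Real.exp_zero,
      neg_div_neg_eq, one_div, mul_comm]
  have hint : Integrable (Function.uncurry fun u t : ℝ => u ^ γ * Real.exp (-(1 + u ^ 2) * t))
      ((volume.restrict (Set.Ioi 0)).prod (volume.restrict (Set.Ioi 0))) := by
    rw [integrable_prod_iff (Measurable.aestronglyMeasurable (by fun_prop))]
    constructor
    · refine Eventually.of_forall fun u => ?_
      have hp : (0 : ℝ) < 1 + u ^ 2 := by positivity
      exact (integrableOn_exp_mul_Ioi (neg_neg_of_pos hp) 0).const_mul (u ^ γ)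
    · refine IntegrableOn.congr_fun (integrableOn_rpow_div_one_add_sq h0 h1) (fun u hu => ?_)
        measurableSet_Ioi
      rw [← hexp u]
      congr 1; ext t
      rw [Function.uncurry_apply_pair, Real.norm_of_nonneg
        (mul_nonneg (Real.rpow_nonneg (le_of_lt hu) _) (Real.exp_pos _).le)]
  have hsw := integral_integral_swap hint
  simp only [hexp] at hsw
  rw [hsw]
  have hin : ∀ t ∈ Set.Ioi (0 : ℝ), ∫ u in Set.Ioi (0 : ℝ), u ^ γ * Real.exp (-(1 + u ^ 2) * t) =
      (1 / 2 * Real.Gamma ((γ + 1) / 2)) * (Real.exp (-t) * t ^ ((1 - γ) / 2 - 1)) := by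
    intro t ht
    have h := integral_rpow_mul_exp_neg_mul_rpow (p := 2) (q := γ) (b := t) two_pos (by linarith) ht
    have h2 : ∀ u : ℝ, u ^ γ * Real.exp (-(1 + u ^ 2) * t) =
        Real.exp (-t) * (u ^ γ * Real.exp (-t * u ^ (2 : ℝ))) := fun u => by
      rw [Real.rpow_two, mul_left_comm, ← Real.exp_add]; congr 2; ring
    simp only [h2]
    rw [integral_const_mul, h, show -(γ + 1) / 2 = (1 - γ) / 2 - 1 by ring]
    ring
  rw [setIntegral_congr_fun measurableSet_Ioi hin, integral_const_mul,
    ← Real.Gamma_eq_integral (by linarith)]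
  have hr := Real.Gamma_mul_Gamma_one_sub ((γ + 1) / 2)
  rw [show 1 - (γ + 1) / 2 = (1 - γ) / 2 by ring,
    show Real.pi * ((γ + 1) / 2) = Real.pi * γ / 2 + Real.pi / 2 by ring, Real.sin_add_pi_div_two] at hr
  rw [mul_assoc, hr]
  field_simp

/-- Near `0` the limit gives the bound; for `s ≥ δ` the trivial bound `2` is at most `2 (s / δ) ^
p`. The global bound is what dominates the rescaled integrals. -/
theorem exists_one_sub_charFun_re_le {m : Measure ℝ} [IsProbabilityMeasure m] {p K : ℝ}
    (hp : 0 < p)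
    (h : Tendsto (fun s => (1 - (charFun m s).re) / s ^ p) (𝓝[>] 0) (𝓝 K)) :
    ∃ A : ℝ, ∀ s, 0 < s → 1 - (charFun m s).re ≤ A * s ^ p := by
  have h1 := h.eventually (gt_mem_nhds (lt_add_one K))
  obtain ⟨δ, hδ, hs⟩ := mem_nhdsGT_iff_exists_Ioo_subset.1 h1
  have hδ0 : (0 : ℝ) < δ := hδ
  have hδp := Real.rpow_pos_of_pos hδ0 p
  refine ⟨max (K + 1) (2 / δ ^ p), fun s hs0 => ?_⟩
  have hsp := Real.rpow_pos_of_pos hs0 p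
  rcases lt_or_ge s δ with h2 | h2
  · have h3 : (1 - (charFun m s).re) / s ^ p < K + 1 := hs ⟨hs0, h2⟩
    rw [div_lt_iff₀ hsp] at h3
    exact h3.le.trans (mul_le_mul_of_nonneg_right (le_max_left _ _) hsp.le)
  · have h3 : δ ^ p ≤ s ^ p := Real.rpow_le_rpow hδ0.le h2 hp.le
    have h4 : 1 - (charFun m s).re ≤ 2 := by linarith [(abs_le.1 (abs_charFun_re_le m s)).1]
    calc 1 - (charFun m s).re ≤ 2 / δ ^ p * δ ^ p := by rwa [div_mul_cancel₀ _ hδp.ne']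
      _ ≤ 2 / δ ^ p * s ^ p := by gcongr
      _ ≤ _ := mul_le_mul_of_nonneg_right (le_max_right _ _) hsp.le

theorem tendsto_integral_mul_one_sub_charFun_re {m : Measure ℝ} [IsProbabilityMeasure m] {p K : ℝ}
    (hp : 0 < p) {k : ℝ → ℝ} (hk : Measurable k) (hk0 : ∀ u, 0 < u → 0 ≤ k u)
    (hki : IntegrableOn (fun u => k u * u ^ p) (Set.Ioi 0))
    (h : Tendsto (fun s => (1 - (charFun m s).re) / s ^ p) (𝓝[>] 0) (𝓝 K)) :
    Tendsto (fun s => (∫ u in Set.Ioi 0, k u * (1 - (charFun m (s * u)).re)) / s ^ p) (𝓝[>] 0)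
      (𝓝 (K * ∫ u in Set.Ioi 0, k u * u ^ p)) := by
  obtain ⟨A, hA⟩ := exists_one_sub_charFun_re_le hp h
  have hcont := continuous_charFun_re m
  rw [← integral_const_mul]
  simp only [← integral_div]
  refine tendsto_integral_filter_of_dominated_convergence (fun u => A * (k u * u ^ p)) ?_ ?_
    (hki.const_mul A) ?_
  · exact Eventually.of_forall fun s => Measurable.aestronglyMeasurable (by fun_prop)
  · filter_upwards [self_mem_nhdsWithin] with s hs
    have hs' : (0 : ℝ) < s := hs
    have hsp := Real.rpow_pos_of_pos hs' p
    filter_upwards [ae_restrict_mem measurableSet_Ioi] with u hu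
    have hu' : (0 : ℝ) < u := hu
    have h1 := hA (s * u) (mul_pos hs' hu')
    have h2 : 0 ≤ 1 - (charFun m (s * u)).re := by
      linarith [(abs_le.1 (abs_charFun_re_le m (s * u))).2]
    rw [Real.norm_of_nonneg (div_nonneg (mul_nonneg (hk0 u hu') h2) hsp.le), div_le_iff₀ hsp]
    rw [Real.mul_rpow hs'.le hu'.le] at h1
    calc k u * (1 - (charFun m (s * u)).re) ≤ k u * (A * (s ^ p * u ^ p)) :=
          mul_le_mul_of_nonneg_left h1 (hk0 u hu')
      _ = _ := by ring
  · filter_upwards [ae_restrict_mem measurableSet_Ioi] with u hu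
    have hu' : (0 : ℝ) < u := hu
    have hlim : Tendsto (fun s => s * u) (𝓝[>] 0) (𝓝[>] 0) := by
      refine tendsto_nhdsWithin_iff.2 ⟨?_, ?_⟩
      · have : Tendsto (fun s => s * u) (𝓝[>] 0) (𝓝 (0 * u)) :=
          (Continuous.tendsto (by fun_prop) 0).mono_left nhdsWithin_le_nhds
        simpa using this
      · filter_upwards [self_mem_nhdsWithin] with s hs using mul_pos hs hu'
    refine ((h.comp hlim).mul_const (k u * u ^ p)).congr' ?_
    filter_upwards [self_mem_nhdsWithin] with s hs
    have hs' : (0 : ℝ) < s := hs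
    have hsp := (Real.rpow_pos_of_pos hs' p).ne'
    have hup := (Real.rpow_pos_of_pos hu' p).ne'
    simp only [Function.comp]
    rw [Real.mul_rpow hs'.le hu'.le]
    field_simp

theorem integral_mul_one_sub_charFun_re {m : Measure ℝ} [IsProbabilityMeasure m] {k : ℝ → ℝ}
    (hki : IntegrableOn k (Set.Ioi 0)) (s : ℝ) :
    ∫ u in Set.Ioi 0, k u * (1 - (charFun m (s * u)).re) =
      ∫ x, (∫ u in Set.Ioi 0, k u * (1 - Real.cos (u * (s * x)))) ∂m := by
  have hint : Integrable (Function.uncurry fun u x : ℝ => k u * (1 - Real.cos (u * (s * x))))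
      ((volume.restrict (Set.Ioi 0)).prod m) := by
    have h1 : Integrable (fun z : ℝ × ℝ => k z.1) ((volume.restrict (Set.Ioi 0)).prod m) :=
      Integrable.comp_fst hki m
    refine Integrable.mul_bdd (c := 2) h1 (by fun_prop) (Eventually.of_forall fun z => ?_)
    rw [Real.norm_eq_abs, abs_le]
    constructor <;> linarith [Real.neg_one_le_cos (z.1 * (s * z.2)), Real.cos_le_one (z.1 * (s * z.2))]
  rw [← integral_integral_swap hint]
  congr 1; ext u
  rw [integral_const_mul, one_sub_charFun_re_eq]
  congr 2; ext x
  congr 2; ring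

/-- For `y ≤ 1` the difference is at most `2 y²` and `1 + y² ≤ 2`; for `y ≥ 1` it is at most `2` and
`y² / (1 + y²) ≥ 1/2`. The right side is four times a mixture of `1 - cos (t y)`. -/
theorem abs_one_sub_exp_neg_sub_sin_le {y : ℝ} (hy : 0 ≤ y) :
    |1 - Real.exp (-y) - Real.sin y| ≤ 4 * (y ^ 2 / (1 + y ^ 2)) := by
  have hp : (0 : ℝ) < 1 + y ^ 2 := by positivity
  rw [← mul_div_assoc, le_div_iff₀ hp]
  rcases le_total y 1 with h | h
  · have h1 := abs_le.1 (Real.abs_exp_sub_one_sub_id_le (x := -y) (by rwa [abs_neg, abs_of_nonneg hy]))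
    have h2 := Real.sin_le hy
    have h3 : y - y ^ 2 ≤ Real.sin y := by
      rcases hy.eq_or_lt with h0 | h0
      · rw [← h0]; simp
      · have := Real.sin_gt_sub_cube h0
        nlinarith [mul_nonneg (sq_nonneg y) (sub_nonneg.2 h)]
    have h4 : |1 - Real.exp (-y) - Real.sin y| ≤ 2 * y ^ 2 := by
      rw [abs_le]; constructor <;> nlinarith [h1.1, h1.2]
    have h5 : y ^ 2 ≤ 1 := by nlinarith
    nlinarith [mul_nonneg (abs_nonneg (1 - Real.exp (-y) - Real.sin y)) (sub_nonneg.2 h5)]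
  · have h4 : |1 - Real.exp (-y) - Real.sin y| ≤ 2 := by
      have h5 := Real.exp_pos (-y)
      have h6 : Real.exp (-y) ≤ 1 := Real.exp_le_one_iff.2 (by linarith)
      rw [abs_le]
      constructor <;> linarith [Real.neg_one_le_sin y, Real.sin_le_one y]
    nlinarith

/-- Only the real part `c cos (π γ / 2) θ ^ γ` of the expansion is used; the factor `cos (π γ / 2)`
cancels against the integral of `u ^ γ / (1 + u²)`, finite because `γ < 1`. -/
theorem tendsto_laplace_of_lt_one {m : Measure ℝ} [IsProbabilityMeasure m]
    (hpos : ∀ᵐ x ∂m, 0 ≤ x) {γ c : ℝ} (hγ0 : 0 < γ) (hγ1 : γ < 1)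
    (h : (fun θ : ℝ => charFun m θ
          - (1 - c * Complex.exp (-(Complex.I * (Real.pi / 2) * γ)) * (θ ^ γ : ℝ)))
        =o[𝓝[>] 0] fun θ : ℝ => θ ^ γ) :
    Tendsto (fun s => (1 - ∫ x, Real.exp (-(s * x)) ∂m) / s ^ γ) (𝓝[>] 0) (𝓝 c) := by
  have hcos : 0 < Real.cos (Real.pi * γ / 2) := by
    have hpi := Real.pi_pos
    refine Real.cos_pos_of_mem_Ioo ⟨?_, ?_⟩ <;> nlinarith
  have he : (Complex.exp (-(Complex.I * (Real.pi / 2) * γ))).re = Real.cos (Real.pi * γ / 2) := by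
    rw [show -(Complex.I * (Real.pi / 2) * γ) = ((-(Real.pi * γ / 2) : ℝ) : ℂ) * Complex.I by
      push_cast; ring, Complex.exp_ofReal_mul_I_re, Real.cos_neg]
  have h0 : Tendsto (fun s => (1 - (charFun m s).re) / s ^ γ) (𝓝[>] 0)
      (𝓝 (c * Real.cos (Real.pi * γ / 2))) := by
    have h1 : (fun s : ℝ => (1 - (charFun m s).re) - c * Real.cos (Real.pi * γ / 2) * s ^ γ)
        =o[𝓝[>] 0] fun s : ℝ => s ^ γ := by
      refine IsBigO.trans_isLittleO (IsBigO.of_bound 1 (Eventually.of_forall fun s => ?_)) h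
      rw [one_mul, Real.norm_eq_abs, ← abs_neg]
      refine le_trans (le_of_eq ?_) (Complex.abs_re_le_norm _)
      rw [Complex.sub_re, Complex.sub_re, Complex.one_re, Complex.re_mul_ofReal,
        Complex.re_ofReal_mul, he]
      congr 1; ring
    have h2 := h1.tendsto_div_nhds_zero.add_const (c * Real.cos (Real.pi * γ / 2))
    rw [zero_add] at h2
    refine h2.congr' ?_
    filter_upwards [self_mem_nhdsWithin] with s hs
    have : s ^ γ ≠ 0 := (Real.rpow_pos_of_pos hs γ).ne'
    field_simp
    ring
  have h1 := (tendsto_integral_mul_one_sub_charFun_re hγ0 (k := fun u => (1 + u ^ 2)⁻¹)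
    (by fun_prop) (fun u _ => by positivity) (integrableOn_rpow_div_one_add_sq hγ0.le hγ1)
    h0).const_mul (2 / Real.pi)
  rw [integral_rpow_div_one_add_sq hγ0.le hγ1] at h1
  have hpi := Real.pi_pos
  have e : 2 / Real.pi * (c * Real.cos (Real.pi * γ / 2) *
      (Real.pi / (2 * Real.cos (Real.pi * γ / 2)))) = c := by
    field_simp
  rw [e] at h1
  refine h1.congr' ?_
  filter_upwards [self_mem_nhdsWithin] with s hs
  have hs' : (0 : ℝ) < s := hs
  rw [integral_mul_one_sub_charFun_re integrable_inv_one_add_sq.integrableOn]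
  have h2 : ∀ᵐ x ∂m, ∫ u in Set.Ioi (0 : ℝ), (1 + u ^ 2)⁻¹ * (1 - Real.cos (u * (s * x))) =
      Real.pi / 2 * (1 - Real.exp (-(s * x))) := by
    filter_upwards [hpos] with x hx
    exact integral_Ioi_one_sub_cos_div_one_add_sq (by positivity)
  rw [integral_congr_ae h2, integral_const_mul,
    integral_sub (integrable_const _) (integrable_exp_neg_mul hpos hs'.le)]
  simp
  field_simp

/-- The kernel `1 / (1 + u²)` is not integrable against `u`, so the mean is taken from the imaginary
part `E sin (s X) ~ μ s`. The error in replacing `1 - exp (-s X)` by `sin (s X)` is controlled by `1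
- Re φ(s t)` averaged over `exp (-t)`, which is `o(s)`. -/
theorem tendsto_laplace_of_mean {m : Measure ℝ} [IsProbabilityMeasure m]
    (hpos : ∀ᵐ x ∂m, 0 ≤ x) {μ : ℝ}
    (h : (fun θ : ℝ => charFun m θ - (1 + Complex.I * μ * θ)) =o[𝓝[>] 0] fun θ : ℝ => θ) :
    Tendsto (fun s => (1 - ∫ x, Real.exp (-(s * x)) ∂m) / s) (𝓝[>] 0) (𝓝 μ) := by
  have hre : Tendsto (fun s => (1 - (charFun m s).re) / s ^ (1 : ℝ)) (𝓝[>] 0) (𝓝 0) := by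
    have h1 : (fun s : ℝ => 1 - (charFun m s).re) =o[𝓝[>] 0] fun s : ℝ => s := by
      refine IsBigO.trans_isLittleO (IsBigO.of_bound 1 (Eventually.of_forall fun s => ?_)) h
      rw [one_mul, Real.norm_eq_abs, ← abs_neg]
      refine le_trans (le_of_eq ?_) (Complex.abs_re_le_norm _)
      simp
    simpa using h1.tendsto_div_nhds_zero
  have him : Tendsto (fun s => (charFun m s).im / s) (𝓝[>] 0) (𝓝 μ) := by
    have h1 : (fun s : ℝ => (charFun m s).im - μ * s) =o[𝓝[>] 0] fun s : ℝ => s := by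
      refine IsBigO.trans_isLittleO (IsBigO.of_bound 1 (Eventually.of_forall fun s => ?_)) h
      rw [one_mul, Real.norm_eq_abs]
      refine le_trans (le_of_eq ?_) (Complex.abs_im_le_norm _)
      simp
    have h2 := h1.tendsto_div_nhds_zero.add_const μ
    rw [zero_add] at h2
    refine h2.congr' ?_
    filter_upwards [self_mem_nhdsWithin] with s hs
    have hs' : s ≠ 0 := ne_of_gt hs
    field_simp
    ring
  have hki : IntegrableOn (fun u : ℝ => Real.exp (-u) * u ^ (1 : ℝ)) (Set.Ioi 0) := by
    have := Real.GammaIntegral_convergent (s := 2) two_pos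
    rwa [show (2 : ℝ) - 1 = 1 by norm_num] at this
  have h1 := (tendsto_integral_mul_one_sub_charFun_re one_pos (k := fun u => Real.exp (-u))
    (by fun_prop) (fun u _ => (Real.exp_pos _).le) hki hre).const_mul 4
  rw [zero_mul, mul_zero] at h1
  have hdiff : Tendsto (fun s => (1 - ∫ x, Real.exp (-(s * x)) ∂m) / s - (charFun m s).im / s)
      (𝓝[>] 0) (𝓝 0) := by
    refine squeeze_zero_norm' ?_ h1
    filter_upwards [self_mem_nhdsWithin] with s hs
    have hs' : (0 : ℝ) < s := hs
    have hi1 := integrable_exp_neg_mul hpos hs'.le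
    have hi2 := integrable_sin_mul m s
    have e1 : (1 - ∫ x, Real.exp (-(s * x)) ∂m) - (charFun m s).im =
        ∫ x, (1 - Real.exp (-(s * x)) - Real.sin (s * x)) ∂m := by
      have h3 : Integrable (fun x => 1 - Real.exp (-(s * x))) m := (integrable_const 1).sub hi1
      rw [integral_sub h3 hi2, integral_sub (integrable_const _) hi1, charFun_im_eq]
      simp
    rw [integral_mul_one_sub_charFun_re integrableOn_exp_neg_Ioi_zero]
    simp only [integral_exp_neg_mul_one_sub_cos]
    rw [← sub_div, e1, norm_div, Real.norm_of_nonneg hs'.le, Real.rpow_one, ← mul_div_assoc,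
      ← integral_const_mul]
    refine div_le_div_of_nonneg_right ?_ hs'.le
    refine norm_integral_le_of_norm_le ?_ ?_
    · refine (Integrable.of_bound (C := 1) (Measurable.aestronglyMeasurable (by fun_prop))
        (Eventually.of_forall fun x => ?_)).const_mul 4
      rw [Real.norm_of_nonneg (by positivity), div_le_one (by positivity)]
      linarith
    · filter_upwards [hpos] with x hx
      exact abs_one_sub_exp_neg_sub_sin_le (by positivity)
  have h4 := hdiff.add him
  rw [zero_add] at h4
  exact h4.congr fun s => by ring

/-! ### The ladder height in the medium. -/

theorem firstLadderTime_eq_succ_iff (x : ℕ → ℤ) (n : ℕ) :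
    firstLadderTime x = n + 1 ↔ x ∈ ladderAt n := by
  constructor
  · intro h
    -- The infimum of the empty set is `0`, so a positive value certifies that the walk does enter
    -- `(0, ∞)`.
    have hne : {n : ℕ | 0 < n ∧ 0 < walk x n}.Nonempty := by
      by_contra hne
      rw [Set.not_nonempty_iff_eq_empty] at hne
      rw [firstLadderTime, hne, Nat.sInf_empty] at h
      omega
    have hmem := Nat.sInf_mem hne
    rw [show sInf {n : ℕ | 0 < n ∧ 0 < walk x n} = n + 1 from h] at hmem
    refine ⟨fun m hm hmn => ?_, hmem.2⟩
    have := Nat.notMem_of_lt_sInf (s := {n : ℕ | 0 < n ∧ 0 < walk x n}) (m := m)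
      (lt_of_lt_of_eq (Nat.lt_succ_of_le hmn) h.symm)
    exact not_lt.1 fun hw => this ⟨hm, hw⟩
  · rintro ⟨h1, h2⟩
    refine IsLeast.csInf_eq ⟨⟨Nat.succ_pos n, h2⟩, fun m hm => ?_⟩
    by_contra! hlt
    exact absurd (h1 m hm.1 (Nat.lt_succ_iff.1 hlt)) (not_le.2 hm.2)

theorem measurable_firstLadderTime : Measurable firstLadderTime := by
  have hs : ∀ n : ℕ, MeasurableSet (firstLadderTime ⁻¹' {n + 1}) := fun n => by
    have : firstLadderTime ⁻¹' {n + 1} = ladderAt n := by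
      ext x; exact firstLadderTime_eq_succ_iff x n
    rw [this]; exact measurableSet_ladderAt n
  refine measurable_to_countable' fun n => ?_
  cases n with
  | zero =>
    have : firstLadderTime ⁻¹' {0} = (⋃ n : ℕ, firstLadderTime ⁻¹' {n + 1})ᶜ := by
      ext x
      simp only [Set.mem_preimage, Set.mem_singleton_iff, Set.mem_compl_iff, Set.mem_iUnion,
        not_exists]
      exact ⟨fun h n => by omega, fun h => by
        by_contra h0
        exact h (firstLadderTime x - 1) (by omega)⟩
    rw [this]
    exact (MeasurableSet.iUnion hs).compl
  | succ n => exact hs n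

/-- The position of the walk at its first ladder time. -/
def ladderSite (x : ℕ → ℤ) : ℤ := walk x (firstLadderTime x)

theorem ladderSite_of_mem {x : ℕ → ℤ} {n : ℕ} (h : x ∈ ladderAt n) :
    ladderSite x = walk x (n + 1) := by
  rw [ladderSite, (firstLadderTime_eq_succ_iff x n).2 h]

/-- Valid for every path: the default time `0` gives the site `0`. Hence the medium is only ever
summed over positive indices. -/
theorem ladderSite_nonneg (x : ℕ → ℤ) : 0 ≤ ladderSite x := by
  rcases Nat.eq_zero_or_pos (firstLadderTime x) with h | h
  · simp [ladderSite, h, walk]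
  · obtain ⟨n, hn⟩ := Nat.exists_eq_succ_of_ne_zero h.ne'
    have hm := (firstLadderTime_eq_succ_iff x n).1 hn
    rw [ladderSite_of_mem hm]
    exact le_of_lt hm.2

theorem measurable_ladderSite : Measurable ladderSite := by
  have h : Measurable fun p : ℕ × (ℕ → ℤ) => walk p.2 p.1 :=
    measurable_from_prod_countable_right fun n => measurable_walk n
  exact h.comp (measurable_firstLadderTime.prodMk measurable_id)

theorem firstLadderHeight_eq_medium (x : ℕ → ℤ) (y : ℤ → ℝ) :
    firstLadderHeight x y = medium y (ladderSite x) := rfl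

theorem measurable_medium (k : ℤ) : Measurable fun y : ℤ → ℝ => medium y k := by
  unfold medium
  fun_prop

theorem measurable_firstLadderHeight :
    Measurable fun p : (ℕ → ℤ) × (ℤ → ℝ) => firstLadderHeight p.1 p.2 := by
  have h : Measurable fun p : ℤ × (ℤ → ℝ) => medium p.2 p.1 :=
    measurable_from_prod_countable_right measurable_medium
  have h1 : Measurable fun p : (ℕ → ℤ) × (ℤ → ℝ) => (ladderSite p.1, p.2) :=
    (measurable_ladderSite.comp measurable_fst).prodMk measurable_snd
  simp only [firstLadderHeight_eq_medium]
  exact Measurable.comp (g := fun p : ℤ × (ℤ → ℝ) => medium p.2 p.1)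
    (f := fun p : (ℕ → ℤ) × (ℤ → ℝ) => (ladderSite p.1, p.2)) h h1

theorem medium_of_nonneg (y : ℤ → ℝ) {k : ℤ} (hk : 0 ≤ k) :
    medium y k = ∑ j ∈ Finset.Ioc 0 k, y j := by
  rw [medium, Finset.Ioc_eq_empty (a := k) (by omega), Finset.sum_empty, sub_zero]

section Height

variable {Ω : Type*} [MeasurableSpace Ω] {P : Measure Ω}
  {ξ : ℕ → Ω → ℤ} {ζ : ℤ → Ω → ℝ}

theorem integral_exp_neg_medium (hζ_meas : ∀ k, Measurable (ζ k)) (hζ_indep : iIndepFun ζ P)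
    (hζ_ident : ∀ k, IdentDistrib (ζ k) (ζ 0) P P) (s : ℝ) {k : ℤ} (hk : 0 ≤ k) :
    ∫ a, Real.exp (-(s * medium (fun j => ζ j a) k)) ∂P =
      (∫ a, Real.exp (-(s * ζ 0 a)) ∂P) ^ k.toNat := by
  have h := hζ_indep.mgf_sum hζ_meas (Finset.Ioc 0 k) (t := -s)
  have h2 : ∀ j, mgf (ζ j) P (-s) = ∫ a, Real.exp (-(s * ζ 0 a)) ∂P := fun j => by
    rw [mgf]
    have := ((hζ_ident j).comp (u := fun y => Real.exp (-s * y)) (by fun_prop)).integral_eq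
    simpa [Function.comp_def] using this
  simp only [h2, Finset.prod_const, Int.card_Ioc, sub_zero] at h
  rw [← h, mgf]
  congr 1; ext a
  simp only [medium_of_nonneg _ hk, Finset.sum_apply, neg_mul]

theorem firstLadderHeight_nonneg_ae (hζ_pos : ∀ k, ∀ᵐ a ∂P, 0 < ζ k a) :
    ∀ᵐ a ∂P, 0 ≤ firstLadderHeight (fun k => ξ k a) (fun k => ζ k a) := by
  filter_upwards [ae_all_iff.2 hζ_pos] with a ha
  rw [firstLadderHeight_eq_medium, medium_of_nonneg _ (ladderSite_nonneg fun k => ξ k a)]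
  exact Finset.sum_nonneg fun j _ => (ha j).le

variable [IsProbabilityMeasure P]

theorem integral_indepFun_prod {X Y : Type*} [MeasurableSpace X] [MeasurableSpace Y]
    {f : Ω → X} {h : Ω → Y} (hf : Measurable f) (hh : Measurable h) (hfh : IndepFun f h P)
    {g : X × Y → ℝ} (hg : Measurable g) {C : ℝ} (hC : ∀ᵐ a ∂P, ‖g (f a, h a)‖ ≤ C) :
    ∫ a, g (f a, h a) ∂P = ∫ a, ∫ b, g (f a, h b) ∂P ∂P := by
  have hmap := (indepFun_iff_map_prod_eq_prod_map_map hf.aemeasurable hh.aemeasurable).1 hfh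
  have := Measure.isProbabilityMeasure_map (μ := P) hf.aemeasurable
  have := Measure.isProbabilityMeasure_map (μ := P) hh.aemeasurable
  have hi : Integrable g ((P.map f).prod (P.map h)) :=
    Integrable.of_bound hg.aestronglyMeasurable C (by
      rw [← hmap]
      exact (ae_map_iff (hf.prodMk hh).aemeasurable (measurableSet_le hg.norm measurable_const)).2 hC)
  rw [← integral_map (hf.prodMk hh).aemeasurable hg.aestronglyMeasurable, hmap,
    integral_prod _ hi, integral_map hf.aemeasurable
      hg.stronglyMeasurable.integral_prod_right'.aestronglyMeasurable]
  congr 1; ext a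
  exact integral_map hh.aemeasurable (hg.comp measurable_prodMk_left).aestronglyMeasurable

/-- With the walk frozen by Fubini, the height is a sum of `ladderSite` many independent copies of
`ζ`, whose Laplace transform is a power. -/
theorem integral_exp_neg_firstLadderHeight (hξ_meas : ∀ k, Measurable (ξ k))
    (hζ_meas : ∀ k, Measurable (ζ k)) (hζ_indep : iIndepFun ζ P)
    (hζ_ident : ∀ k, IdentDistrib (ζ k) (ζ 0) P P)
    (hζ_pos : ∀ k, ∀ᵐ a ∂P, 0 < ζ k a)
    (hξζ : IndepFun (fun a k => ξ k a) (fun a k => ζ k a) P) {s : ℝ} (hs : 0 ≤ s) :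
    ∫ a, Real.exp (-(s * firstLadderHeight (fun k => ξ k a) (fun k => ζ k a))) ∂P =
      ∫ a, (∫ b, Real.exp (-(s * ζ 0 b)) ∂P) ^ (ladderSite fun k => ξ k a).toNat ∂P := by
  have hg : Measurable fun p : (ℕ → ℤ) × (ℤ → ℝ) =>
      Real.exp (-(s * firstLadderHeight p.1 p.2)) :=
    ((measurable_firstLadderHeight.const_mul s).neg).exp
  have h := integral_indepFun_prod (f := fun a k => ξ k a) (h := fun a k => ζ k a)
    (g := fun p : (ℕ → ℤ) × (ℤ → ℝ) => Real.exp (-(s * firstLadderHeight p.1 p.2))) (C := 1)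
    (measurable_pi_lambda _ hξ_meas) (measurable_pi_lambda _ hζ_meas) hξζ hg (by
      filter_upwards [firstLadderHeight_nonneg_ae (ξ := ξ) hζ_pos] with a ha
      rw [Real.norm_of_nonneg (Real.exp_pos _).le, Real.exp_le_one_iff]
      exact neg_nonpos.2 (mul_nonneg hs ha))
  rw [h]
  congr 1; ext a
  simp only [firstLadderHeight_eq_medium]
  exact integral_exp_neg_medium hζ_meas hζ_indep hζ_ident s (ladderSite_nonneg fun k => ξ k a)

/-- The generating function at `z = 1` never exceeds the probability that a ladder epoch exists, yet
it tends to `1` as `r → 1-` because `β > 0`. -/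
theorem ae_exists_mem_ladderAt (hξ_meas : ∀ k, Measurable (ξ k)) {β C : ℝ} (hβ0 : 0 < β)
    (h : Tendsto (fun r => (1 - ladderGen P ξ 1 r) / (1 - r) ^ (β / 2)) (𝓝[<] 1) (𝓝 C)) :
    ∀ᵐ a ∂P, ∃ n, (fun k => ξ k a) ∈ ladderAt n := by
  have hseq : Measurable fun a k => ξ k a := measurable_pi_lambda _ hξ_meas
  have h0 : Tendsto (fun r : ℝ => (1 - r) ^ (β / 2)) (𝓝[<] 1) (𝓝 0) := by
    have : Tendsto (fun r : ℝ => (1 - r) ^ (β / 2)) (𝓝[<] 1) (𝓝 ((1 - 1) ^ (β / 2))) :=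
      ((continuous_const.sub continuous_id).rpow_const fun _ =>
        Or.inr (by positivity)).continuousAt.tendsto.mono_left nhdsWithin_le_nhds
    rwa [sub_self, Real.zero_rpow (by positivity)] at this
  have h1 := h.mul h0
  rw [mul_zero] at h1
  set q := ∑' n : ℕ, P.real ((fun a k => ξ k a) ⁻¹' ladderAt n) with hq
  have hq1 : 1 - q ≤ 0 := by
    refine ge_of_tendsto h1 ?_
    filter_upwards [Ioo_mem_nhdsLT (zero_lt_one (α := ℝ))] with r hr
    have hr1 : 0 < 1 - r := by linarith [hr.2]
    rw [div_mul_cancel₀ _ (Real.rpow_pos_of_pos hr1 _).ne']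
    linarith [ladderGen_le (P := P) hξ_meas zero_le_one le_rfl hr.1.le hr.2.le]
  have hd : Pairwise (Function.onFun Disjoint fun n : ℕ => (fun a k => ξ k a) ⁻¹' ladderAt n) :=
    fun m n h => (pairwise_disjoint_ladderAt h).preimage _
  have hU := hasSum_integral_iUnion (μ := P) (f := fun _ => (1 : ℝ))
    (fun n => hseq (measurableSet_ladderAt n)) hd (integrable_const _).integrableOn
  simp only [integral_const, measureReal_restrict_apply_univ, smul_eq_mul, mul_one] at hU
  have hone : P.real (⋃ n : ℕ, (fun a k => ξ k a) ⁻¹' ladderAt n) = 1 :=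
    le_antisymm measureReal_le_one (by rw [← hU.tsum_eq]; linarith)
  have hm : MeasurableSet (⋃ n : ℕ, (fun a k => ξ k a) ⁻¹' ladderAt n) :=
    MeasurableSet.iUnion fun n => hseq (measurableSet_ladderAt n)
  have hc := (prob_compl_eq_zero_iff hm).2 (by
    rw [← ofReal_measureReal, hone, ENNReal.ofReal_one] : P _ = 1)
  filter_upwards [compl_mem_ae_iff.2 hc] with a ha
  rw [compl_compl] at ha
  simpa using ha

theorem integral_pow_ladderSite (hξ_meas : ∀ k, Measurable (ξ k))
    (h : ∀ᵐ a ∂P, ∃ n, (fun k => ξ k a) ∈ ladderAt n) {r : ℝ} (h0 : 0 ≤ r) (h1 : r ≤ 1) :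
    ∫ a, r ^ (ladderSite fun k => ξ k a).toNat ∂P = ladderGen P ξ 1 r := by
  have hseq : Measurable fun a k => ξ k a := measurable_pi_lambda _ hξ_meas
  have hd : Pairwise (Function.onFun Disjoint fun n : ℕ => (fun a k => ξ k a) ⁻¹' ladderAt n) :=
    fun m n h => (pairwise_disjoint_ladderAt h).preimage _
  have hm : Measurable fun a => r ^ (ladderSite fun k => ξ k a).toNat :=
    (measurable_of_countable fun k : ℤ => r ^ k.toNat).comp (measurable_ladderSite.comp hseq)
  have hi : Integrable (fun a => r ^ (ladderSite fun k => ξ k a).toNat) P :=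
    Integrable.of_bound hm.aestronglyMeasurable 1 (Eventually.of_forall fun a => by
      rw [norm_pow, Real.norm_of_nonneg h0]; exact pow_le_one₀ h0 h1)
  have hU := hasSum_integral_iUnion (μ := P)
    (fun n => hseq (measurableSet_ladderAt n)) hd hi.integrableOn
  have hae : (⋃ n : ℕ, (fun a k => ξ k a) ⁻¹' ladderAt n) =ᵐ[P] Set.univ := by
    refine ae_eq_univ.2 ?_
    rw [← ae_iff.1 h]
    congr 1
    ext a
    simp
  rw [← setIntegral_univ, ← setIntegral_congr_set hae, ← hU.tsum_eq, ladderGen]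
  refine tsum_congr fun n => ?_
  rw [one_pow, one_mul]
  refine setIntegral_congr_fun (hseq (measurableSet_ladderAt n)) fun a ha => ?_
  rw [ladderSite_of_mem ha]

/-- Substitute `r = L(s)` and factor the quotient as `(1 - E r^(S_𝒯)) / (1 - r)^(β/2)` times the
power `β/2` of `(1 - L(s)) / s ^ p`. -/
theorem tendsto_laplace_firstLadderHeight (hξ_meas : ∀ k, Measurable (ξ k))
    (hζ_meas : ∀ k, Measurable (ζ k)) (hζ_indep : iIndepFun ζ P)
    (hζ_ident : ∀ k, IdentDistrib (ζ k) (ζ 0) P P)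
    (hζ_pos : ∀ k, ∀ᵐ a ∂P, 0 < ζ k a)
    (hξζ : IndepFun (fun a k => ξ k a) (fun a k => ζ k a) P) {β C : ℝ} (hβ0 : 0 < β)
    (h : Tendsto (fun r => (1 - ladderGen P ξ 1 r) / (1 - r) ^ (β / 2)) (𝓝[<] 1) (𝓝 C))
    {p κ : ℝ} (hp : 0 < p) (hκ : 0 < κ)
    (hζ : Tendsto (fun s => (1 - ∫ a, Real.exp (-(s * ζ 0 a)) ∂P) / s ^ p) (𝓝[>] 0) (𝓝 κ)) :
    Tendsto (fun s => (1 - ∫ a, Real.exp (-(s *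
      firstLadderHeight (fun k => ξ k a) (fun k => ζ k a))) ∂P) / s ^ (p * β / 2)) (𝓝[>] 0)
      (𝓝 (C * κ ^ (β / 2))) := by
  have hae := ae_exists_mem_ladderAt hξ_meas hβ0 h
  have hsp : Tendsto (fun s : ℝ => s ^ p) (𝓝[>] 0) (𝓝 0) := by
    have : Tendsto (fun s : ℝ => s ^ p) (𝓝[>] 0) (𝓝 (0 ^ p)) :=
      (Real.continuousAt_rpow_const 0 p (Or.inr hp.le)).tendsto.mono_left nhdsWithin_le_nhds
    rwa [Real.zero_rpow hp.ne'] at this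
  -- Strictness comes from `κ > 0` and ensures that `L(s)` approaches `1` from below.
  have hpos : ∀ᶠ s in 𝓝[>] (0 : ℝ), 0 < 1 - ∫ a, Real.exp (-(s * ζ 0 a)) ∂P := by
    filter_upwards [hζ.eventually (lt_mem_nhds hκ), self_mem_nhdsWithin] with s h1 hs
    exact (div_pos_iff_of_pos_right (Real.rpow_pos_of_pos hs p)).1 h1
  have hlim : Tendsto (fun s => ∫ a, Real.exp (-(s * ζ 0 a)) ∂P) (𝓝[>] 0) (𝓝[<] 1) := by
    refine tendsto_nhdsWithin_iff.2 ⟨?_, ?_⟩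
    · have h1 := (hζ.mul hsp).const_sub 1
      rw [mul_zero, sub_zero] at h1
      refine h1.congr' ?_
      filter_upwards [self_mem_nhdsWithin] with s hs
      rw [div_mul_cancel₀ _ (Real.rpow_pos_of_pos hs p).ne', sub_sub_cancel]
    · filter_upwards [hpos] with s hs
      exact Set.mem_Iio.2 (by linarith)
  refine ((h.comp hlim).mul (hζ.rpow_const (p := β / 2) (Or.inl hκ.ne'))).congr' ?_
  filter_upwards [self_mem_nhdsWithin, hpos] with s hs h1
  have hs' : (0 : ℝ) < s := hs
  rw [integral_exp_neg_firstLadderHeight hξ_meas hζ_meas hζ_indep hζ_ident hζ_pos hξζ hs'.le,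
    integral_pow_ladderSite hξ_meas hae (integral_nonneg fun a => (Real.exp_pos _).le)
      (by linarith)]
  simp only [Function.comp]
  rw [Real.div_rpow h1.le (Real.rpow_nonneg hs'.le _), ← Real.rpow_mul hs'.le,
    mul_div_assoc p β 2]
  have := (Real.rpow_pos_of_pos h1 (β / 2)).ne'
  field_simp

end Height

theorem isEquivalent_of_tendsto_rpow_mul {F : ℝ → ℝ} {α K : ℝ} (hK : K ≠ 0)
    (h : Tendsto (fun x => x ^ α * F x) atTop (𝓝 K)) :
    F ~[atTop] fun x => K * x ^ (-α) := by
  refine isEquivalent_of_tendsto_one ?_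
  have h1 := h.div_const K
  rw [div_self hK] at h1
  refine h1.congr' ?_
  filter_upwards [eventually_gt_atTop 0] with x hx
  rw [Pi.div_apply, Real.rpow_neg hx.le]
  have := (Real.rpow_pos_of_pos hx α).ne'
  field_simp

end

/-! ### Assembly of the asymptotics. -/

theorem corollary4 {Ω : Type*} [MeasurableSpace Ω] (P : Measure Ω) [IsProbabilityMeasure P]
    -- the i.i.d. symmetric integer-valued increments of `S`
    (ξ : ℕ → Ω → ℤ) (hξ_meas : ∀ k, Measurable (ξ k)) (hξ_indep : iIndepFun ξ P)
    (hξ_ident : ∀ k, IdentDistrib (ξ k) (ξ 0) P P)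
    (hξ_symm : IdentDistrib (fun a => -ξ 0 a) (ξ 0) P P)
    -- the i.i.d. positive inter-distances, independent of `S`
    (ζ : ℤ → Ω → ℝ) (hζ_meas : ∀ k, Measurable (ζ k)) (hζ_indep : iIndepFun ζ P)
    (hζ_ident : ∀ k, IdentDistrib (ζ k) (ζ 0) P P)
    (hζ_pos : ∀ k, ∀ᵐ a ∂P, 0 < ζ k a)
    (hξζ : IndepFun (fun a k => ξ k a) (fun a k => ζ k a) P)
    -- the characteristic function of `ξ_1` is `1 - ν s ^ β + o(s ^ β)` as `s → 0+`
    (β ν : ℝ) (hβ0 : 0 < β) (hβ2 : β ≤ 2) (hν : 0 < ν)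
    (hξ_char : (fun s : ℝ => charFun (P.map (fun a => (ξ 0 a : ℝ))) s - (1 - ν * (s ^ β : ℝ)))
      =o[𝓝[>] 0] fun s : ℝ => s ^ β)
    (γ : ℝ) (hγ0 : 0 < γ) (hγ2 : γ ≤ 2) (hγ1 : γ ≠ 1) :
    -- the first-ladder time is almost surely finite
    (∀ᵐ a ∂P, ∃ n : ℕ, 0 < n ∧ 0 < walk (fun k => ξ k a) n) ∧
    -- `γ ∈ (1, 2]`, so that `min 1 γ = 1`
    (1 < γ → ∀ μ : ℝ, 0 < μ →
      ((fun θ : ℝ => charFun (P.map (ζ 0)) θ - (1 + Complex.I * μ * θ))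
        =o[𝓝[>] 0] fun θ : ℝ => θ) →
      (β < 2 →
        (fun x : ℝ => P.real {a | x < firstLadderHeight (fun k => ξ k a) (fun k => ζ k a)})
          ~[atTop] fun x : ℝ =>
            (√ν * μ ^ (β / 2) * ladderPhi (P.map (fun a => (ξ 0 a : ℝ))) 1
              / Real.Gamma (1 - β / 2)) * x ^ (-(min 1 γ * β / 2))) ∧
      -- for `β = 2` the constant is `0`, since `1 / Γ(0) = 0`
      (β = 2 →
        (fun x : ℝ => P.real {a | x < firstLadderHeight (fun k => ξ k a) (fun k => ζ k a)})
          =o[atTop] fun x : ℝ => x ^ (-(min 1 γ * β / 2)))) ∧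
    -- `γ ∈ (0, 1)`, so that `min 1 γ = γ`
    (γ < 1 → ∀ c : ℝ, 0 < c →
      ((fun θ : ℝ => charFun (P.map (ζ 0)) θ
          - (1 - c * Complex.exp (-(Complex.I * (Real.pi / 2) * γ)) * (θ ^ γ : ℝ)))
        =o[𝓝[>] 0] fun θ : ℝ => θ ^ γ) →
      (fun x : ℝ => P.real {a | x < firstLadderHeight (fun k => ξ k a) (fun k => ζ k a)})
        ~[atTop] fun x : ℝ =>
          (√ν * c ^ (β / 2) * ladderPhi (P.map (fun a => (ξ 0 a : ℝ))) 1
            / Real.Gamma (1 - γ * β / 2)) * x ^ (-(min 1 γ * β / 2))) := by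
  have hD := tendsto_one_sub_ladderGen_div hξ_meas hξ_indep hξ_ident hξ_symm hν hξ_char
  have hΦ : 0 < ladderPhi (P.map (fun a => (ξ 0 a : ℝ))) 1 := Real.exp_pos _
  set Φ := ladderPhi (P.map (fun a => (ξ 0 a : ℝ))) 1
  have hY : Measurable fun a => firstLadderHeight (fun k => ξ k a) (fun k => ζ k a) :=
    Measurable.comp (g := fun p : (ℕ → ℤ) × (ℤ → ℝ) => firstLadderHeight p.1 p.2)
      (f := fun a => (fun k => ξ k a, fun k => ζ k a)) measurable_firstLadderHeight
      ((measurable_pi_lambda _ hξ_meas).prodMk (measurable_pi_lambda _ hζ_meas))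
  have := Measure.isProbabilityMeasure_map (μ := P) hY.aemeasurable
  have := Measure.isProbabilityMeasure_map (μ := P) (hζ_meas 0).aemeasurable
  have hYpos : ∀ᵐ x ∂(P.map fun a => firstLadderHeight (fun k => ξ k a) (fun k => ζ k a)), 0 ≤ x :=
    (ae_map_iff hY.aemeasurable measurableSet_Ici).2 (firstLadderHeight_nonneg_ae hζ_pos)
  have hζpos : ∀ᵐ x ∂(P.map (ζ 0)), 0 ≤ x :=
    (ae_map_iff (hζ_meas 0).aemeasurable measurableSet_Ici).2
      ((hζ_pos 0).mono fun a ha => le_of_lt ha)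
  have hζmap : ∀ s : ℝ, ∫ x, Real.exp (-(s * x)) ∂(P.map (ζ 0)) =
      ∫ a, Real.exp (-(s * ζ 0 a)) ∂P := fun s =>
    integral_map (hζ_meas 0).aemeasurable (by fun_prop)
  have hYmap : ∀ s : ℝ, ∫ x, Real.exp (-(s * x)) ∂(P.map fun a =>
      firstLadderHeight (fun k => ξ k a) (fun k => ζ k a)) = ∫ a, Real.exp (-(s *
      firstLadderHeight (fun k => ξ k a) (fun k => ζ k a))) ∂P := fun s =>
    integral_map hY.aemeasurable (by fun_prop)
  have htail : ∀ x : ℝ, (P.map fun a =>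
      firstLadderHeight (fun k => ξ k a) (fun k => ζ k a)).real (Set.Ioi x) =
      P.real {a | x < firstLadderHeight (fun k => ξ k a) (fun k => ζ k a)} := fun x =>
    map_measureReal_apply hY measurableSet_Ioi
  refine ⟨?_, fun hγ μ hμ hζc => ?_, fun hγ c hc hζc => ?_⟩
  · filter_upwards [ae_exists_mem_ladderAt hξ_meas hβ0 hD] with a ⟨n, hn⟩
    exact ⟨n + 1, Nat.succ_pos n, hn.2⟩
  · have h1 := tendsto_laplace_of_mean hζpos hζc
    simp only [hζmap] at h1
    have h2 := tendsto_laplace_firstLadderHeight hξ_meas hζ_meas hζ_indep hζ_ident hζ_pos hξζ hβ0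
      hD one_pos hμ (by simpa only [Real.rpow_one] using h1)
    rw [one_mul] at h2
    rw [min_eq_left hγ.le, one_mul]
    refine ⟨fun hβ => ?_, fun hβ => ?_⟩
    · have h3 := tendsto_rpow_mul_tail hYpos (α := β / 2) (C := √ν * Φ * μ ^ (β / 2)) (by linarith) (by linarith)
        (by positivity) (by simpa only [hYmap] using h2)
      simp only [htail] at h3
      have hG : 0 < Real.Gamma (1 - β / 2) := Real.Gamma_pos_of_pos (by linarith)
      refine isEquivalent_of_tendsto_rpow_mul (by positivity) ?_
      rwa [mul_right_comm] at h3
    -- At `β = 2` the exponent is exactly `1`, outside the range of Karamata's theorem for the tail.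
    · have h3 := isLittleO_tail_of_tendsto hYpos (C := √ν * Φ * μ ^ (β / 2))
        (by simpa only [hYmap, hβ, div_self (two_ne_zero (α := ℝ)), Real.rpow_one] using h2)
      simp only [htail] at h3
      rw [hβ, div_self two_ne_zero]
      refine (isLittleO_iff_tendsto' ?_).2 (h3.congr' ?_)
      · filter_upwards [eventually_gt_atTop 0] with x hx h0
        exact absurd h0 (Real.rpow_pos_of_pos hx _).ne'
      · filter_upwards [eventually_gt_atTop 0] with x hx
        rw [Real.rpow_neg_one, div_inv_eq_mul, mul_comm]
  · have h1 := tendsto_laplace_of_lt_one hζpos hγ0 hγ hζc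
    simp only [hζmap] at h1
    have h2 := tendsto_laplace_firstLadderHeight hξ_meas hζ_meas hζ_indep hζ_ident hζ_pos hξζ hβ0
      hD hγ0 hc h1
    rw [min_eq_right hγ.le]
    -- Here `γ < 1` and `β ≤ 2` keep the exponent below `1`, so `β = 2` needs no separate treatment.
    have hα1 : γ * β / 2 < 1 := by nlinarith
    have h3 := tendsto_rpow_mul_tail hYpos (α := γ * β / 2) (C := √ν * Φ * c ^ (β / 2)) (by positivity) hα1
      (by positivity) (by simpa only [hYmap] using h2)
    simp only [htail] at h3
    have hG : 0 < Real.Gamma (1 - γ * β / 2) := Real.Gamma_pos_of_pos (by linarith)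
    refine isEquivalent_of_tendsto_rpow_mul (by positivity) ?_
    rwa [mul_right_comm] at h3
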